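/- **Setting.** Let $M$ be a compact smooth manifold without boundary and let $\Pi$ be a regular Poisson structure of rank $2k$ on $M$. Write $Z^\sharp:T^*M\to TM$, $\alpha\mapsto \iota_\alpha Z=Z(\alpha,\cdot)$, for a bivector field $Z$, and $T\mathcal F=\operatorname{im}\Pi^\sharp$. Let $\omega$ be the leafwise symplectic form with $\Pi=-\omega^{-1}$. Fix a smooth distribution $G$ with $TM=G\oplus T\mathcal F$, with projection $\operatorname{pr}_G$ onto $G$, and let $\gamma\in\Omega^2(M)$ be the extension of $\omega$ by zero on $G$, with $\gamma^\flat(X)=\iota_X\gamma$. A bivector field $Z$ lies in $\mathcal I_\gamma$ if $\mathrm{id}_{T^*M}+\gamma^\flat\circ Z^\sharp$ is invertible at every point; then $Z^\gamma$ is the bivector field with $(Z^\gamma)^\sharp=Z^\sharp\circ(\mathrm{id}_{T^*M}+\gamma^\flat\circ Z^\sharp)^{-1}$. The good multivector fields are $\mathfrak X^\bullet_{\mathcal F}(M)=\{W\in\mathfrak X^\bullet(M):\iota_\alpha\iota_\beta W=0 \text{ for all } \alpha,\beta\in\Gamma(T\mathcal F^{0})\}$, where $T\mathcal F^0$ is the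 annihilator of $T\mathcal F$. Then $\mathfrak X^\bullet_{\mathcal F}(M)[2]$ is an $L_\infty[1]$-algebra with brackets $$\mathfrak l^G_1(P)=[\Pi,P]_{SN},\qquad \mathfrak l^G_2(P,Q)=(-1)^{|P|}[P,Q]_\gamma,\qquad \mathfrak l^G_3(P,Q,R)=-(-1)^{|Q|}(P^\sharp\wedge Q^\sharp\wedge R^\sharp)\Upsilon .$$ Here $[\cdot,\cdot]_{SN}$ is the Schouten-Nijenhuis bracket; $[\cdot,\cdot]_\gamma$ is the extension by the graded Leibniz rule (with anchor $\operatorname{pr}_G$) of $$[X,Y]_\gamma=[\operatorname{pr}_GX,\operatorname{pr}_GY]-\Pi^\sharp\big(\mathcal L_{\operatorname{pr}_GX}\iota_Y\gamma-\mathcal L_{\operatorname{pr}_GY}\iota_X\gamma\big)$$ to multivector fields; $\Upsilon\in\Omega^3(M)$ is $$\Upsilon(X,Y,Z)=\gamma(X,[\operatorname{pr}_GY,\operatorname{pr}_GZ])+\gamma(Y,[\operatorname{pr}_GZ,\operatorname{pr}_GX])+\gamma(Z,[\operatorname{pr}_GX,\operatorname{pr}_GY]);$$ $P^\sharp$ denotes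 contraction of covectors with $P$, and $(P^\sharp\wedge Q^\sharp\wedge R^\sharp)(\xi_1\wedge\xi_2\wedge\xi_3)=\sum_{\sigma\in S_3}(-1)^\sigma P^\sharp(\xi_{\sigma(1)})\wedge Q^\sharp(\xi_{\sigma(2)})\wedge R^\sharp(\xi_{\sigma(3)})$. A Maurer-Cartan (MC) element is a $W\in\mathfrak X^2_{\mathcal F}(M)$ with $\mathfrak l^G_1(W)+\tfrac12\mathfrak l^G_2(W,W)+\tfrac16\mathfrak l^G_3(W,W,W)=0$. **Theorem.** Let $W_0,W_1$ be MC elements of $(\mathfrak X^\bullet_{\mathcal F}(M)[2],\{\mathfrak l^G_k\})$ lying in $\mathcal I_\gamma$, and put $\Pi_0=\Pi+(W_0)^\gamma$ and $\Pi_1=\Pi+(W_1)^\gamma$. The following are equivalent: (i) $W_0$ and $W_1$ are gauge equivalent through MC elements in $\mathcal I_\gamma$: there are a smooth family $(W_t)_{t\in[0,1]}$ of MC elements of $(\mathfrak X^\bullet_{\mathcal F}(M)[2],\{\mathfrak l^G_k\})$ lying in $\mathcal I_\gamma$, which interpolates between $W_0$ and $W_1$, and a smooth family $(X_t)_{t\in[0,1]}$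 of vector fields on $M$ such that for all $t\in[0,1]$ $$\frac{d}{dt}W_t=\mathfrak l^G_1(X_t)+\mathfrak l^G_2(X_t,W_t)+\tfrac12\mathfrak l^G_3(X_t,W_t,W_t);$$ (ii) there is a diffeomorphism $\psi$ of $M$ with $\psi_*\Pi_0=\Pi_1$ which is isotopic to $\mathrm{id}_M$ by a smooth isotopy $(\psi_t)_{t\in[0,1]}$, $\psi_0=\mathrm{id}_M$, $\psi_1=\psi$, such that $(\psi_t)_*(\operatorname{im}\Pi_0^\sharp)$ is transverse to $G$ for all $t\in[0,1]$. -/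

import Mathlib

open scoped Manifold ContDiff
open Set

noncomputable section

namespace RegPoisson

section Fields

variable {E : Type*} [NormedAddCommGroup E] [NormedSpace ℝ E] [FiniteDimensional ℝ E]
  {H : Type*} [TopologicalSpace H] (I : ModelWithCorners ℝ E H)
  {M : Type*} [TopologicalSpace M] [ChartedSpace H M]

instance finiteDimensional_tangentSpace (x : M) : FiniteDimensional ℝ (TangentSpace I x) :=
  inferInstanceAs (FiniteDimensional ℝ E)

/-- The cotangent space `T*_x M`. -/
abbrev Cotangent (x : M) : Type _ := Module.Dual ℝ (TangentSpace I x)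

variable (M)

/-- Not necessarily smooth vector fields. -/
abbrev VecField : Type _ := ∀ x : M, TangentSpace I x

/-- Not necessarily smooth one-forms. -/
abbrev OneForm : Type _ := ∀ x : M, Cotangent I x

/-- Not necessarily smooth fields of bilinear forms on the cotangent spaces. Skew-symmetric
bilinear forms on `T*_x M` are identified with elements of `∧² T_x M`, in such a way that
`(u ∧ v)(a, b) = a(u) b(v) - a(v) b(u)`. -/
abbrev BiField : Type _ := ∀ x : M, Cotangent I x →ₗ[ℝ] Cotangent I x →ₗ[ℝ] ℝ

variable {M}

/-- Smooth vector fields, the elements of `𝔛(M) = 𝔛¹(M)`. -/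
def SmoothVec [IsManifold I ∞ M] (X : VecField I M) : Prop :=
  ContMDiff I I.tangent ∞ (fun x => (⟨x, X x⟩ : TangentBundle I M))

/-- Smooth one-forms: those whose pairing with every smooth vector field is smooth. -/
def SmoothForm [IsManifold I ∞ M] (α : OneForm I M) : Prop :=
  ∀ X : VecField I M, SmoothVec I X → ContMDiff I 𝓘(ℝ, ℝ) ∞ (fun x => α x (X x))

/-- (Smooth) bivector fields, the elements of `𝔛²(M)`. -/
def IsBivectorField [IsManifold I ∞ M] (W : BiField I M) : Prop :=
  (∀ x a, W x a a = 0) ∧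
    ∀ α β : OneForm I M, SmoothForm I α → SmoothForm I β →
      ContMDiff I 𝓘(ℝ, ℝ) ∞ (fun x => W x (α x) (β x))

/-- A smooth distribution: through every vector of it there passes a smooth vector field
that is tangent to it. (Constancy of the rank is required separately.) -/
def SmoothDistribution [IsManifold I ∞ M] (D : ∀ x : M, Submodule ℝ (TangentSpace I x)) : Prop :=
  ∀ x, ∀ v ∈ D x, ∃ X : VecField I M, SmoothVec I X ∧ X x = v ∧ ∀ y, X y ∈ D y

/-- `W♯ : T*M → TM`, `a ↦ ι_a W = W(a, ·)`. -/
def sharp (W : BiField I M) (x : M) : Cotangent I x →ₗ[ℝ] TangentSpace I x :=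
  (Module.evalEquiv ℝ (TangentSpace I x)).symm.toLinearMap ∘ₗ W x

theorem apply_sharp (W : BiField I M) (x : M) (a b : Cotangent I x) :
    b (sharp I W x a) = W x a b := by
  have h : Module.evalEquiv ℝ (TangentSpace I x) (sharp I W x a) = W x a := by
    simp [sharp]
  have h2 := LinearMap.congr_fun h b
  simpa using h2

/-- `W♯ α` as a vector field, for a one-form `α`. -/
def sharpField (W : BiField I M) (α : OneForm I M) : VecField I M :=
  fun x => sharp I W x (α x)

/-- `X(f) = df(X)`. -/
def vderiv (X : VecField I M) (f : M → ℝ) (x : M) : ℝ :=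
  mfderiv I 𝓘(ℝ, ℝ) f x (X x)

/-- The Lie derivative of the one-form `η` along `X`, evaluated on `V`:
`(L_X η)(V) = X(η(V)) - η([X, V])`. -/
def lieForm (X : VecField I M) (η : OneForm I M) (V : VecField I M) (x : M) : ℝ :=
  vderiv I X (fun y => η y (V y)) x - η x (VectorField.mlieBracket I X V x)

end Fields

section Brackets

variable {E : Type*} [NormedAddCommGroup E] [NormedSpace ℝ E] [FiniteDimensional ℝ E]
  {H : Type*} [TopologicalSpace H] (I : ModelWithCorners ℝ E H)
  (M : Type*) [TopologicalSpace M] [ChartedSpace H M]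

/-- The anchor `ρ` and the bracket `[·,·]` (on sections) of an almost Lie algebroid structure on
`TM`, where the bracket is recorded through its pairing
`pairing X Y α = ⟨α, [X, Y]⟩` with one-forms. Only two such structures are used:
the standard one and the one defined by a splitting. -/
structure AlmostLieData where
  anchor : VecField I M → VecField I M
  pairing : VecField I M → VecField I M → OneForm I M → M → ℝ

/-- The tangent Lie algebroid: identity anchor and the Lie bracket of vector fields. -/
def tangentLie : AlmostLieData I M where
  anchor X := X
  pairing X Y α := fun x => α x (VectorField.mlieBracket I X Y x)

variable {I M}

namespace AlmostLieData

variable (A : AlmostLieData I M)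

/-- Lie derivative of a one-form, `(L_X α)(Y) = ρ(X)(α(Y)) - ⟨α, [X, Y]⟩`. -/
def lie (X : VecField I M) (α : OneForm I M) (Y : VecField I M) (x : M) : ℝ :=
  vderiv I (A.anchor X) (fun y => α y (Y y)) x - A.pairing X Y α x

/-- Exterior derivative of a one-form,
`(dα)(X, Y) = ρ(X)(α(Y)) - ρ(Y)(α(X)) - ⟨α, [X, Y]⟩`. -/
def d (α : OneForm I M) (X Y : VecField I M) (x : M) : ℝ :=
  vderiv I (A.anchor X) (fun y => α y (Y y)) x - vderiv I (A.anchor Y) (fun y => α y (X y)) x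
    - A.pairing X Y α x

/-- The extension `[X, W]` of the bracket to a vector field `X` and a bivector field `W`,
evaluated on one-forms `α, β`:
`[X, W](α, β) = ρ(X)(W(α, β)) - W(L_X α, β) - W(α, L_X β)`, where
`- W(L_X α, β) = (L_X α)(W♯β)` and `W(α, L_X β) = (L_X β)(W♯α)`.
It is the extension by the Leibniz rule: `[X, U ∧ V] = [X, U] ∧ V + U ∧ [X, V]`. -/
def bracketVB (X : VecField I M) (W : BiField I M) (α β : OneForm I M) (x : M) : ℝ :=
  vderiv I (A.anchor X) (fun y => W y (α y) (β y)) x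
    + A.lie X α (sharpField I W β) x - A.lie X β (sharpField I W α) x

/-- The extension `[P, Q]` of the bracket to two bivector fields, evaluated on one-forms:
`ι_α [P, Q] = [P♯α, Q] + [Q♯α, P] - (contraction of dα with P and Q)`.
It is the extension by the graded Leibniz rule: `[X ∧ Y, U ∧ V] =
[X, U] ∧ Y ∧ V - [X, V] ∧ Y ∧ U - [Y, U] ∧ X ∧ V + [Y, V] ∧ X ∧ U`. -/
def bracketBB (P Q : BiField I M) (α β δ : OneForm I M) (x : M) : ℝ :=
  A.bracketVB (sharpField I P α) Q β δ x + A.bracketVB (sharpField I Q α) P β δ x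
    - A.d α (sharpField I P β) (sharpField I Q δ) x
    - A.d α (sharpField I Q β) (sharpField I P δ) x

end AlmostLieData

/-- The Schouten-Nijenhuis bracket `[P, Q]_SN` of bivector fields, evaluated on one-forms. -/
def schoutenBB (P Q : BiField I M) : OneForm I M → OneForm I M → OneForm I M → M → ℝ :=
  (tangentLie I M).bracketBB P Q

/-- The Schouten-Nijenhuis bracket `[P, X]_SN = - [X, P]_SN = - L_X P` of a bivector field and a
vector field, evaluated on one-forms. -/
def schoutenBV (P : BiField I M) (X : VecField I M) (α β : OneForm I M) (x : M) : ℝ :=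
  - (tangentLie I M).bracketVB X P α β x

/-- `P` is a Poisson structure: a bivector field with `[P, P]_SN = 0`. -/
def IsPoisson [IsManifold I ∞ M] (P : BiField I M) : Prop :=
  IsBivectorField I P ∧
    ∀ α β δ : OneForm I M, SmoothForm I α → SmoothForm I β → SmoothForm I δ →
      ∀ x, schoutenBB P P α β δ x = 0

end Brackets

section Splitting

variable {E : Type*} [NormedAddCommGroup E] [NormedSpace ℝ E] [FiniteDimensional ℝ E]
  {H : Type*} [TopologicalSpace H] (I : ModelWithCorners ℝ E H)
  (M : Type*) [TopologicalSpace M] [ChartedSpace H M] [IsManifold I ∞ M]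

/-- A regular Poisson structure `Π` of rank `2k`, with characteristic distribution
`T𝓕 = im Π♯`, together with a smooth distribution `G` complementary to `T𝓕`. -/
structure SplitRegularPoisson where
  Pi : BiField I M
  isPoisson : IsPoisson Pi
  k : ℕ
  rank_eq : ∀ x, Module.finrank ℝ (LinearMap.range (sharp I Pi x)) = 2 * k
  G : ∀ x : M, Submodule ℝ (TangentSpace I x)
  smooth_G : SmoothDistribution I G
  isCompl : ∀ x, IsCompl (LinearMap.range (sharp I Pi x)) (G x)

namespace SplitRegularPoisson

variable {I M} (S : SplitRegularPoisson I M)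

/-- The characteristic distribution `T𝓕`. -/
def TF (x : M) : Submodule ℝ (TangentSpace I x) := LinearMap.range (sharp I S.Pi x)

/-- The projection of `TM = T𝓕 ⊕ G` onto `T𝓕`. -/
def prF (x : M) : TangentSpace I x →ₗ[ℝ] TangentSpace I x :=
  Submodule.projection _ _ (S.isCompl x)

/-- The projection of `TM = T𝓕 ⊕ G` onto `G`. -/
def prG (x : M) : TangentSpace I x →ₗ[ℝ] TangentSpace I x :=
  Submodule.projection _ _ (S.isCompl x).symm

/-- A linear right inverse of `Π♯ : T*_x M → T_x𝓕`. The two-form `γ` does not depend on it. -/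
def section_ (x : M) : LinearMap.range (sharp I S.Pi x) →ₗ[ℝ] Cotangent I x :=
  ((sharp I S.Pi x).rangeRestrict.exists_rightInverse_of_surjective
    (sharp I S.Pi x).range_rangeRestrict).choose

theorem sharp_section (x : M) (v : LinearMap.range (sharp I S.Pi x)) :
    sharp I S.Pi x (S.section_ x v) = v := by
  have h := ((sharp I S.Pi x).rangeRestrict.exists_rightInverse_of_surjective
    (sharp I S.Pi x).range_rangeRestrict).choose_spec
  exact congrArg Subtype.val (LinearMap.congr_fun h v)

/-- `γ♭ : TM → T*M`, `u ↦ γ(u, ·)`, where the two-form `γ` is the extension by zero on `G` of the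
leafwise symplectic form `ω` with `Π = - ω⁻¹`: it sends `u` to `- a ∘ pr_{T𝓕}`,
where `a` is a covector with `Π♯ a = pr_{T𝓕} u`. -/
def gammaFlat (x : M) : TangentSpace I x →ₗ[ℝ] Cotangent I x :=
  - ((S.prF x).dualMap ∘ₗ S.section_ x ∘ₗ Submodule.projectionOnto _ _ (S.isCompl x))

/-- `γ` vanishes on `G` in the first argument. -/
theorem gammaFlat_of_mem_G (x : M) {u : TangentSpace I x} (hu : u ∈ S.G x) :
    S.gammaFlat x u = 0 := by
  have h : Submodule.projectionOnto _ _ (S.isCompl x) u = 0 :=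
    (Submodule.projectionOnto_apply_eq_zero_iff (S.isCompl x)).2 hu
  simp [gammaFlat, h]

/-- `γ` vanishes on `G` in the second argument. -/
theorem gammaFlat_apply_of_mem_G (x : M) (u : TangentSpace I x) {v : TangentSpace I x}
    (hv : v ∈ S.G x) : S.gammaFlat x u v = 0 := by
  have h : S.prF x v = 0 :=
    (Submodule.projection_apply_eq_zero_iff (S.isCompl x)).2 hv
  simp [gammaFlat, h]

/-- On `T𝓕`, `γ♭ = ω♭` is minus the inverse of `Π♯ : T*𝓕 → T𝓕`. -/
theorem gammaFlat_sharp (x : M) (a : Cotangent I x) {v : TangentSpace I x} (hv : v ∈ S.TF x) :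
    S.gammaFlat x (sharp I S.Pi x a) v = - a v := by
  obtain ⟨b, rfl⟩ := hv
  have skew : ∀ c e : Cotangent I x, S.Pi x c e = - S.Pi x e c := by
    intro c e
    have h := S.isPoisson.1.1 x (c + e)
    simp only [map_add, LinearMap.add_apply, S.isPoisson.1.1 x] at h
    linarith
  have h1 : S.prF x (sharp I S.Pi x b) = sharp I S.Pi x b :=
    Submodule.projection_apply_of_mem_left (S.isCompl x) ⟨b, rfl⟩
  have h2 : Submodule.projectionOnto _ _ (S.isCompl x) (sharp I S.Pi x a) = ⟨sharp I S.Pi x a, a, rfl⟩ :=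
    Submodule.projectionOnto_apply_left (S.isCompl x) ⟨sharp I S.Pi x a, a, rfl⟩
  simp only [gammaFlat, LinearMap.neg_apply, LinearMap.comp_apply, LinearMap.dualMap_apply, h1, h2]
  rw [apply_sharp, apply_sharp, skew b, skew b, ← apply_sharp, ← apply_sharp, sharp_section]

/-- The two-form `γ`. -/
def gamma (x : M) (u v : TangentSpace I x) : ℝ := S.gammaFlat x u v

/-- `pr_G X` as a vector field. -/
def prGField (X : VecField I M) : VecField I M := fun x => S.prG x (X x)

/-- The one-form `ι_X γ`. -/
def gammaField (X : VecField I M) : OneForm I M := fun x => S.gammaFlat x (X x)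

/-- The almost Lie algebroid structure on `TM` with anchor `pr_G` and bracket
`[X, Y]_γ = [pr_G X, pr_G Y] - Π♯(L_{pr_G X} ι_Y γ - L_{pr_G Y} ι_X γ)`.
Here `⟨α, - Π♯ η⟩ = η(Π♯ α)` for one-forms `α, η`. -/
def gammaLie : AlmostLieData I M where
  anchor X := S.prGField X
  pairing X Y α := fun x =>
    α x (VectorField.mlieBracket I (S.prGField X) (S.prGField Y) x)
      + (lieForm I (S.prGField X) (S.gammaField Y) (sharpField I S.Pi α) x
        - lieForm I (S.prGField Y) (S.gammaField X) (sharpField I S.Pi α) x)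

/-- The three-form `Υ(X, Y, Z) = γ(X, [pr_G Y, pr_G Z]) + γ(Y, [pr_G Z, pr_G X])
+ γ(Z, [pr_G X, pr_G Y])`, the Courant tensor of `TM`. -/
def Upsilon (X Y Z : VecField I M) (x : M) : ℝ :=
  S.gamma x (X x) (VectorField.mlieBracket I (S.prGField Y) (S.prGField Z) x)
    + S.gamma x (Y x) (VectorField.mlieBracket I (S.prGField Z) (S.prGField X) x)
    + S.gamma x (Z x) (VectorField.mlieBracket I (S.prGField X) (S.prGField Y) x)

/-! Multibrackets `𝔩₁, 𝔩₂, 𝔩₃` of the `L∞[1]`-algebra `𝔛^•(M)[2]`, which restrict to the good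
multivector fields, on arguments in `𝔛¹(M)` (degree `-1`) and `𝔛²(M)` (degree `0`); these are the
only arguments that occur in the Maurer-Cartan equation and in the gauge equation. The values,
in `𝔛²(M)` and `𝔛³(M)`, are evaluated on two, respectively three one-forms. -/

/-- `𝔩₁(W) = [Π, W]_SN` for a bivector field `W`. -/
def l1B (W : BiField I M) (α β δ : OneForm I M) (x : M) : ℝ := schoutenBB S.Pi W α β δ x

/-- `𝔩₁(X) = [Π, X]_SN` for a vector field `X`. -/
def l1V (X : VecField I M) (α β : OneForm I M) (x : M) : ℝ := schoutenBV S.Pi X α β x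

/-- `𝔩₂(P, Q) = (-1)^{|P|} [P, Q]_γ = [P, Q]_γ` for bivector fields `P, Q`. -/
def l2BB (P Q : BiField I M) (α β δ : OneForm I M) (x : M) : ℝ :=
  S.gammaLie.bracketBB P Q α β δ x

/-- `𝔩₂(X, W) = (-1)^{|X|} [X, W]_γ = - [X, W]_γ` for a vector field `X` and a bivector
field `W`. -/
def l2VB (X : VecField I M) (W : BiField I M) (α β : OneForm I M) (x : M) : ℝ :=
  - S.gammaLie.bracketVB X W α β x

/-- `(P♯ ∧ Q♯ ∧ R♯)Υ` for bivector fields `P, Q, R`, evaluated on three one-forms. With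
`(P♯ ∧ Q♯ ∧ R♯)(a₀ ∧ a₁ ∧ a₂) = ∑_σ sgn(σ) P♯a_{σ0} ∧ Q♯a_{σ1} ∧ R♯a_{σ2}` and the skew-symmetry
of `P, Q, R`, its value on `(α₀, α₁, α₂)` is
`- ∑_τ sgn(τ) Υ(P♯α_{τ0}, Q♯α_{τ1}, R♯α_{τ2})`. -/
def sharpUpsilonBBB (P Q R : BiField I M) (α β δ : OneForm I M) (x : M) : ℝ :=
  - ∑ τ : Equiv.Perm (Fin 3), ((Equiv.Perm.sign τ : ℤ) : ℝ) *
      S.Upsilon (sharpField I P (![α, β, δ] (τ 0))) (sharpField I Q (![α, β, δ] (τ 1)))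
        (sharpField I R (![α, β, δ] (τ 2))) x

/-- `(X♯ ∧ Q♯ ∧ R♯)Υ` for a vector field `X` (with `X♯ a = a(X)`) and bivector fields `Q, R`,
evaluated on two one-forms: its value on `(α₀, α₁)` is
`∑_τ sgn(τ) Υ(X, Q♯α_{τ0}, R♯α_{τ1})`. -/
def sharpUpsilonVBB (X : VecField I M) (Q R : BiField I M) (α β : OneForm I M) (x : M) : ℝ :=
  ∑ τ : Equiv.Perm (Fin 2), ((Equiv.Perm.sign τ : ℤ) : ℝ) *
      S.Upsilon X (sharpField I Q (![α, β] (τ 0))) (sharpField I R (![α, β] (τ 1))) x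

/-- `𝔩₃(P, Q, R) = - (-1)^{|Q|} (P♯ ∧ Q♯ ∧ R♯)Υ` for bivector fields. -/
def l3BBB (P Q R : BiField I M) (α β δ : OneForm I M) (x : M) : ℝ :=
  - S.sharpUpsilonBBB P Q R α β δ x

/-- `𝔩₃(X, Q, R) = - (-1)^{|Q|} (X♯ ∧ Q♯ ∧ R♯)Υ` for a vector field `X` and bivector
fields `Q, R`. -/
def l3VBB (X : VecField I M) (Q R : BiField I M) (α β : OneForm I M) (x : M) : ℝ :=
  - S.sharpUpsilonVBB X Q R α β x

/-- `W` is a good bivector field, an element of `𝔛²_𝓕(M)`: it is a bivector field with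
`ι_a ι_b W = 0` for all `a, b` in the annihilator of `T𝓕`. -/
def IsGood (W : BiField I M) : Prop :=
  IsBivectorField I W ∧
    ∀ x, ∀ a ∈ (S.TF x).dualAnnihilator, ∀ b ∈ (S.TF x).dualAnnihilator, W x a b = 0

/-- `W` is a Maurer-Cartan element of `(𝔛^•_𝓕(M)[2], {𝔩_k})`: a good bivector field with
`𝔩₁(W) + 1/2 𝔩₂(W, W) + 1/6 𝔩₃(W, W, W) = 0`. -/
def IsMaurerCartan (W : BiField I M) : Prop :=
  S.IsGood W ∧
    ∀ α β δ : OneForm I M, SmoothForm I α → SmoothForm I β → SmoothForm I δ → ∀ x,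
      S.l1B W α β δ x + (1 / 2) * S.l2BB W W α β δ x + (1 / 6) * S.l3BBB W W W α β δ x = 0

/-- `id + γ♭ ∘ W♯` on `T*_x M`. -/
def idAddGammaSharp (W : BiField I M) (x : M) : Module.End ℝ (Cotangent I x) :=
  LinearMap.id + S.gammaFlat x ∘ₗ sharp I W x

/-- `W` takes values in `𝓘_γ`: `id + γ♭ ∘ W♯` is invertible at every point. -/
def MemI (W : BiField I M) : Prop := ∀ x, IsUnit (S.idAddGammaSharp W x)

/-- The gauge transform `W^γ`, with `(W^γ)♯ = W♯ ∘ (id + γ♭ ∘ W♯)⁻¹`, of a field `W` with values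
in `𝓘_γ`. -/
def gaugeTransform (W : BiField I M) : BiField I M :=
  fun x => W x ∘ₗ Ring.inverse (S.idAddGammaSharp W x)

/-- The Dirac exponential map `W ↦ Π + W^γ`. -/
def expG (W : BiField I M) : BiField I M := S.Pi + S.gaugeTransform W

/-- A family `(W_t)_{t ∈ [0,1]}` of bivector fields is smooth (jointly in `t` and the point). -/
def SmoothBiFamily (W : ℝ → BiField I M) : Prop :=
  ∀ α β : OneForm I M, SmoothForm I α → SmoothForm I β →
    ContMDiffOn (𝓘(ℝ, ℝ).prod I) 𝓘(ℝ, ℝ) ∞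
      (fun p : ℝ × M => W p.1 p.2 (α p.2) (β p.2)) (Icc 0 1 ×ˢ univ)

/-- A family `(X_t)_{t ∈ [0,1]}` of vector fields is smooth (jointly in `t` and the point). -/
def SmoothVecFamily (X : ℝ → VecField I M) : Prop :=
  ContMDiffOn (𝓘(ℝ, ℝ).prod I) I.tangent ∞
    (fun p : ℝ × M => (⟨p.2, X p.1 p.2⟩ : TangentBundle I M)) (Icc 0 1 ×ˢ univ)

/-- `W₀` and `W₁` are gauge equivalent in `(𝔛^•_𝓕(M)[2], {𝔩_k})` through Maurer-Cartan elements
with values in `𝓘_γ`: there are a smooth family of such elements `W_t` from `W₀` to `W₁` and a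
smooth family of vector fields `X_t` such that
`d/dt W_t = 𝔩₁(X_t) + 𝔩₂(X_t, W_t) + 1/2 𝔩₃(X_t, W_t, W_t)` for `t ∈ [0,1]`. -/
def GaugeEquivalent (W₀ W₁ : BiField I M) : Prop :=
  ∃ (W : ℝ → BiField I M) (X : ℝ → VecField I M),
    SmoothBiFamily W ∧ SmoothVecFamily X ∧ W 0 = W₀ ∧ W 1 = W₁ ∧
    (∀ t ∈ Icc (0 : ℝ) 1, S.IsMaurerCartan (W t) ∧ S.MemI (W t)) ∧
    ∀ t ∈ Icc (0 : ℝ) 1, ∀ α β : OneForm I M, SmoothForm I α → SmoothForm I β → ∀ x,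
      HasDerivWithinAt (fun s => W s x (α x) (β x))
        (S.l1V (X t) α β x + S.l2VB (X t) (W t) α β x
          + (1 / 2) * S.l3VBB (X t) (W t) (W t) α β x) (Icc 0 1) t

end SplitRegularPoisson

variable {I M}

/-- `φ` relates `P` to `Q`, i.e. `φ_* P = Q`, where
`(φ_* P)_{φ(x)}(a, b) = P_x(a ∘ dφ_x, b ∘ dφ_x)`. -/
def Pushforward (φ : M ≃ₘ^∞⟮I, I⟯ M) (P Q : BiField I M) : Prop :=
  ∀ x, ∀ a b : Cotangent I (φ x),
    Q (φ x) a b = P x (a ∘ₗ (mfderiv I I φ x).toLinearMap) (b ∘ₗ (mfderiv I I φ x).toLinearMap)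

/-- `(φ_t)_{t ∈ [0,1]}` is an isotopy of `M` starting at the identity: every `φ_t` is a
diffeomorphism, `(t, x) ↦ φ_t(x)` is smooth on `[0,1] × M`, and `φ_0 = id`. -/
def IsIsotopy (φ : ℝ → M ≃ₘ^∞⟮I, I⟯ M) : Prop :=
  ContMDiffOn (𝓘(ℝ, ℝ).prod I) I ∞ (fun p : ℝ × M => φ p.1 p.2) (Icc 0 1 ×ˢ univ) ∧
    φ 0 = Diffeomorph.refl I M ∞

/-- `φ_* D` is transverse to `G`, i.e. `φ_* D + G = TM`, where `(φ_* D)_{φ(x)} = dφ_x(D_x)`. -/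
def PushforwardTransverse (φ : M ≃ₘ^∞⟮I, I⟯ M)
    (D G : ∀ x : M, Submodule ℝ (TangentSpace I x)) : Prop :=
  ∀ x, (D x).map (mfderiv I I φ x).toLinearMap ⊔ G (φ x) = ⊤

end Splitting

end RegPoisson

end

noncomputable section

set_option linter.unusedSectionVars false

namespace RegPoisson

open scoped Topology
open Filter

section Frames

variable {E : Type*} [NormedAddCommGroup E] [NormedSpace ℝ E] [FiniteDimensional ℝ E]
  {H : Type*} [TopologicalSpace H] {I : ModelWithCorners ℝ E H}
  {M : Type*} [TopologicalSpace M] [ChartedSpace H M]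

variable (I) in
/-- The differential of a function, as a one-form. -/
def dform (f : M → ℝ) : OneForm I M := fun x => (mfderiv I 𝓘(ℝ, ℝ) f x).toLinearMap

theorem vderiv_eq_dform (X : VecField I M) (f : M → ℝ) (x : M) :
    vderiv I X f x = dform I f x (X x) := rfl

theorem dform_congr {f g : M → ℝ} {x : M} (h : f =ᶠ[𝓝 x] g) : dform I f x = dform I g x := by
  unfold dform
  ext v
  exact congrArg (fun L : E →L[ℝ] ℝ => L v) (h.mfderiv_eq (I := I) (I' := 𝓘(ℝ, ℝ)))

theorem dform_add {f g : M → ℝ} {x : M} (hf : MDifferentiableAt I 𝓘(ℝ, ℝ) f x)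
    (hg : MDifferentiableAt I 𝓘(ℝ, ℝ) g x) :
    dform I (fun y => f y + g y) x = dform I f x + dform I g x := by
  ext v
  exact congrArg (fun L : E →L[ℝ] ℝ => L v) (hf.hasMFDerivAt.add hg.hasMFDerivAt).mfderiv

theorem dform_sub {f g : M → ℝ} {x : M} (hf : MDifferentiableAt I 𝓘(ℝ, ℝ) f x)
    (hg : MDifferentiableAt I 𝓘(ℝ, ℝ) g x) :
    dform I (fun y => f y - g y) x = dform I f x - dform I g x := by
  ext v
  exact congrArg (fun L : E →L[ℝ] ℝ => L v) (hf.hasMFDerivAt.sub hg.hasMFDerivAt).mfderiv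

theorem dform_neg (f : M → ℝ) (x : M) : dform I (fun y => - f y) x = - dform I f x := by
  ext v
  exact congrArg (fun L : E →L[ℝ] ℝ => L v) (mfderiv_neg (I := I) (f := f) (x := x))

theorem dform_mul {f g : M → ℝ} {x : M} (hf : MDifferentiableAt I 𝓘(ℝ, ℝ) f x)
    (hg : MDifferentiableAt I 𝓘(ℝ, ℝ) g x) :
    dform I (fun y => f y * g y) x = f x • dform I g x + g x • dform I f x := by
  ext v
  have h := congrArg (fun L : E →L[ℝ] ℝ => L v) (hf.hasMFDerivAt.mul hg.hasMFDerivAt).mfderiv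
  exact h

theorem dform_const (c : ℝ) (x : M) : dform I (fun _ : M => c) x = 0 := by
  ext v
  exact congrArg (fun L : E →L[ℝ] ℝ => L v) (mfderiv_const (I := I) (c := c) (x := x))

theorem dform_const_mul {f : M → ℝ} {x : M} (c : ℝ) (hf : MDifferentiableAt I 𝓘(ℝ, ℝ) f x) :
    dform I (fun y => c * f y) x = c • dform I f x := by
  rw [dform_mul mdifferentiableAt_const hf, dform_const, smul_zero, add_zero]

theorem dform_finsetSum {ι : Type*} (s : Finset ι) {f : ι → M → ℝ} {x : M}
    (hf : ∀ i, MDifferentiableAt I 𝓘(ℝ, ℝ) (f i) x) :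
    MDifferentiableAt I 𝓘(ℝ, ℝ) (fun y => ∑ i ∈ s, f i y) x ∧
    dform I (fun y => ∑ i ∈ s, f i y) x = ∑ i ∈ s, dform I (f i) x := by
  classical
  induction s using Finset.induction_on with
  | empty => simpa using ⟨mdifferentiableAt_const, dform_const 0 x⟩
  | insert a s ha ih =>
    simp only [Finset.sum_insert ha]
    exact ⟨(hf a).add ih.1, by rw [dform_add (hf a) ih.1, ih.2]⟩

variable [IsManifold I ∞ M]

/-- The differential of a smooth function along a smooth section over a map. -/
theorem contMDiffAt_mfderiv_section {E' : Type*} [NormedAddCommGroup E'] [NormedSpace ℝ E']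
    {H' : Type*} [TopologicalSpace H'] {J : ModelWithCorners ℝ E' H'}
    {N : Type*} [TopologicalSpace N] [ChartedSpace H' N] {f : M → ℝ}
    (hf : ContMDiff I 𝓘(ℝ, ℝ) ∞ f) {b : N → M} {X : ∀ p, TangentSpace I (b p)} {s : Set N} {p₀ : N}
    (hX : ContMDiffWithinAt J I.tangent ∞ (fun p => (⟨b p, X p⟩ : TangentBundle I M)) s p₀) :
    ContMDiffWithinAt J 𝓘(ℝ, ℝ) ∞ (fun p => dform I f (b p) (X p)) s p₀ := by
  have h1 : ContMDiff I.tangent 𝓘(ℝ, ℝ).tangent ∞ (tangentMap I 𝓘(ℝ, ℝ) f) :=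
    hf.contMDiff_tangentMap (by simp)
  have h2 := (contMDiff_snd_tangentBundle_modelSpace ℝ 𝓘(ℝ, ℝ) (n := ∞)).comp h1
  exact h2.contMDiffAt.comp_contMDiffWithinAt p₀ hX

theorem smoothForm_dform {f : M → ℝ} (hf : ContMDiff I 𝓘(ℝ, ℝ) ∞ f) : SmoothForm I (dform I f) := by
  intro X hX x
  exact contMDiffAt_mfderiv_section (b := id) hf (hX x)

variable [T2Space M]

theorem exists_contMDiff_eventuallyEq {F : Type*} [NormedAddCommGroup F] [NormedSpace ℝ F]
    {f : M → F} {U : Set M} (hU : IsOpen U) {x₀ : M} (hx : x₀ ∈ U)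
    (hf : ContMDiffOn I 𝓘(ℝ, F) ∞ f U) :
    ∃ g : M → F, ContMDiff I 𝓘(ℝ, F) ∞ g ∧ g =ᶠ[𝓝 x₀] f := by
  obtain ⟨χ, -, hχ⟩ := (SmoothBumpFunction.nhds_basis_tsupport (I := I) x₀).mem_iff.1 (hU.mem_nhds hx)
  refine ⟨fun x => χ x • f x, contMDiff_of_tsupport fun x hx => ?_, ?_⟩
  · have hxU : x ∈ U := hχ (tsupport_smul_subset_left _ _ hx)
    exact χ.contMDiffAt.smul (hf.contMDiffAt (hU.mem_nhds hxU))
  · filter_upwards [χ.eventuallyEq_one] with x hx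
    simp [hx]

theorem exists_smoothVec_eventuallyEq {X : VecField I M} {U : Set M} (hU : IsOpen U) {x₀ : M}
    (hx : x₀ ∈ U)
    (hX : ContMDiffOn I I.tangent ∞ (fun x => (⟨x, X x⟩ : TangentBundle I M)) U) :
    ∃ Y : VecField I M, SmoothVec I Y ∧ ∀ᶠ x in 𝓝 x₀, Y x = X x := by
  obtain ⟨χ, -, hχ⟩ := (SmoothBumpFunction.nhds_basis_tsupport (I := I) x₀).mem_iff.1 (hU.mem_nhds hx)
  refine ⟨(χ : M → ℝ) • X, ?_, ?_⟩
  · exact ContMDiffOn.smul_section_of_tsupport (V := TangentSpace I) (I := I)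
      χ.contMDiff.contMDiffOn hU hχ hX
  · filter_upwards [χ.eventuallyEq_one] with x hx
    simp [hx]

/-- Dual frames around a point: smooth vector fields and the differentials of smooth functions. -/
theorem exists_frame (x₀ : M) :
    ∃ (e : Fin (Module.finrank ℝ E) → VecField I M) (q : Fin (Module.finrank ℝ E) → M → ℝ),
      (∀ i, SmoothVec I (e i)) ∧ (∀ i, ContMDiff I 𝓘(ℝ, ℝ) ∞ (q i)) ∧
      ∀ᶠ x in 𝓝 x₀, (∀ i j, dform I (q i) x (e j x) = if i = j then 1 else 0) ∧
        ∀ v : TangentSpace I x, v = ∑ i, dform I (q i) x v • e i x := by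
  set b := Module.finBasis ℝ E
  set T := trivializationAt E (TangentSpace I) x₀
  have hbase : T.baseSet = (chartAt H x₀).source := by simp [T]
  have hx₀ : x₀ ∈ T.baseSet := by simp [hbase]
  have hopen : IsOpen T.baseSet := T.open_baseSet
  have he : ∀ i, ∃ Y : VecField I M, SmoothVec I Y ∧ ∀ᶠ x in 𝓝 x₀, Y x = T.localFrame b i x :=
    fun i => exists_smoothVec_eventuallyEq hopen hx₀ (T.contMDiffOn_localFrame_baseSet ∞ b i)
  choose e hes hee using he
  have hq : ∀ i, ∃ g : M → ℝ, ContMDiff I 𝓘(ℝ, ℝ) ∞ g ∧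
      g =ᶠ[𝓝 x₀] fun x => LinearMap.toContinuousLinearMap (b.coord i) (extChartAt I x₀ x) := by
    intro i
    refine exists_contMDiff_eventuallyEq hopen hx₀ ?_
    rw [hbase]
    exact (LinearMap.toContinuousLinearMap (b.coord i)).contMDiff.comp_contMDiffOn
      contMDiffOn_extChartAt
  choose q hqs hqe using hq
  refine ⟨e, q, hes, hqs, ?_⟩
  have h1 : ∀ᶠ x in 𝓝 x₀, ∀ i, e i x = T.localFrame b i x := eventually_all.2 hee
  have h2 : ∀ᶠ x in 𝓝 x₀, ∀ i, q i =ᶠ[𝓝 x]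
      fun x => LinearMap.toContinuousLinearMap (b.coord i) (extChartAt I x₀ x) :=
    eventually_all.2 fun i => (hqe i).eventually_nhds
  filter_upwards [h1, h2, hopen.mem_nhds hx₀] with x h1 h2 h3
  have h3' : x ∈ (chartAt H x₀).source := hbase ▸ h3
  have hd : ∀ i (v : TangentSpace I x), dform I (q i) x v = b.coord i (T.continuousLinearMapAt ℝ x v) := by
    intro i v
    rw [dform_congr (h2 i)]
    have hc : MDifferentiableAt I 𝓘(ℝ, E) (extChartAt I x₀) x := mdifferentiableAt_extChartAt h3'
    have h4 := ((LinearMap.toContinuousLinearMap (b.coord i)).hasMFDerivAt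
      (x := extChartAt I x₀ x)).comp x hc.hasMFDerivAt
    have h5 : mfderiv I 𝓘(ℝ, ℝ) (fun x => LinearMap.toContinuousLinearMap (b.coord i)
        (extChartAt I x₀ x)) x = _ := h4.mfderiv
    have h6 : T.continuousLinearMapAt ℝ x = mfderiv I 𝓘(ℝ, E) (extChartAt I x₀) x :=
      TangentBundle.continuousLinearMapAt_trivializationAt h3'
    unfold dform
    rw [h5, h6]
    rfl
  have hf : ∀ j, T.continuousLinearMapAt ℝ x (e j x) = b j := by
    intro j
    rw [h1 j, T.localFrame_apply_of_mem_baseSet b h3]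
    simp only [Bundle.Trivialization.continuousLinearMapAt_apply, h3,
      Bundle.Trivialization.linearMapAt_apply, if_true]
    exact (T.linearEquivAt ℝ x h3).apply_symm_apply (b j)
  refine ⟨fun i j => ?_, fun v => ?_⟩
  · rw [hd, hf]
    simp [Finsupp.single_apply, eq_comm]
  · have hinj : Function.Injective (T.continuousLinearMapAt ℝ x) := by
      rw [← T.coe_continuousLinearEquivAt_eq h3]
      exact (T.continuousLinearEquivAt ℝ x h3).injective
    apply hinj
    rw [map_sum]
    simp_rw [map_smul, hf, hd]
    exact (b.sum_repr _).symm

end Frames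

section Families

variable {E : Type*} [NormedAddCommGroup E] [NormedSpace ℝ E] [FiniteDimensional ℝ E]
  {H : Type*} [TopologicalSpace H] {I : ModelWithCorners ℝ E H}
  {M : Type*} [TopologicalSpace M] [ChartedSpace H M]

variable (I) in
/-- A family of functions that is smooth on `ℝ × M`. -/
def FamFun (f : ℝ → M → ℝ) : Prop :=
  ContMDiff (𝓘(ℝ, ℝ).prod I) 𝓘(ℝ, ℝ) ∞ (fun p : ℝ × M => f p.1 p.2)

variable [IsManifold I ∞ M]

variable (I) in
/-- A family of vector fields that is smooth on `ℝ × M`. -/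
def FamVec (X : ℝ → VecField I M) : Prop :=
  ∀ α : OneForm I M, SmoothForm I α → FamFun I (fun t x => α x (X t x))

variable (I) in
/-- A family of one-forms that is smooth on `ℝ × M`. -/
def FamForm (α : ℝ → OneForm I M) : Prop :=
  ∀ X : VecField I M, SmoothVec I X → FamFun I (fun t x => α t x (X x))

variable (I) in
/-- A family of fields of bilinear forms that is smooth on `ℝ × M`. -/
def FamBi (P : ℝ → BiField I M) : Prop :=
  ∀ α β : OneForm I M, SmoothForm I α → SmoothForm I β → FamFun I (fun t x => P t x (α x) (β x))

variable (I) in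
/-- A family of fields of endomorphisms of the cotangent bundle that is smooth on `ℝ × M`. -/
def FamEnd (K : ℝ → ∀ x : M, Module.End ℝ (Cotangent I x)) : Prop :=
  ∀ α : OneForm I M, SmoothForm I α → FamForm I (fun t x => K t x (α x))

theorem FamFun.of_eventuallyEq_at {f : ℝ → M → ℝ}
    (h : ∀ (t₀ : ℝ) (x₀ : M), ∃ g : ℝ → M → ℝ,
      ContMDiffAt (𝓘(ℝ, ℝ).prod I) 𝓘(ℝ, ℝ) ∞ (fun p : ℝ × M => g p.1 p.2) (t₀, x₀) ∧
        ∀ᶠ x in 𝓝 x₀, ∀ t, f t x = g t x) :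
    FamFun I f := by
  rintro ⟨t₀, x₀⟩
  obtain ⟨g, hg, hgf⟩ := h t₀ x₀
  refine hg.congr_of_eventuallyEq ?_
  have h2 : Tendsto Prod.snd (𝓝 (t₀, x₀)) (𝓝 x₀) := continuous_snd.tendsto (t₀, x₀)
  filter_upwards [h2.eventually hgf] with p hp
  exact hp p.1

/-- Smoothness on `ℝ × M` can be checked after expansion in a frame. -/
theorem FamFun.of_eventuallyEq {f : ℝ → M → ℝ}
    (h : ∀ x₀ : M, ∃ g : ℝ → M → ℝ, FamFun I g ∧ ∀ᶠ x in 𝓝 x₀, ∀ t, f t x = g t x) :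
    FamFun I f :=
  .of_eventuallyEq_at fun t₀ x₀ => by
    obtain ⟨g, hg, h⟩ := h x₀
    exact ⟨g, hg (t₀, x₀), h⟩

theorem FamFun.add {f g : ℝ → M → ℝ} (hf : FamFun I f) (hg : FamFun I g) :
    FamFun I (fun t x => f t x + g t x) := ContMDiff.add hf hg

theorem FamFun.sub {f g : ℝ → M → ℝ} (hf : FamFun I f) (hg : FamFun I g) :
    FamFun I (fun t x => f t x - g t x) := ContMDiff.sub hf hg

theorem FamFun.neg {f : ℝ → M → ℝ} (hf : FamFun I f) :
    FamFun I (fun t x => - f t x) := ContMDiff.neg hf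

theorem FamFun.mul {f g : ℝ → M → ℝ} (hf : FamFun I f) (hg : FamFun I g) :
    FamFun I (fun t x => f t x * g t x) := ContMDiff.mul hf hg

theorem FamFun.sum {ι : Type*} {s : Finset ι} {f : ι → ℝ → M → ℝ} (hf : ∀ i, FamFun I (f i)) :
    FamFun I (fun t x => ∑ i ∈ s, f i t x) :=
  contMDiff_finsetSum fun i _ => hf i

theorem FamFun.const {f : M → ℝ} (hf : ContMDiff I 𝓘(ℝ, ℝ) ∞ f) : FamFun I (fun _ x => f x) :=
  hf.comp contMDiff_snd

theorem FamFun.slice {f : ℝ → M → ℝ} (hf : FamFun I f) (t : ℝ) : ContMDiff I 𝓘(ℝ, ℝ) ∞ (f t) :=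
  ContMDiff.comp (g := fun p : ℝ × M => f p.1 p.2) hf (contMDiff_const.prodMk contMDiff_id)

theorem FamVec.of_smooth {X : VecField I M} (hX : SmoothVec I X) : FamVec I (fun _ => X) :=
  fun _ hα => FamFun.const (hα X hX)

theorem FamForm.of_smooth {α : OneForm I M} (hα : SmoothForm I α) : FamForm I (fun _ => α) :=
  fun X hX => FamFun.const (hα X hX)

theorem FamForm.slice {α : ℝ → OneForm I M} (hα : FamForm I α) (t : ℝ) : SmoothForm I (α t) :=
  fun X hX => (hα X hX).slice t

theorem FamBi.of_smooth {P : BiField I M} (hP : IsBivectorField I P) : FamBi I (fun _ => P) :=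
  fun α β hα hβ => FamFun.const (hP.2 α β hα hβ)

theorem FamForm.add {α β : ℝ → OneForm I M} (hα : FamForm I α) (hβ : FamForm I β) :
    FamForm I (fun t => α t + β t) := fun X hX => (hα X hX).add (hβ X hX)

theorem FamVec.add {X Y : ℝ → VecField I M} (hX : FamVec I X) (hY : FamVec I Y) :
    FamVec I (fun t => X t + Y t) := fun α hα => by
  simpa using! (hX α hα).add (hY α hα)

theorem FamVec.sub {X Y : ℝ → VecField I M} (hX : FamVec I X) (hY : FamVec I Y) :
    FamVec I (fun t => X t - Y t) := fun α hα => by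
  simpa using! (hX α hα).sub (hY α hα)

theorem FamForm.sub {α β : ℝ → OneForm I M} (hα : FamForm I α) (hβ : FamForm I β) :
    FamForm I (fun t => α t - β t) := fun X hX => (hα X hX).sub (hβ X hX)

theorem FamBi.sub {P Q : ℝ → BiField I M} (hP : FamBi I P) (hQ : FamBi I Q) :
    FamBi I (fun t => P t - Q t) := fun α β hα hβ => (hP α β hα hβ).sub (hQ α β hα hβ)

theorem SmoothVec.add {X Y : VecField I M} (hX : SmoothVec I X) (hY : SmoothVec I Y) :
    SmoothVec I (X + Y) := ContMDiff.add_section (V := TangentSpace I) hX hY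

theorem SmoothVec.mdifferentiableAt {X : VecField I M} (hX : SmoothVec I X) (x : M) :
    MDifferentiableAt I I.tangent (fun x => (⟨x, X x⟩ : TangentBundle I M)) x :=
  (hX x).mdifferentiableAt (by simp)

variable [T2Space M]

theorem Cotangent.eq_sum_of_frame {n : ℕ} {x : M} {e : Fin n → TangentSpace I x}
    {q : Fin n → Cotangent I x} (h : ∀ v, v = ∑ i, q i v • e i) (a : Cotangent I x) :
    a = ∑ i, a (e i) • q i := by
  ext v
  conv_lhs => rw [h v]
  simp [mul_comm]

theorem FamBi.pairing {P : ℝ → BiField I M} {α β : ℝ → OneForm I M} (hP : FamBi I P)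
    (hα : FamForm I α) (hβ : FamForm I β) : FamFun I (fun t x => P t x (α t x) (β t x)) := by
  refine .of_eventuallyEq fun x₀ => ?_
  obtain ⟨e, q, he, hq, h⟩ := exists_frame (I := I) x₀
  refine ⟨fun t x => ∑ i, ∑ j, (α t x (e i x) * β t x (e j x)) *
      P t x (dform I (q i) x) (dform I (q j) x),
    .sum fun i => .sum fun j => ((hα _ (he i)).mul (hβ _ (he j))).mul
      (hP _ _ (smoothForm_dform (hq i)) (smoothForm_dform (hq j))), ?_⟩
  filter_upwards [h] with x hx t
  conv_lhs => rw [Cotangent.eq_sum_of_frame hx.2 (α t x), Cotangent.eq_sum_of_frame hx.2 (β t x)]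
  simp only [map_sum, map_smul, LinearMap.sum_apply, LinearMap.smul_apply, smul_eq_mul,
    Finset.mul_sum]
  rw [Finset.sum_comm]
  refine Finset.sum_congr rfl fun i _ => Finset.sum_congr rfl fun j _ => by ring

theorem FamBi.sharp {P : ℝ → BiField I M} {α : ℝ → OneForm I M} (hP : FamBi I P)
    (hα : FamForm I α) : FamVec I (fun t => sharpField I (P t) (α t)) := by
  intro β hβ
  simp only [sharpField, apply_sharp]
  exact hP.pairing hα (.of_smooth hβ)

theorem FamEnd.apply {K : ℝ → ∀ x : M, Module.End ℝ (Cotangent I x)} {α : ℝ → OneForm I M}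
    (hK : FamEnd I K) (hα : FamForm I α) : FamForm I (fun t x => K t x (α t x)) := by
  intro X hX
  refine .of_eventuallyEq fun x₀ => ?_
  obtain ⟨e, q, he, hq, h⟩ := exists_frame (I := I) x₀
  refine ⟨fun t x => ∑ i, α t x (e i x) * K t x (dform I (q i) x) (X x),
    .sum fun i => (hα _ (he i)).mul (hK _ (smoothForm_dform (hq i)) _ hX), ?_⟩
  filter_upwards [h] with x hx t
  conv_lhs => rw [Cotangent.eq_sum_of_frame hx.2 (α t x)]
  simp

/-- A family of vector fields whose pairings with smooth one-forms are smooth is a smooth map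
to the tangent bundle. -/
theorem FamVec.contMDiff {X : ℝ → VecField I M} (hX : FamVec I X) :
    ContMDiff (𝓘(ℝ, ℝ).prod I) I.tangent ∞
      (fun p : ℝ × M => (⟨p.2, X p.1 p.2⟩ : TangentBundle I M)) := by
  rintro ⟨t₀, x₀⟩
  obtain ⟨e, q, he, hq, h⟩ := exists_frame (I := I) x₀
  rw [Bundle.contMDiffAt_totalSpace]
  refine ⟨contMDiffAt_snd, ?_⟩
  set T := trivializationAt E (TangentSpace I) x₀
  have h2 : Tendsto Prod.snd (𝓝 (t₀, x₀)) (𝓝 x₀) := continuous_snd.tendsto (t₀, x₀)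
  have hb : T.baseSet ∈ 𝓝 x₀ := T.open_baseSet.mem_nhds (FiberBundle.mem_baseSet_trivializationAt' x₀)
  have h3 : ContMDiffAt (𝓘(ℝ, ℝ).prod I) 𝓘(ℝ, E) ∞ (fun p : ℝ × M =>
      ∑ i, dform I (q i) p.2 (X p.1 p.2) • (T ⟨p.2, e i p.2⟩).2) (t₀, x₀) := by
    refine contMDiffAt_finsetSum fun i _ => ?_
    refine ContMDiffAt.smul (hX _ (smoothForm_dform (hq i)) (t₀, x₀)) ?_
    have h4 := (Bundle.contMDiffAt_totalSpace.1 (he i x₀)).2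
    exact ContMDiffAt.comp (g := fun x : M => (T ⟨x, e i x⟩).2) (f := Prod.snd) (t₀, x₀) h4
      contMDiffAt_snd
  refine h3.congr_of_eventuallyEq ?_
  filter_upwards [h2.eventually h, h2.eventually hb] with p hp hpb
  have h5 : ∀ v : TangentSpace I p.2, (T ⟨p.2, v⟩).2 = T.linearMapAt ℝ p.2 v := by
    intro v
    rw [T.linearMapAt_apply, if_pos (show p.2 ∈ T.baseSet from hpb)]
  change (T ⟨p.2, X p.1 p.2⟩).2 = _
  rw [h5]
  conv_lhs => rw [hp.2 (X p.1 p.2)]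
  rw [map_sum]
  simp_rw [h5, map_smul]

theorem FamVec.slice {X : ℝ → VecField I M} (hX : FamVec I X) (t : ℝ) : SmoothVec I (X t) :=
  hX.contMDiff.comp (contMDiff_const.prodMk contMDiff_id)

theorem FamVec.of_contMDiff {X : ℝ → VecField I M}
    (hX : ContMDiff (𝓘(ℝ, ℝ).prod I) I.tangent ∞
      (fun p : ℝ × M => (⟨p.2, X p.1 p.2⟩ : TangentBundle I M))) : FamVec I X := by
  intro α hα
  refine .of_eventuallyEq fun x₀ => ?_
  obtain ⟨e, q, he, hq, h⟩ := exists_frame (I := I) x₀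
  refine ⟨fun t x => ∑ i, dform I (q i) x (X t x) * α x (e i x),
    .sum fun i => FamFun.mul (fun p => contMDiffAt_mfderiv_section (b := Prod.snd) (hq i) (hX p))
      (.const (hα _ (he i))), ?_⟩
  filter_upwards [h] with x hx t
  conv_lhs => rw [hx.2 (X t x)]
  simp

theorem IsBivectorField.smooth_sharp {P : BiField I M} (hP : IsBivectorField I P) {α : OneForm I M}
    (hα : SmoothForm I α) : SmoothVec I (sharpField I P α) :=
  ((FamBi.of_smooth hP).sharp (.of_smooth hα)).slice 0

/-- Every covector extends to a smooth one-form. -/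
theorem exists_smoothForm_eq (x₀ : M) (a : Cotangent I x₀) :
    ∃ α : OneForm I M, SmoothForm I α ∧ α x₀ = a := by
  obtain ⟨e, q, he, hq, h⟩ := exists_frame (I := I) x₀
  refine ⟨fun x => ∑ i, a (e i x₀) • dform I (q i) x, ?_, ?_⟩
  · intro X hX
    simp only [LinearMap.sum_apply, LinearMap.smul_apply, smul_eq_mul]
    exact contMDiff_finsetSum fun i _ => contMDiff_const.mul (smoothForm_dform (hq i) X hX)
  · exact (Cotangent.eq_sum_of_frame h.self_of_nhds.2 a).symm

/-- Every covector is the differential of a smooth function. -/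
theorem exists_dform_eq (x₀ : M) (a : Cotangent I x₀) :
    ∃ f : M → ℝ, ContMDiff I 𝓘(ℝ, ℝ) ∞ f ∧ dform I f x₀ = a := by
  obtain ⟨e, q, he, hq, h⟩ := exists_frame (I := I) x₀
  refine ⟨fun x => ∑ i, a (e i x₀) * q i x,
    contMDiff_finsetSum fun i _ => contMDiff_const.mul (hq i), ?_⟩
  have h1 := dform_finsetSum (I := I) (x := x₀) Finset.univ (f := fun i x => a (e i x₀) * q i x)
    fun i => (contMDiff_const.mul (hq i) x₀).mdifferentiableAt (by simp)
  rw [h1.2]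
  refine Eq.trans ?_ (Cotangent.eq_sum_of_frame h.self_of_nhds.2 a).symm
  exact Finset.sum_congr rfl fun i _ =>
    dform_const_mul _ ((hq i x₀).mdifferentiableAt (by simp))

end Families

section MatrixInverse

variable {E' : Type*} [NormedAddCommGroup E'] [NormedSpace ℝ E']
  {H' : Type*} [TopologicalSpace H'] {J : ModelWithCorners ℝ E' H'}
  {N : Type*} [TopologicalSpace N] [ChartedSpace H' N] {n : Type*} [Fintype n] [DecidableEq n]

theorem contMDiffAt_det {A : N → Matrix n n ℝ} {p₀ : N}
    (hA : ∀ i j, ContMDiffAt J 𝓘(ℝ, ℝ) ∞ (fun p => A p i j) p₀) :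
    ContMDiffAt J 𝓘(ℝ, ℝ) ∞ (fun p => (A p).det) p₀ := by
  simp only [Matrix.det_apply']
  exact contMDiffAt_finsetSum fun σ _ => contMDiffAt_const.mul
    (contMDiffAt_finsetProd fun i _ => hA _ _)

theorem contMDiffAt_matrix_inv {A : N → Matrix n n ℝ} {p₀ : N}
    (hA : ∀ i j, ContMDiffAt J 𝓘(ℝ, ℝ) ∞ (fun p => A p i j) p₀) (h0 : (A p₀).det ≠ 0) (i j : n) :
    ContMDiffAt J 𝓘(ℝ, ℝ) ∞ (fun p => (A p)⁻¹ i j) p₀ := by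
  simp only [Matrix.inv_def, Matrix.smul_apply, smul_eq_mul, Ring.inverse_eq_inv',
    Matrix.adjugate_apply]
  have h1 : ContMDiffAt J 𝓘(ℝ, ℝ) ∞ (fun p => ((A p).det)⁻¹) p₀ :=
    ContMDiffAt.comp (g := fun y : ℝ => y⁻¹) p₀ (contDiffAt_inv ℝ h0).contMDiffAt
      (contMDiffAt_det hA)
  refine h1.mul (contMDiffAt_det fun k l => ?_)
  simp only [Matrix.updateRow_apply]
  split_ifs
  · exact contMDiffAt_const
  · exact hA k l

end MatrixInverse

section Inverse

variable {E : Type*} [NormedAddCommGroup E] [NormedSpace ℝ E] [FiniteDimensional ℝ E]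
  {H : Type*} [TopologicalSpace H] {I : ModelWithCorners ℝ E H}
  {M : Type*} [TopologicalSpace M] [ChartedSpace H M] [IsManifold I ∞ M] [T2Space M]

theorem FamEnd.inverse {K : ℝ → ∀ x : M, Module.End ℝ (Cotangent I x)} (hK : FamEnd I K)
    (hu : ∀ t x, IsUnit (K t x)) : FamEnd I (fun t x => Ring.inverse (K t x)) := by
  intro α hα X hX
  refine .of_eventuallyEq_at fun t₀ x₀ => ?_
  obtain ⟨e, q, he, hq, h⟩ := exists_frame (I := I) x₀
  set A : ℝ → M → Matrix (Fin (Module.finrank ℝ E)) (Fin (Module.finrank ℝ E)) ℝ :=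
    fun t x => Matrix.of fun i j => K t x (dform I (q j) x) (e i x) with hA
  have hdet : ∀ x : M, (∀ i j, dform I (q i) x (e j x) = if i = j then 1 else 0) →
      (∀ v : TangentSpace I x, v = ∑ i, dform I (q i) x v • e i x) → ∀ t, (A t x).det ≠ 0 := by
    intro x h1 h2 t hd
    obtain ⟨v, hv, hAv⟩ := Matrix.exists_mulVec_eq_zero_iff.2 hd
    apply hv
    have h3 : K t x (∑ j, v j • dform I (q j) x) = 0 := by
      rw [Cotangent.eq_sum_of_frame h2 (K t x (∑ j, v j • dform I (q j) x))]
      refine Finset.sum_eq_zero fun i _ => ?_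
      have h4 := congrFun hAv i
      simp only [Matrix.mulVec, dotProduct, hA, Matrix.of_apply, Pi.zero_apply] at h4
      have h5 : K t x (∑ j, v j • dform I (q j) x) (e i x) = 0 := by
        rw [map_sum, LinearMap.sum_apply, ← h4]
        exact Finset.sum_congr rfl fun j _ => by simp [mul_comm]
      rw [h5, zero_smul]
    have h6 : ∑ j, v j • dform I (q j) x = 0 := by
      have h7 := congrArg (fun a => Ring.inverse (K t x) a) h3
      simp only [map_zero] at h7
      rwa [← Module.End.mul_apply, Ring.inverse_mul_cancel _ (hu t x)] at h7
    funext i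
    have h8 := LinearMap.congr_fun h6 (e i x)
    simpa [LinearMap.sum_apply, h1] using h8
  refine ⟨fun t x => ∑ j, (∑ i, (A t x)⁻¹ j i * α x (e i x)) * dform I (q j) x (X x), ?_, ?_⟩
  · have hAs : ∀ i j, ContMDiffAt (𝓘(ℝ, ℝ).prod I) 𝓘(ℝ, ℝ) ∞
        (fun p : ℝ × M => A p.1 p.2 i j) (t₀, x₀) := fun i j =>
      hK _ (smoothForm_dform (hq j)) _ (he i) (t₀, x₀)
    have h0 := hdet x₀ h.self_of_nhds.1 h.self_of_nhds.2 t₀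
    exact contMDiffAt_finsetSum fun j _ => ContMDiffAt.mul
      (contMDiffAt_finsetSum fun i _ => ContMDiffAt.mul (contMDiffAt_matrix_inv hAs h0 j i)
        (FamFun.const (hα _ (he i)) (t₀, x₀)))
      (FamFun.const (smoothForm_dform (hq j) X hX) (t₀, x₀))
  · filter_upwards [h] with x hx t
    have hd := hdet x hx.1 hx.2 t
    set c : Fin (Module.finrank ℝ E) → ℝ := (A t x)⁻¹.mulVec (fun i => α x (e i x)) with hc
    have h1 : K t x (∑ j, c j • dform I (q j) x) = α x := by
      rw [Cotangent.eq_sum_of_frame hx.2 (K t x (∑ j, c j • dform I (q j) x)),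
        Cotangent.eq_sum_of_frame hx.2 (α x)]
      refine Finset.sum_congr rfl fun i _ => ?_
      congr 1
      have h2 : (A t x).mulVec c i = α x (e i x) := by
        rw [hc, Matrix.mulVec_mulVec, Matrix.mul_nonsing_inv _ (isUnit_iff_ne_zero.2 hd),
          Matrix.one_mulVec]
      rw [map_sum, LinearMap.sum_apply, ← h2]
      simp only [Matrix.mulVec, dotProduct, hA, Matrix.of_apply]
      exact Finset.sum_congr rfl fun j _ => by simp [mul_comm]
    have h3 : Ring.inverse (K t x) (α x) = ∑ j, c j • dform I (q j) x := by
      rw [← h1, ← Module.End.mul_apply, Ring.inverse_mul_cancel _ (hu t x)]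
      rfl
    rw [h3]
    simp [LinearMap.sum_apply, hc, Matrix.mulVec, dotProduct]

end Inverse

namespace SplitRegularPoisson

variable {E : Type*} [NormedAddCommGroup E] [NormedSpace ℝ E] [FiniteDimensional ℝ E]
  {H : Type*} [TopologicalSpace H] {I : ModelWithCorners ℝ E H}
  {M : Type*} [TopologicalSpace M] [ChartedSpace H M] [IsManifold I ∞ M]
  (S : SplitRegularPoisson I M)

theorem gammaFlat_sharp_apply (x : M) (a : Cotangent I x) (v : TangentSpace I x) :
    S.gammaFlat x (sharp I S.Pi x a) v = - a (S.prF x v) := by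
  have h2 : Submodule.projectionOnto _ _ (S.isCompl x) (sharp I S.Pi x a) = ⟨sharp I S.Pi x a, a, rfl⟩ :=
    Submodule.projectionOnto_apply_left (S.isCompl x) ⟨sharp I S.Pi x a, a, rfl⟩
  have h1 : S.prF x v ∈ S.TF x := Submodule.projection_apply_mem (S.isCompl x) v
  have h3 : S.prF x (S.prF x v) = S.prF x v :=
    Submodule.projection_apply_of_mem_left (S.isCompl x) h1
  rw [← S.gammaFlat_sharp x a h1]
  simp only [gammaFlat, LinearMap.neg_apply, LinearMap.comp_apply, LinearMap.dualMap_apply, h3]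

variable [T2Space M]

theorem exists_adapted_frame (x₀ : M) :
    ∃ F : Fin (Module.finrank ℝ E) → VecField I M, (∀ i, SmoothVec I (F i)) ∧
      (∀ i, (∃ α, SmoothForm I α ∧ F i = sharpField I S.Pi α) ∨ ∀ y, F i y ∈ S.G y) ∧
      LinearIndependent ℝ (fun i => F i x₀) := by
  set s : Set (TangentSpace I x₀) := {v | ∃ F : VecField I M, SmoothVec I F ∧
    ((∃ α, SmoothForm I α ∧ F = sharpField I S.Pi α) ∨ ∀ y, F y ∈ S.G y) ∧ F x₀ = v}
  have hs : Submodule.span ℝ s = ⊤ := by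
    rw [eq_top_iff, ← (S.isCompl x₀).sup_eq_top]
    refine sup_le ?_ ?_
    · rintro _ ⟨a, rfl⟩
      obtain ⟨α, hα, rfl⟩ := exists_smoothForm_eq x₀ a
      exact Submodule.subset_span ⟨sharpField I S.Pi α, S.isPoisson.1.smooth_sharp hα,
        .inl ⟨α, hα, rfl⟩, rfl⟩
    · intro v hv
      obtain ⟨F, hF, hFv, hFG⟩ := S.smooth_G x₀ v hv
      exact Submodule.subset_span ⟨F, hF, .inr hFG, hFv⟩
  obtain ⟨f, hf, -, hli⟩ := Submodule.exists_fun_fin_finrank_span_eq ℝ s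
  have hn : Module.finrank ℝ E = Module.finrank ℝ (Submodule.span ℝ s) := by
    rw [hs, finrank_top]; rfl
  choose F hF hFa hFx using hf
  refine ⟨fun i => F (Fin.cast hn i), fun i => hF _, fun i => hFa _, ?_⟩
  simp_rw [hFx]
  exact hli.comp _ (Fin.cast_injective hn)

theorem smooth_gammaField {X : VecField I M} (hX : SmoothVec I X) :
    SmoothForm I (S.gammaField X) := by
  intro Y hY x₀
  obtain ⟨e, q, he, hq, h⟩ := exists_frame (I := I) x₀
  obtain ⟨F, hF, hFa, hFi⟩ := S.exists_adapted_frame x₀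
  have hγ : ∀ i j, ContMDiff I 𝓘(ℝ, ℝ) ∞ (fun x => S.gammaFlat x (F i x) (F j x)) := by
    intro i j
    rcases hFa i with ⟨α, hα, hi⟩ | hi
    · rcases hFa j with ⟨β, hβ, hj⟩ | hj
      · have h1 : ∀ x, S.gammaFlat x (F i x) (F j x) = - α x (F j x) := fun x => by
          rw [hi, hj]
          exact S.gammaFlat_sharp x (α x) ⟨β x, rfl⟩
        simp_rw [h1]
        exact (hα _ (hF j)).neg
      · simp_rw [fun x => S.gammaFlat_apply_of_mem_G x (F i x) (hj x)]
        exact contMDiff_const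
    · simp_rw [fun x => S.gammaFlat_of_mem_G x (hi x)]
      exact contMDiff_const
  set B : M → Matrix (Fin (Module.finrank ℝ E)) (Fin (Module.finrank ℝ E)) ℝ :=
    fun x => Matrix.of fun i j => dform I (q i) x (F j x) with hB
  have hBs : ∀ i j, ContMDiff I 𝓘(ℝ, ℝ) ∞ (fun x => B x i j) := fun i j =>
    smoothForm_dform (hq i) _ (hF j)
  have h0 : (B x₀).det ≠ 0 := by
    intro hd
    obtain ⟨v, hv, hBv⟩ := Matrix.exists_mulVec_eq_zero_iff.2 hd
    apply hv
    have h1 : ∑ j, v j • F j x₀ = 0 := by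
      rw [h.self_of_nhds.2 (∑ j, v j • F j x₀)]
      refine Finset.sum_eq_zero fun i _ => ?_
      have h4 := congrFun hBv i
      simp only [Matrix.mulVec, dotProduct, hB, Matrix.of_apply, Pi.zero_apply] at h4
      have h5 : dform I (q i) x₀ (∑ j, v j • F j x₀) = 0 := by
        rw [map_sum, ← h4]
        exact Finset.sum_congr rfl fun j _ => by simp [mul_comm]
      rw [h5, zero_smul]
    funext i
    exact Fintype.linearIndependent_iff.1 hFi v h1 i
  have hev : ∀ᶠ x in 𝓝 x₀, (B x).det ≠ 0 :=
    (contMDiffAt_det fun i j => hBs i j x₀).continuousAt.eventually_ne h0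
  set c : VecField I M → Fin (Module.finrank ℝ E) → M → ℝ :=
    fun Z j x => ∑ i, (B x)⁻¹ j i * dform I (q i) x (Z x) with hc
  have hcs : ∀ Z, SmoothVec I Z → ∀ j, ContMDiffAt I 𝓘(ℝ, ℝ) ∞ (c Z j) x₀ := fun Z hZ j =>
    contMDiffAt_finsetSum fun i _ => ContMDiffAt.mul
      (contMDiffAt_matrix_inv (fun i j => hBs i j x₀) h0 j i) (smoothForm_dform (hq i) Z hZ x₀)
  have hcZ : ∀ᶠ x in 𝓝 x₀, ∀ Z : VecField I M, Z x = ∑ j, c Z j x • F j x := by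
    filter_upwards [h, hev] with x hx hd Z
    rw [hx.2 (Z x), hx.2 (∑ j, c Z j x • F j x)]
    refine Finset.sum_congr rfl fun i _ => ?_
    congr 1
    have h2 : (B x).mulVec ((B x)⁻¹.mulVec (fun i => dform I (q i) x (Z x))) i =
        dform I (q i) x (Z x) := by
      rw [Matrix.mulVec_mulVec, Matrix.mul_nonsing_inv _ (isUnit_iff_ne_zero.2 hd),
        Matrix.one_mulVec]
    rw [map_sum]
    refine h2.symm.trans ?_
    unfold Matrix.mulVec dotProduct
    refine Finset.sum_congr rfl fun j _ => ?_
    rw [map_smul, smul_eq_mul, mul_comm]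
    rfl
  have hsum : ContMDiffAt I 𝓘(ℝ, ℝ) ∞
      (fun x => ∑ j, ∑ k, (c X j x * c Y k x) * S.gammaFlat x (F j x) (F k x)) x₀ :=
    contMDiffAt_finsetSum fun j _ => contMDiffAt_finsetSum fun k _ =>
      ((hcs X hX j).mul (hcs Y hY k)).mul (hγ j k x₀)
  refine hsum.congr_of_eventuallyEq ?_
  filter_upwards [hcZ] with x hx
  change S.gammaFlat x (X x) (Y x) = _
  conv_lhs => rw [hx X, hx Y]
  simp only [map_sum, map_smul, LinearMap.sum_apply, LinearMap.smul_apply, smul_eq_mul,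
    Finset.mul_sum]
  rw [Finset.sum_comm]
  exact Finset.sum_congr rfl fun i _ => Finset.sum_congr rfl fun j _ => by ring

end SplitRegularPoisson

section Linear

variable {E : Type*} [NormedAddCommGroup E] [NormedSpace ℝ E] [FiniteDimensional ℝ E]
  {H : Type*} [TopologicalSpace H] {I : ModelWithCorners ℝ E H}
  {M : Type*} [TopologicalSpace M] [ChartedSpace H M]

theorem BiField.skew {P : BiField I M} (hP : ∀ x a, P x a a = 0) (x : M) (a b : Cotangent I x) :
    P x a b = - P x b a := by
  have h := hP x (a + b)
  simp only [map_add, LinearMap.add_apply, hP] at h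
  linarith

theorem BiField.apply_sharp_swap {P : BiField I M} (hP : ∀ x a, P x a a = 0) (x : M)
    (a b : Cotangent I x) : a (sharp I P x b) = - b (sharp I P x a) := by
  rw [apply_sharp, apply_sharp, BiField.skew hP]

theorem sharp_sub (P Q : BiField I M) (x : M) (a : Cotangent I x) :
    sharp I (P - Q) x a = sharp I P x a - sharp I Q x a := by
  simp [sharp]

theorem sharp_comp (P : BiField I M) (L : ∀ x : M, Module.End ℝ (Cotangent I x)) (x : M)
    (a : Cotangent I x) : sharp I (fun x => P x ∘ₗ L x) x a = sharp I P x (L x a) := by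
  simp [sharp]

theorem Cotangent.eq_of_forall_apply {x : M} {u v : TangentSpace I x}
    (h : ∀ a : Cotangent I x, a u = a v) : u = v := by
  rw [← sub_eq_zero, ← Module.forall_dual_apply_eq_zero_iff ℝ]
  intro a
  rw [map_sub, h, sub_self]

end Linear

namespace SplitRegularPoisson

variable {E : Type*} [NormedAddCommGroup E] [NormedSpace ℝ E] [FiniteDimensional ℝ E]
  {H : Type*} [TopologicalSpace H] {I : ModelWithCorners ℝ E H}
  {M : Type*} [TopologicalSpace M] [ChartedSpace H M] [IsManifold I ∞ M]
  (S : SplitRegularPoisson I M)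

theorem Pi_self (x : M) (a : Cotangent I x) : S.Pi x a a = 0 := S.isPoisson.1.1 x a

theorem prF_add_prG (x : M) (v : TangentSpace I x) : S.prF x v + S.prG x v = v := by
  have h := Submodule.projection_add_projection_eq_self (S.isCompl x) v
  exact h

theorem prG_eq_sub (x : M) (v : TangentSpace I x) : S.prG x v = v - S.prF x v := by
  rw [eq_sub_iff_add_eq', prF_add_prG]

theorem prF_mem (x : M) (v : TangentSpace I x) : S.prF x v ∈ S.TF x :=
  Submodule.projection_apply_mem (S.isCompl x) v

theorem prG_mem (x : M) (v : TangentSpace I x) : S.prG x v ∈ S.G x :=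
  Submodule.projection_apply_mem (S.isCompl x).symm v

theorem prF_of_mem {x : M} {v : TangentSpace I x} (hv : v ∈ S.TF x) : S.prF x v = v :=
  Submodule.projection_apply_of_mem_left (S.isCompl x) hv

theorem prF_of_mem_G {x : M} {v : TangentSpace I x} (hv : v ∈ S.G x) : S.prF x v = 0 :=
  (Submodule.projection_apply_eq_zero_iff (S.isCompl x)).2 hv

theorem prG_of_mem {x : M} {v : TangentSpace I x} (hv : v ∈ S.TF x) : S.prG x v = 0 := by
  rw [prG_eq_sub, prF_of_mem S hv, sub_self]

theorem prG_of_mem_G {x : M} {v : TangentSpace I x} (hv : v ∈ S.G x) : S.prG x v = v := by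
  rw [prG_eq_sub, prF_of_mem_G S hv, sub_zero]

@[simp] theorem gammaFlat_prG (x : M) (v : TangentSpace I x) : S.gammaFlat x (S.prG x v) = 0 :=
  S.gammaFlat_of_mem_G x (S.prG_mem x v)

@[simp] theorem gammaFlat_apply_prG (x : M) (u v : TangentSpace I x) :
    S.gammaFlat x u (S.prG x v) = 0 :=
  S.gammaFlat_apply_of_mem_G x u (S.prG_mem x v)

theorem gammaFlat_prF (x : M) (v : TangentSpace I x) :
    S.gammaFlat x (S.prF x v) = S.gammaFlat x v := by
  conv_rhs => rw [← S.prF_add_prG x v, map_add, gammaFlat_prG, add_zero]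

theorem gammaFlat_apply_prF (x : M) (u v : TangentSpace I x) :
    S.gammaFlat x u (S.prF x v) = S.gammaFlat x u v := by
  conv_rhs => rw [← S.prF_add_prG x v, map_add, gammaFlat_apply_prG, add_zero]

theorem gammaFlat_skew (x : M) (u v : TangentSpace I x) :
    S.gammaFlat x u v = - S.gammaFlat x v u := by
  rw [← S.gammaFlat_prF x u, ← S.gammaFlat_apply_prF x _ v, ← S.gammaFlat_prF x v,
    ← S.gammaFlat_apply_prF x _ u]
  obtain ⟨a, ha⟩ := S.prF_mem x u
  obtain ⟨b, hb⟩ := S.prF_mem x v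
  rw [← ha, ← hb, S.gammaFlat_sharp x a ⟨b, rfl⟩, S.gammaFlat_sharp x b ⟨a, rfl⟩,
    BiField.apply_sharp_swap S.Pi_self]

theorem sharp_gammaFlat (x : M) (v : TangentSpace I x) :
    sharp I S.Pi x (S.gammaFlat x v) = - S.prF x v := by
  refine Cotangent.eq_of_forall_apply fun a => ?_
  rw [BiField.apply_sharp_swap S.Pi_self, gammaFlat_skew, gammaFlat_sharp_apply, map_neg]
  ring

theorem idAddGammaSharp_apply (W : BiField I M) (x : M) (a : Cotangent I x) :
    S.idAddGammaSharp W x a = a + S.gammaFlat x (sharp I W x a) := rfl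

theorem expG_apply_idAddGammaSharp {W : BiField I M} (hW : S.MemI W) (x : M)
    (a b : Cotangent I x) :
    S.expG W x (S.idAddGammaSharp W x a) b = S.Pi x (S.idAddGammaSharp W x a) b + W x a b := by
  have h : Ring.inverse (S.idAddGammaSharp W x) (S.idAddGammaSharp W x a) = a := by
    rw [← Module.End.mul_apply, Ring.inverse_mul_cancel _ (hW x)]
    rfl
  change S.Pi x (S.idAddGammaSharp W x a) b +
    W x (Ring.inverse (S.idAddGammaSharp W x) (S.idAddGammaSharp W x a)) b = _
  rw [h]

theorem sharp_expG_idAddGammaSharp {W : BiField I M} (hW : S.MemI W) (x : M)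
    (a : Cotangent I x) :
    sharp I (S.expG W) x (S.idAddGammaSharp W x a) =
      sharp I S.Pi x a + S.prG x (sharp I W x a) := by
  refine Cotangent.eq_of_forall_apply fun b => ?_
  rw [apply_sharp, expG_apply_idAddGammaSharp S hW, ← apply_sharp, ← apply_sharp,
    idAddGammaSharp_apply, map_add, sharp_gammaFlat, prG_eq_sub]
  simp only [map_add, map_neg, map_sub]
  ring

theorem exists_idAddGammaSharp_eq {W : BiField I M} (hW : S.MemI W) (x : M)
    (a : Cotangent I x) : S.idAddGammaSharp W x (Ring.inverse (S.idAddGammaSharp W x) a) = a := by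
  rw [← Module.End.mul_apply, Ring.mul_inverse_cancel _ (hW x)]
  rfl

theorem expG_self {W : BiField I M} (hW : S.MemI W) (hW0 : ∀ x a, W x a a = 0) (x : M)
    (a : Cotangent I x) : S.expG W x a a = 0 := by
  rw [← S.exists_idAddGammaSharp_eq hW x a]
  set c := Ring.inverse (S.idAddGammaSharp W x) a
  rw [← apply_sharp, sharp_expG_idAddGammaSharp S hW, idAddGammaSharp_apply, LinearMap.add_apply,
    map_add, map_add, gammaFlat_apply_prG, gammaFlat_skew, gammaFlat_sharp_apply, apply_sharp,
    Pi_self, prG_eq_sub, map_sub, apply_sharp, hW0]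
  ring

/-- The difference of `Π + W'^γ` and `Π + W^γ` in terms of the difference of `W'` and `W`. -/
theorem expG_sub_expG {W W' : BiField I M} (hW : S.MemI W) (hW' : S.MemI W')
    (hW0' : ∀ x a, W' x a a = 0) (x : M) (a b : Cotangent I x) :
    S.expG W' x (S.idAddGammaSharp W x a) (S.idAddGammaSharp W' x b) -
      S.expG W x (S.idAddGammaSharp W x a) (S.idAddGammaSharp W' x b) = W' x a b - W x a b := by
  rw [BiField.skew (S.expG_self hW' hW0'), expG_apply_idAddGammaSharp S hW',
    expG_apply_idAddGammaSharp S hW, BiField.skew S.Pi_self, BiField.skew hW0' x b]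
  simp only [idAddGammaSharp_apply, map_add, LinearMap.add_apply]
  rw [BiField.skew hW0' x (S.gammaFlat x _), ← apply_sharp I W x a (S.gammaFlat x _),
    ← apply_sharp I W' x b (S.gammaFlat x _), gammaFlat_skew]
  ring

theorem expG_injective {W W' : BiField I M} (hW : S.MemI W) (hW' : S.MemI W')
    (hW0' : ∀ x a, W' x a a = 0) (h : S.expG W = S.expG W') :
    W = W' := by
  funext x
  ext a b
  have h1 := S.expG_sub_expG hW hW' hW0' x a b
  rw [h, sub_self] at h1
  linarith

/-- The field of endomorphisms `id - γ♭ ∘ (P - Π)♯`, whose inverse is `id + γ♭ ∘ W♯` for the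
`W` with `P = Π + W^γ`. -/
def idSubGammaSharp (P : BiField I M) (x : M) : Module.End ℝ (Cotangent I x) :=
  LinearMap.id - S.gammaFlat x ∘ₗ sharp I (P - S.Pi) x

/-- The inverse of `W ↦ Π + W^γ`. -/
def logG (P : BiField I M) : BiField I M :=
  fun x => (P - S.Pi) x ∘ₗ Ring.inverse (S.idSubGammaSharp P x)

theorem idSubGammaSharp_apply (P : BiField I M) (x : M) (a : Cotangent I x) :
    S.idSubGammaSharp P x a = a - S.gammaFlat x (sharp I (P - S.Pi) x a) := rfl

theorem idSubGammaSharp_apply' (P : BiField I M) (x : M) (a : Cotangent I x)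
    (v : TangentSpace I x) :
    S.idSubGammaSharp P x a v = a (S.prG x v) - S.gammaFlat x (sharp I P x a) v := by
  rw [idSubGammaSharp_apply, sharp_sub, map_sub, LinearMap.sub_apply, LinearMap.sub_apply,
    gammaFlat_sharp_apply, prG_eq_sub, map_sub]
  ring

theorem idAddGammaSharp_logG {P : BiField I M} (hP : ∀ x, IsUnit (S.idSubGammaSharp P x)) (x : M) :
    S.idAddGammaSharp (S.logG P) x = Ring.inverse (S.idSubGammaSharp P x) := by
  have h : S.idAddGammaSharp (S.logG P) x * S.idSubGammaSharp P x = 1 := by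
    refine LinearMap.ext fun a => ?_
    have h1 : Ring.inverse (S.idSubGammaSharp P x) (S.idSubGammaSharp P x a) = a := by
      rw [← Module.End.mul_apply, Ring.inverse_mul_cancel _ (hP x)]
      rfl
    have h2 : sharp I (S.logG P) x (S.idSubGammaSharp P x a) = sharp I (P - S.Pi) x a :=
      (sharp_comp _ _ _ _).trans (by rw [h1])
    rw [Module.End.mul_apply, idAddGammaSharp_apply, h2, idSubGammaSharp_apply]
    simp
  calc S.idAddGammaSharp (S.logG P) x
      = S.idAddGammaSharp (S.logG P) x * (S.idSubGammaSharp P x *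
          Ring.inverse (S.idSubGammaSharp P x)) := by
        rw [Ring.mul_inverse_cancel _ (hP x), mul_one]
    _ = _ := by rw [← mul_assoc, h, one_mul]

theorem memI_logG {P : BiField I M} (hP : ∀ x, IsUnit (S.idSubGammaSharp P x)) :
    S.MemI (S.logG P) := fun x => by
  rw [idAddGammaSharp_logG S hP]
  exact (hP x).ringInverse

theorem expG_logG {P : BiField I M} (hP : ∀ x, IsUnit (S.idSubGammaSharp P x)) :
    S.expG (S.logG P) = P := by
  funext x
  have h : Ring.inverse (S.idAddGammaSharp (S.logG P) x) = S.idSubGammaSharp P x := by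
    rw [idAddGammaSharp_logG S hP, Ring.inverse_inverse (hP x)]
  ext a b
  have h1 : Ring.inverse (S.idSubGammaSharp P x) (S.idSubGammaSharp P x a) = a := by
    rw [← Module.End.mul_apply, Ring.inverse_mul_cancel _ (hP x)]
    rfl
  change S.Pi x a b + (P - S.Pi) x (Ring.inverse (S.idSubGammaSharp P x)
    (Ring.inverse (S.idAddGammaSharp (S.logG P) x) a)) b = _
  rw [h, h1]
  simp

theorem logG_self {P : BiField I M} (hP : ∀ x, IsUnit (S.idSubGammaSharp P x))
    (hP0 : ∀ x a, P x a a = 0) (x : M) (a : Cotangent I x) : S.logG P x a a = 0 := by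
  have h2 : S.idSubGammaSharp P x (Ring.inverse (S.idSubGammaSharp P x) a) = a := by
    rw [← Module.End.mul_apply, Ring.mul_inverse_cancel _ (hP x)]
    rfl
  set c := Ring.inverse (S.idSubGammaSharp P x) a with hc
  have h0 : ∀ x a, (P - S.Pi) x a a = 0 := fun x a => by
    simp [hP0, Pi_self]
  change (P - S.Pi) x (Ring.inverse (S.idSubGammaSharp P x) a) a = 0
  rw [← hc, ← h2, idSubGammaSharp_apply, map_sub, h0, BiField.skew h0, ← apply_sharp]
  have h3 := S.gammaFlat_skew x (sharp I (P - S.Pi) x c) (sharp I (P - S.Pi) x c)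
  rw [BiField.apply_sharp_swap h0]
  linarith

end SplitRegularPoisson

section Courant

variable {E : Type*} [NormedAddCommGroup E] [NormedSpace ℝ E] [FiniteDimensional ℝ E]
  {H : Type*} [TopologicalSpace H] {I : ModelWithCorners ℝ E H}
  {M : Type*} [TopologicalSpace M] [ChartedSpace H M]

/-- The Courant tensor `⟨⟦e₁, e₂⟧, e₃⟩` of sections of `TM ⊕ T*M`, where `⟦·,·⟧` is the
Dorfman bracket. -/
def courant (e₁ e₂ e₃ : VecField I M × OneForm I M) (x : M) : ℝ :=
  e₃.2 x (VectorField.mlieBracket I e₁.1 e₂.1 x)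
    + vderiv I e₁.1 (fun y => e₂.2 y (e₃.1 y)) x - e₂.2 x (VectorField.mlieBracket I e₁.1 e₃.1 x)
    - vderiv I e₂.1 (fun y => e₁.2 y (e₃.1 y)) x + vderiv I e₃.1 (fun y => e₁.2 y (e₂.1 y)) x
    + e₁.2 x (VectorField.mlieBracket I e₂.1 e₃.1 x)

variable (I) in
/-- The section `(P♯α, α)` of the graph of a bivector field. -/
def graphSec (P : BiField I M) (α : OneForm I M) : VecField I M × OneForm I M :=
  (sharpField I P α, α)

theorem vderiv_add_left (X Y : VecField I M) (f : M → ℝ) (x : M) :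
    vderiv I (X + Y) f x = vderiv I X f x + vderiv I Y f x :=
  map_add (dform I f x) (X x) (Y x)

theorem vderiv_add {X : VecField I M} {f g : M → ℝ} {x : M}
    (hf : MDifferentiableAt I 𝓘(ℝ, ℝ) f x) (hg : MDifferentiableAt I 𝓘(ℝ, ℝ) g x) :
    vderiv I X (fun y => f y + g y) x = vderiv I X f x + vderiv I X g x := by
  simp only [vderiv_eq_dform, dform_add hf hg, LinearMap.add_apply]

@[simp] theorem vderiv_zero (X : VecField I M) (x : M) : vderiv I X (fun _ => 0) x = 0 := by
  rw [vderiv_eq_dform, dform_const, LinearMap.zero_apply]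

theorem schoutenBB_self_eq_courant (P : BiField I M) (α β δ : OneForm I M) (x : M) :
    schoutenBB P P α β δ x =
      2 * courant (graphSec I P α) (graphSec I P β) (graphSec I P δ) x := by
  have h : (fun y => P y (β y) (δ y)) = fun y => δ y (sharpField I P β y) := by
    funext y
    exact (apply_sharp I P y _ _).symm
  simp only [schoutenBB, AlmostLieData.bracketBB, AlmostLieData.bracketVB, AlmostLieData.lie,
    AlmostLieData.d, tangentLie, courant, graphSec, h]
  ring

theorem bracketVB_eq_courant (P : BiField I M) (Y : VecField I M) (α β : OneForm I M) (x : M) :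
    (tangentLie I M).bracketVB Y P α β x =
      courant (Y, 0) (graphSec I P α) (graphSec I P β) x := by
  have h : (fun y => P y (α y) (β y)) = fun y => β y (sharpField I P α y) := by
    funext y
    exact (apply_sharp I P y _ _).symm
  simp only [AlmostLieData.bracketVB, AlmostLieData.lie, tangentLie, courant, graphSec, h,
    Pi.zero_apply, LinearMap.zero_apply, vderiv_zero]
  ring

theorem schoutenBB_eq_courant (P W : BiField I M) (α β δ : OneForm I M) (x : M) :
    schoutenBB P W α β δ x =
      courant (graphSec I P α) (graphSec I P β) (sharpField I W δ, 0) x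
      + courant (graphSec I P α) (sharpField I W β, 0) (graphSec I P δ) x
      + courant (sharpField I W α, 0) (graphSec I P β) (graphSec I P δ) x := by
  have h : (fun y => P y (β y) (δ y)) = fun y => δ y (sharpField I P β y) := by
    funext y
    exact (apply_sharp I P y _ _).symm
  have h' : (fun y => W y (β y) (δ y)) = fun y => δ y (sharpField I W β y) := by
    funext y
    exact (apply_sharp I W y _ _).symm
  simp only [schoutenBB, AlmostLieData.bracketBB, AlmostLieData.bracketVB, AlmostLieData.lie,
    AlmostLieData.d, tangentLie, courant, graphSec, h, h', Pi.zero_apply, LinearMap.zero_apply,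
    vderiv_zero]
  ring

variable [IsManifold I ∞ M]

/-- Smooth sections of `TM ⊕ T*M`. -/
def SmoothGen (e : VecField I M × OneForm I M) : Prop := SmoothVec I e.1 ∧ SmoothForm I e.2

theorem SmoothGen.pairing {e f : VecField I M × OneForm I M} (he : SmoothGen e)
    (hf : SmoothGen f) (x : M) : MDifferentiableAt I 𝓘(ℝ, ℝ) (fun y => e.2 y (f.1 y)) x :=
  (he.2 _ hf.1 x).mdifferentiableAt (by simp)

theorem SmoothForm.add {α β : OneForm I M} (hα : SmoothForm I α) (hβ : SmoothForm I β) :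
    SmoothForm I (α + β) := fun X hX => (hα X hX).add (hβ X hX)

theorem smoothForm_zero : SmoothForm I (0 : OneForm I M) := fun _ _ => contMDiff_const

theorem SmoothGen.add {e f : VecField I M × OneForm I M} (he : SmoothGen e)
    (hf : SmoothGen f) : SmoothGen (e + f) := ⟨he.1.add hf.1, he.2.add hf.2⟩

theorem SmoothVec.smoothGen {X : VecField I M} (hX : SmoothVec I X) :
    SmoothGen (X, (0 : OneForm I M)) := ⟨hX, smoothForm_zero⟩

theorem courant_add_left {e e' f g : VecField I M × OneForm I M} (he : SmoothGen e)
    (he' : SmoothGen e') (hf : SmoothGen f) (hg : SmoothGen g) (x : M) :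
    courant (e + e') f g x = courant e f g x + courant e' f g x := by
  simp only [courant, Prod.fst_add, Prod.snd_add, Pi.add_apply, LinearMap.add_apply]
  rw [vderiv_add (he.pairing hg x) (he'.pairing hg x),
    vderiv_add (he.pairing hf x) (he'.pairing hf x),
    VectorField.mlieBracket_add_left (he.1.mdifferentiableAt x) (he'.1.mdifferentiableAt x),
    VectorField.mlieBracket_add_left (he.1.mdifferentiableAt x) (he'.1.mdifferentiableAt x),
    vderiv_add_left]
  simp only [map_add]
  ring

theorem courant_add_mid {e f f' g : VecField I M × OneForm I M} (he : SmoothGen e)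
    (hf : SmoothGen f) (hf' : SmoothGen f') (hg : SmoothGen g) (x : M) :
    courant e (f + f') g x = courant e f g x + courant e f' g x := by
  simp only [courant, Prod.fst_add, Prod.snd_add, Pi.add_apply, LinearMap.add_apply, map_add]
  rw [vderiv_add (hf.pairing hg x) (hf'.pairing hg x),
    vderiv_add (he.pairing hf x) (he.pairing hf' x),
    VectorField.mlieBracket_add_right (hf.1.mdifferentiableAt x) (hf'.1.mdifferentiableAt x),
    VectorField.mlieBracket_add_left (hf.1.mdifferentiableAt x) (hf'.1.mdifferentiableAt x),
    vderiv_add_left]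
  simp only [map_add]
  ring

theorem courant_add_right {e f g g' : VecField I M × OneForm I M} (he : SmoothGen e)
    (hf : SmoothGen f) (hg : SmoothGen g) (hg' : SmoothGen g') (x : M) :
    courant e f (g + g') x = courant e f g x + courant e f g' x := by
  simp only [courant, Prod.fst_add, Prod.snd_add, Pi.add_apply, LinearMap.add_apply, map_add]
  rw [vderiv_add (hf.pairing hg x) (hf.pairing hg' x),
    vderiv_add (he.pairing hg x) (he.pairing hg' x),
    VectorField.mlieBracket_add_right (hg.1.mdifferentiableAt x) (hg'.1.mdifferentiableAt x),
    VectorField.mlieBracket_add_right (hg.1.mdifferentiableAt x) (hg'.1.mdifferentiableAt x),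
    vderiv_add_left]
  simp only [map_add]
  ring

theorem courant_swap_left {e f g : VecField I M × OneForm I M} (he : SmoothGen e)
    (hf : SmoothGen f) (x : M) :
    courant e f g x = - courant f e g x
      + vderiv I g.1 (fun y => e.2 y (f.1 y) + f.2 y (e.1 y)) x := by
  simp only [courant]
  rw [vderiv_add (he.pairing hf x) (hf.pairing he x),
    VectorField.mlieBracket_swap_apply (V := e.1) (W := f.1)]
  simp only [map_neg]
  ring

theorem courant_swap_right {e f g : VecField I M × OneForm I M}
    (hf : SmoothGen f) (hg : SmoothGen g) (x : M) :
    courant e f g x = - courant e g f x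
      + vderiv I e.1 (fun y => f.2 y (g.1 y) + g.2 y (f.1 y)) x := by
  simp only [courant]
  rw [vderiv_add (hf.pairing hg x) (hg.pairing hf x),
    VectorField.mlieBracket_swap_apply (V := f.1) (W := g.1)]
  simp only [map_neg]
  ring

end Courant

namespace SplitRegularPoisson

variable {E : Type*} [NormedAddCommGroup E] [NormedSpace ℝ E] [FiniteDimensional ℝ E]
  {H : Type*} [TopologicalSpace H] {I : ModelWithCorners ℝ E H}
  {M : Type*} [TopologicalSpace M] [ChartedSpace H M] [IsManifold I ∞ M]
  (S : SplitRegularPoisson I M)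

/-- The section `(pr_G X, ι_X γ)` of `TM ⊕ T*M`. -/
def splitSec (X : VecField I M) : VecField I M × OneForm I M := (S.prGField X, S.gammaField X)

theorem prG_eq_add (x : M) (v : TangentSpace I x) :
    S.prG x v = v + sharp I S.Pi x (S.gammaFlat x v) := by
  rw [sharp_gammaFlat, prG_eq_sub, sub_eq_add_neg]

theorem prGField_eq (X : VecField I M) :
    S.prGField X = X + sharpField I S.Pi (S.gammaField X) :=
  funext fun x => S.prG_eq_add x (X x)

theorem splitSec_eq (X : VecField I M) :
    S.splitSec X = (X, 0) + graphSec I S.Pi (S.gammaField X) := by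
  rw [splitSec, prGField_eq, graphSec, Prod.mk_add_mk, zero_add]

theorem graphSec_expG {W : BiField I M} (hW : S.MemI W) (α : OneForm I M) :
    graphSec I (S.expG W) (fun x => S.idAddGammaSharp W x (α x)) =
      graphSec I S.Pi α + S.splitSec (sharpField I W α) := by
  refine Prod.ext (funext fun x => ?_) rfl
  exact S.sharp_expG_idAddGammaSharp hW x (α x)

theorem courant_splitSec_splitSec_graphSec (X Y : VecField I M) (α : OneForm I M) (x : M) :
    courant (S.splitSec X) (S.splitSec Y) (graphSec I S.Pi α) x = S.gammaLie.pairing X Y α x := by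
  have h : (fun y => S.gammaField X y (S.prGField Y y)) = fun _ => 0 :=
    funext fun y => S.gammaFlat_apply_prG y _ _
  simp only [courant, splitSec, graphSec, h, vderiv_zero, gammaLie, lieForm]
  ring

theorem courant_splitSec (X Y Z : VecField I M) (x : M) :
    courant (S.splitSec X) (S.splitSec Y) (S.splitSec Z) x = S.Upsilon X Y Z x := by
  have h : ∀ X Y, (fun y => S.gammaField X y (S.prGField Y y)) = fun _ => 0 := fun X Y =>
    funext fun y => S.gammaFlat_apply_prG y _ _
  simp only [courant, splitSec, h, vderiv_zero, Upsilon, gamma]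
  rw [VectorField.mlieBracket_swap_apply (V := S.prGField Z)]
  simp only [map_neg, gammaField]
  ring

theorem graphSec_pairing_splitSec (α : OneForm I M) (X : VecField I M) (y : M) :
    (graphSec I S.Pi α).2 y ((S.splitSec X).1 y) + (S.splitSec X).2 y ((graphSec I S.Pi α).1 y) =
      α y (X y) := by
  change α y (S.prG y (X y)) + S.gammaFlat y (X y) (sharp I S.Pi y (α y)) = _
  rw [gammaFlat_skew, gammaFlat_sharp_apply, prG_eq_sub, map_sub]
  ring

theorem Upsilon_swap_left (X Y Z : VecField I M) (x : M) :
    S.Upsilon Y X Z x = - S.Upsilon X Y Z x := by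
  simp only [Upsilon, gamma]
  rw [VectorField.mlieBracket_swap_apply (V := S.prGField Y) (W := S.prGField X),
    VectorField.mlieBracket_swap_apply (V := S.prGField X) (W := S.prGField Z),
    VectorField.mlieBracket_swap_apply (V := S.prGField Y) (W := S.prGField Z)]
  simp only [map_neg]
  ring

theorem Upsilon_swap_right (X Y Z : VecField I M) (x : M) :
    S.Upsilon X Z Y x = - S.Upsilon X Y Z x := by
  simp only [Upsilon, gamma]
  rw [VectorField.mlieBracket_swap_apply (V := S.prGField Y) (W := S.prGField X),
    VectorField.mlieBracket_swap_apply (V := S.prGField X) (W := S.prGField Z),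
    VectorField.mlieBracket_swap_apply (V := S.prGField Z) (W := S.prGField Y)]
  simp only [map_neg]
  ring

theorem Upsilon_perm (v : Fin 3 → VecField I M) (x : M) (τ : Equiv.Perm (Fin 3)) :
    ((Equiv.Perm.sign τ : ℤ) : ℝ) * S.Upsilon (v (τ 0)) (v (τ 1)) (v (τ 2)) x =
      S.Upsilon (v 0) (v 1) (v 2) x := by
  have key : ∀ (w : Fin 3 → VecField I M) (i j : Fin 3), i ≠ j →
      S.Upsilon (w (Equiv.swap i j 0)) (w (Equiv.swap i j 1)) (w (Equiv.swap i j 2)) x =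
        - S.Upsilon (w 0) (w 1) (w 2) x := by
    have h01 : ∀ w : Fin 3 → VecField I M, S.Upsilon (w 1) (w 0) (w 2) x =
        - S.Upsilon (w 0) (w 1) (w 2) x := fun w => S.Upsilon_swap_left _ _ _ x
    have h12 : ∀ w : Fin 3 → VecField I M, S.Upsilon (w 0) (w 2) (w 1) x =
        - S.Upsilon (w 0) (w 1) (w 2) x := fun w => S.Upsilon_swap_right _ _ _ x
    have h02 : ∀ w : Fin 3 → VecField I M, S.Upsilon (w 2) (w 1) (w 0) x =
        - S.Upsilon (w 0) (w 1) (w 2) x := fun w => by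
      rw [S.Upsilon_swap_left, S.Upsilon_swap_right, S.Upsilon_swap_left]
      ring
    intro w i j hij
    fin_cases i <;> fin_cases j <;> first | exact absurd rfl hij | skip
    · exact h01 w
    · exact h02 w
    · exact h01 w
    · exact h12 w
    · exact h02 w
    · exact h12 w
  induction τ using Equiv.Perm.swap_induction_on' with
  | one => simp
  | mul_swap f i j hij ih =>
    rw [Equiv.Perm.sign_mul, Equiv.Perm.sign_swap hij]
    have h := key (fun k => v (f k)) i j hij
    simp only [Equiv.Perm.mul_apply]
    rw [h, ← ih]
    push_cast
    ring

end SplitRegularPoisson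

namespace SplitRegularPoisson

variable {E : Type*} [NormedAddCommGroup E] [NormedSpace ℝ E] [FiniteDimensional ℝ E]
  {H : Type*} [TopologicalSpace H] {I : ModelWithCorners ℝ E H}
  {M : Type*} [TopologicalSpace M] [ChartedSpace H M] [IsManifold I ∞ M] [T2Space M]
  (S : SplitRegularPoisson I M)

theorem smooth_prGField {X : VecField I M} (hX : SmoothVec I X) : SmoothVec I (S.prGField X) := by
  rw [prGField_eq]
  exact hX.add (S.isPoisson.1.smooth_sharp (S.smooth_gammaField hX))

theorem smoothGen_splitSec {X : VecField I M} (hX : SmoothVec I X) : SmoothGen (S.splitSec X) :=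
  ⟨S.smooth_prGField hX, S.smooth_gammaField hX⟩

theorem _root_.RegPoisson.IsBivectorField.smoothGen {P : BiField I M} (hP : IsBivectorField I P)
    {α : OneForm I M} (hα : SmoothForm I α) : SmoothGen (graphSec I P α) :=
  ⟨hP.smooth_sharp hα, hα⟩

theorem smoothGen_graphSec {α : OneForm I M} (hα : SmoothForm I α) :
    SmoothGen (graphSec I S.Pi α) := S.isPoisson.1.smoothGen hα

theorem courant_graphSec {α β δ : OneForm I M} (hα : SmoothForm I α) (hβ : SmoothForm I β)
    (hδ : SmoothForm I δ) (x : M) :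
    courant (graphSec I S.Pi α) (graphSec I S.Pi β) (graphSec I S.Pi δ) x = 0 := by
  have h := S.isPoisson.2 α β δ hα hβ hδ x
  rw [schoutenBB_self_eq_courant] at h
  linarith

theorem courant_splitSec_graphSec_graphSec {X : VecField I M} {α β : OneForm I M}
    (hX : SmoothVec I X) (hα : SmoothForm I α) (hβ : SmoothForm I β) (x : M) :
    courant (S.splitSec X) (graphSec I S.Pi α) (graphSec I S.Pi β) x =
      courant (X, 0) (graphSec I S.Pi α) (graphSec I S.Pi β) x := by
  rw [splitSec_eq, courant_add_left hX.smoothGen (S.smoothGen_graphSec (S.smooth_gammaField hX))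
    (S.smoothGen_graphSec hα) (S.smoothGen_graphSec hβ),
    S.courant_graphSec (S.smooth_gammaField hX) hα hβ, add_zero]

theorem courant_graphSec_splitSec_graphSec {X : VecField I M} {α β : OneForm I M}
    (hX : SmoothVec I X) (hα : SmoothForm I α) (hβ : SmoothForm I β) (x : M) :
    courant (graphSec I S.Pi α) (S.splitSec X) (graphSec I S.Pi β) x =
      courant (graphSec I S.Pi α) (X, 0) (graphSec I S.Pi β) x := by
  rw [splitSec_eq, courant_add_mid (S.smoothGen_graphSec hα) hX.smoothGen
    (S.smoothGen_graphSec (S.smooth_gammaField hX)) (S.smoothGen_graphSec hβ),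
    S.courant_graphSec hα (S.smooth_gammaField hX) hβ, add_zero]

theorem courant_graphSec_graphSec_splitSec {X : VecField I M} {α β : OneForm I M}
    (hX : SmoothVec I X) (hα : SmoothForm I α) (hβ : SmoothForm I β) (x : M) :
    courant (graphSec I S.Pi α) (graphSec I S.Pi β) (S.splitSec X) x =
      courant (graphSec I S.Pi α) (graphSec I S.Pi β) (X, 0) x := by
  rw [splitSec_eq, courant_add_right (S.smoothGen_graphSec hα) (S.smoothGen_graphSec hβ)
    hX.smoothGen (S.smoothGen_graphSec (S.smooth_gammaField hX)),
    S.courant_graphSec hα hβ (S.smooth_gammaField hX), add_zero]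

theorem courant_splitSec_graphSec_splitSec {X Y : VecField I M} {α : OneForm I M}
    (hY : SmoothVec I Y) (hα : SmoothForm I α) (x : M) :
    courant (S.splitSec X) (graphSec I S.Pi α) (S.splitSec Y) x =
      vderiv I (S.prGField X) (fun y => α y (Y y)) x - S.gammaLie.pairing X Y α x := by
  rw [courant_swap_right (S.smoothGen_graphSec hα) (S.smoothGen_splitSec hY),
    courant_splitSec_splitSec_graphSec]
  simp_rw [graphSec_pairing_splitSec]
  rw [splitSec]
  ring

theorem courant_graphSec_splitSec_splitSec {X Y : VecField I M} {α : OneForm I M}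
    (hX : SmoothVec I X) (hY : SmoothVec I Y) (hα : SmoothForm I α) (x : M) :
    courant (graphSec I S.Pi α) (S.splitSec X) (S.splitSec Y) x =
      S.gammaLie.pairing X Y α x - vderiv I (S.prGField X) (fun y => α y (Y y)) x
        + vderiv I (S.prGField Y) (fun y => α y (X y)) x := by
  rw [courant_swap_left (S.smoothGen_graphSec hα) (S.smoothGen_splitSec hX),
    S.courant_splitSec_graphSec_splitSec hY hα]
  simp_rw [graphSec_pairing_splitSec]
  rw [splitSec]
  ring

theorem bracketVB_gammaLie_eq_courant {W : BiField I M} (hW : IsBivectorField I W)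
    {X : VecField I M} {α β : OneForm I M}
    (hα : SmoothForm I α) (hβ : SmoothForm I β) (x : M) :
    S.gammaLie.bracketVB X W α β x =
      courant (S.splitSec X) (S.splitSec (sharpField I W α)) (graphSec I S.Pi β) x
      + courant (S.splitSec X) (graphSec I S.Pi α) (S.splitSec (sharpField I W β)) x := by
  rw [courant_splitSec_splitSec_graphSec,
    S.courant_splitSec_graphSec_splitSec (hW.smooth_sharp hβ) hα]
  have h : (fun y => W y (α y) (β y)) = fun y => β y (sharpField I W α y) := by
    funext y
    exact (apply_sharp I W y _ _).symm
  simp only [AlmostLieData.bracketVB, AlmostLieData.lie, h]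
  simp only [gammaLie]
  ring

theorem l2BB_eq_courant {W : BiField I M} (hW : IsBivectorField I W)
    {α β δ : OneForm I M} (hα : SmoothForm I α) (hβ : SmoothForm I β) (hδ : SmoothForm I δ)
    (x : M) :
    S.l2BB W W α β δ x = 2 * (
      courant (graphSec I S.Pi α) (S.splitSec (sharpField I W β)) (S.splitSec (sharpField I W δ)) x
      + courant (S.splitSec (sharpField I W α)) (graphSec I S.Pi β) (S.splitSec (sharpField I W δ)) x
      + courant (S.splitSec (sharpField I W α)) (S.splitSec (sharpField I W β))
        (graphSec I S.Pi δ) x) := by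
  rw [l2BB, AlmostLieData.bracketBB,
    S.bracketVB_gammaLie_eq_courant hW hβ hδ,
    S.courant_graphSec_splitSec_splitSec (hW.smooth_sharp hβ) (hW.smooth_sharp hδ) hα,
    AlmostLieData.d]
  simp only [gammaLie]
  ring

theorem l3BBB_self (W : BiField I M) (α β δ : OneForm I M) (x : M) :
    S.l3BBB W W W α β δ x =
      6 * S.Upsilon (sharpField I W α) (sharpField I W β) (sharpField I W δ) x := by
  have h := S.Upsilon_perm (fun i => sharpField I W (![α, β, δ] i)) x
  simp only [l3BBB, sharpUpsilonBBB, h, neg_neg, Finset.sum_const, Finset.card_univ,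
    Fintype.card_perm, Fintype.card_fin, nsmul_eq_mul]
  norm_num [Nat.factorial]
  rfl

theorem l3VBB_self (X : VecField I M) (W : BiField I M) (α β : OneForm I M) (x : M) :
    S.l3VBB X W W α β x = - 2 * S.Upsilon X (sharpField I W α) (sharpField I W β) x := by
  have h : (Finset.univ : Finset (Equiv.Perm (Fin 2))) = {1, Equiv.swap 0 1} := by decide
  have h1 : (1 : Equiv.Perm (Fin 2)) ≠ Equiv.swap 0 1 := by decide
  simp only [l3VBB, sharpUpsilonVBB, h]
  rw [Finset.sum_pair h1]
  simp [S.Upsilon_swap_right X (sharpField I W α) (sharpField I W β)]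
  ring

theorem smooth_idAddGammaSharp {W : BiField I M} (hW : IsBivectorField I W) {α : OneForm I M}
    (hα : SmoothForm I α) : SmoothForm I (fun x => S.idAddGammaSharp W x (α x)) :=
  hα.add (S.smooth_gammaField (hW.smooth_sharp hα))

/-- The Schouten bracket of `Π + W^γ` with itself is the Maurer-Cartan expression of `W`. -/
theorem schoutenBB_expG {W : BiField I M} (hW : IsBivectorField I W) (hI : S.MemI W)
    {α β δ : OneForm I M} (hα : SmoothForm I α) (hβ : SmoothForm I β) (hδ : SmoothForm I δ)
    (x : M) :
    schoutenBB (S.expG W) (S.expG W) (fun x => S.idAddGammaSharp W x (α x))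
        (fun x => S.idAddGammaSharp W x (β x)) (fun x => S.idAddGammaSharp W x (δ x)) x =
      2 * (S.l1B W α β δ x + (1 / 2) * S.l2BB W W α β δ x
        + (1 / 6) * S.l3BBB W W W α β δ x) := by
  have hα' := S.smoothGen_graphSec hα
  have hβ' := S.smoothGen_graphSec hβ
  have hδ' := S.smoothGen_graphSec hδ
  have wα := hW.smooth_sharp hα
  have wβ := hW.smooth_sharp hβ
  have wδ := hW.smooth_sharp hδ
  have bα := S.smoothGen_splitSec wα
  have bβ := S.smoothGen_splitSec wβ
  have bδ := S.smoothGen_splitSec wδ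
  rw [schoutenBB_self_eq_courant, S.graphSec_expG hI, S.graphSec_expG hI, S.graphSec_expG hI,
    courant_add_left hα' bα (hβ'.add bβ) (hδ'.add bδ),
    courant_add_mid hα' hβ' bβ (hδ'.add bδ), courant_add_mid bα hβ' bβ (hδ'.add bδ),
    courant_add_right hα' hβ' hδ' bδ, courant_add_right hα' bβ hδ' bδ,
    courant_add_right bα hβ' hδ' bδ, courant_add_right bα bβ hδ' bδ,
    S.courant_graphSec hα hβ hδ, S.courant_splitSec_graphSec_graphSec wα hβ hδ,
    S.courant_graphSec_splitSec_graphSec wβ hα hδ, S.courant_graphSec_graphSec_splitSec wδ hα hβ,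
    S.courant_splitSec, l1B, schoutenBB_eq_courant, S.l2BB_eq_courant hW hα hβ hδ, l3BBB_self]
  ring

/-- If `P = Π + W^γ` is Poisson and `Y = pr_G X - P♯ ι_X γ`, then `- L_Y P` corresponds to the
right-hand side of the gauge equation. -/
theorem bracketVB_expG {W : BiField I M} (hW : IsBivectorField I W) (hI : S.MemI W)
    (hP : IsPoisson (S.expG W)) {X : VecField I M} (hX : SmoothVec I X)
    {α β : OneForm I M} (hα : SmoothForm I α) (hβ : SmoothForm I β) (x : M) :
    - (tangentLie I M).bracketVB
        (S.prGField X - sharpField I (S.expG W) (S.gammaField X)) (S.expG W)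
        (fun x => S.idAddGammaSharp W x (α x)) (fun x => S.idAddGammaSharp W x (β x)) x =
      S.l1V X α β x + S.l2VB X W α β x + (1 / 2) * S.l3VBB X W W α β x := by
  set Y := S.prGField X - sharpField I (S.expG W) (S.gammaField X) with hY
  set A : OneForm I M := fun x => S.idAddGammaSharp W x (α x)
  set B : OneForm I M := fun x => S.idAddGammaSharp W x (β x)
  have hη := S.smooth_gammaField hX
  have hA : SmoothForm I A := S.smooth_idAddGammaSharp hW hα
  have hB : SmoothForm I B := S.smooth_idAddGammaSharp hW hβ
  have hα' := S.smoothGen_graphSec hα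
  have hβ' := S.smoothGen_graphSec hβ
  have wα := hW.smooth_sharp hα
  have wβ := hW.smooth_sharp hβ
  have bα := S.smoothGen_splitSec wα
  have bβ := S.smoothGen_splitSec wβ
  have bX := S.smoothGen_splitSec hX
  have hYs : SmoothVec I Y := by
    have h := ContMDiff.sub_section (V := TangentSpace I) (S.smooth_prGField hX)
      (hP.1.smooth_sharp hη)
    exact h
  have e1 : S.splitSec X = (Y, 0) + graphSec I (S.expG W) (S.gammaField X) := by
    simp [splitSec, graphSec, hY]
  have e2 : courant (graphSec I (S.expG W) (S.gammaField X)) (graphSec I (S.expG W) A)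
      (graphSec I (S.expG W) B) x = 0 := by
    have h := hP.2 _ A B hη hA hB x
    rw [schoutenBB_self_eq_courant] at h
    linarith
  have e3 : courant (S.splitSec X) (graphSec I (S.expG W) A) (graphSec I (S.expG W) B) x =
      courant (Y, 0) (graphSec I (S.expG W) A) (graphSec I (S.expG W) B) x := by
    rw [e1, courant_add_left hYs.smoothGen (hP.1.smoothGen hη) (hP.1.smoothGen hA)
      (hP.1.smoothGen hB), e2, add_zero]
  rw [bracketVB_eq_courant, ← e3, S.graphSec_expG hI, S.graphSec_expG hI,
    courant_add_mid bX hα' bα (hβ'.add bβ), courant_add_right bX hα' hβ' bβ,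
    courant_add_right bX bα hβ' bβ, S.courant_splitSec_graphSec_graphSec hX hα hβ,
    S.courant_splitSec, l1V, schoutenBV, bracketVB_eq_courant, l2VB,
    S.bracketVB_gammaLie_eq_courant hW hα hβ, l3VBB_self]
  ring

/-! ### Smooth families -/

theorem famForm_gammaField {X : ℝ → VecField I M} (hX : FamVec I X) :
    FamForm I (fun t => S.gammaField (X t)) := by
  intro V hV
  have h : (fun t x => S.gammaField (X t) x (V x)) = fun t x => - S.gammaField V x (X t x) := by
    funext t x
    exact S.gammaFlat_skew x _ _
  rw [h]
  exact (hX _ (S.smooth_gammaField hV)).neg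

theorem famVec_prGField {X : ℝ → VecField I M} (hX : FamVec I X) :
    FamVec I (fun t => S.prGField (X t)) := by
  simp_rw [prGField_eq]
  exact hX.add ((FamBi.of_smooth S.isPoisson.1).sharp (S.famForm_gammaField hX))

theorem famEnd_idAddGammaSharp {W : ℝ → BiField I M} (hW : FamBi I W) :
    FamEnd I (fun t => S.idAddGammaSharp (W t)) := fun _ hα =>
  FamForm.add (.of_smooth hα) (S.famForm_gammaField (hW.sharp (.of_smooth hα)))

theorem famEnd_idSubGammaSharp {P : ℝ → BiField I M} (hP : FamBi I P) :
    FamEnd I (fun t => S.idSubGammaSharp (P t)) := fun _ hα =>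
  FamForm.sub (.of_smooth hα) (S.famForm_gammaField
    ((hP.sub (.of_smooth S.isPoisson.1)).sharp (.of_smooth hα)))

theorem famBi_expG {W : ℝ → BiField I M} (hW : FamBi I W) (hI : ∀ t, S.MemI (W t)) :
    FamBi I (fun t => S.expG (W t)) := fun α β hα hβ =>
  (FamBi.of_smooth S.isPoisson.1 α β hα hβ).add
    (hW.pairing (((S.famEnd_idAddGammaSharp hW).inverse hI).apply (.of_smooth hα)) (.of_smooth hβ))

theorem famBi_logG {P : ℝ → BiField I M} (hP : FamBi I P)
    (hI : ∀ t x, IsUnit (S.idSubGammaSharp (P t) x)) :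
    FamBi I (fun t => S.logG (P t)) := fun _ _ hα hβ =>
  (hP.sub (.of_smooth S.isPoisson.1)).pairing
    (((S.famEnd_idSubGammaSharp hP).inverse hI).apply (.of_smooth hα)) (.of_smooth hβ)

theorem isBivectorField_expG {W : BiField I M} (hW : IsBivectorField I W) (hI : S.MemI W) :
    IsBivectorField I (S.expG W) :=
  ⟨S.expG_self hI hW.1, fun α β hα hβ =>
    (S.famBi_expG (FamBi.of_smooth hW) (fun _ => hI) α β hα hβ).slice 0⟩

theorem isPoisson_expG {W : BiField I M} (hW : S.IsMaurerCartan W) (hI : S.MemI W) :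
    IsPoisson (S.expG W) := by
  refine ⟨S.isBivectorField_expG hW.1.1 hI, fun α β δ hα hβ hδ x => ?_⟩
  have hK : ∀ α, SmoothForm I α → SmoothForm I
      (fun x => Ring.inverse (S.idAddGammaSharp W x) (α x)) := fun α hα =>
    (((S.famEnd_idAddGammaSharp (FamBi.of_smooth hW.1.1)).inverse (fun _ => hI)).apply
      (.of_smooth hα)).slice 0
  have h := S.schoutenBB_expG hW.1.1 hI (hK α hα) (hK β hβ) (hK δ hδ) x
  simp only [S.exists_idAddGammaSharp_eq hI] at h
  rw [h, hW.2 _ _ _ (hK α hα) (hK β hβ) (hK δ hδ) x, mul_zero]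

theorem isMaurerCartan_of_isPoisson {W : BiField I M} (hW : S.IsGood W) (hI : S.MemI W)
    (hP : IsPoisson (S.expG W)) : S.IsMaurerCartan W := by
  refine ⟨hW, fun α β δ hα hβ hδ x => ?_⟩
  have h := S.schoutenBB_expG hW.1 hI hα hβ hδ x
  rw [hP.2 _ _ _ (S.smooth_idAddGammaSharp hW.1 hα) (S.smooth_idAddGammaSharp hW.1 hβ)
    (S.smooth_idAddGammaSharp hW.1 hδ) x] at h
  linarith

end SplitRegularPoisson

section Nemytskii

universe u

variable {K : Type*} [TopologicalSpace K] [CompactSpace K]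

/-- Pointwise application of a continuous family of linear maps to a continuous map. -/
def applyCLM (K : Type*) [TopologicalSpace K] [CompactSpace K]
    (E F : Type*) [NormedAddCommGroup E] [NormedSpace ℝ E]
    [NormedAddCommGroup F] [NormedSpace ℝ F] : C(K, E →L[ℝ] F) →L[ℝ] C(K, E) →L[ℝ] C(K, F) :=
  LinearMap.mkContinuous₂ (LinearMap.mk₂ ℝ
    (fun (A : C(K, E →L[ℝ] F)) (u : C(K, E)) => (⟨fun s => A s (u s), by fun_prop⟩ : C(K, F)))
    (fun A B u => by ext; simp) (fun c A u => by ext; simp) (fun A u v => by ext; simp)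
    (fun c A u => by ext; simp)) 1 (fun A u => by
      refine (ContinuousMap.norm_le _ (by positivity)).2 fun s => ?_
      rw [one_mul]
      exact ((A s).le_opNorm (u s)).trans (by
        gcongr
        exacts [A.norm_coe_le_norm s, u.norm_coe_le_norm s]))

variable {E : Type u} [NormedAddCommGroup E] [NormedSpace ℝ E]

theorem hasFDerivAt_postcomp {F : Type u} [NormedAddCommGroup F] [NormedSpace ℝ F]
    (f : C(E, F)) (f' : C(E, E →L[ℝ] F)) (hf : ∀ x, HasFDerivAt f (f' x) x) (u : C(K, E)) :
    HasFDerivAt (fun u : C(K, E) => f.comp u) (applyCLM K E F (f'.comp u)) u := by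
  rw [hasFDerivAt_iff_isLittleO_nhds_zero, Asymptotics.isLittleO_iff]
  intro ε hε
  have hc : Continuous (fun v : C(K, E) => f'.comp v) := ContinuousMap.continuous_postcomp f'
  obtain ⟨δ, hδ, hδu⟩ := (Metric.continuous_iff (α := C(K, E)) (β := C(K, E →L[ℝ] F))).1 hc u ε hε
  filter_upwards [Metric.ball_mem_nhds (0 : C(K, E)) hδ] with h hh
  refine (ContinuousMap.norm_le _ (by positivity)).2 fun s => ?_
  have hbound : ∀ z ∈ segment ℝ (u s) (u s + h s), ‖f' z - f' (u s)‖ ≤ ε := by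
    intro z hz
    rw [segment_eq_image'] at hz
    obtain ⟨r, hr, rfl⟩ := hz
    have h1 : dist (u + r • h) u < δ := by
      rw [dist_eq_norm, add_sub_cancel_left, norm_smul]
      have h2 : ‖h‖ < δ := by simpa using hh
      have h3 : ‖r‖ ≤ 1 := by
        rw [Real.norm_eq_abs, abs_of_nonneg hr.1]; exact hr.2
      calc ‖r‖ * ‖h‖ ≤ 1 * ‖h‖ := by gcongr
        _ < δ := by rwa [one_mul]
    have h4 := (ContinuousMap.dist_apply_le_dist s).trans (hδu _ h1).le
    rw [dist_eq_norm] at h4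
    simpa using h4
  have h5 := (convex_segment (u s) (u s + h s)).norm_image_sub_le_of_norm_hasFDerivWithin_le'
    (f := f) (φ := f' (u s)) (fun z _ => (hf z).hasFDerivWithinAt) hbound
    (left_mem_segment ℝ _ _) (right_mem_segment ℝ _ _)
  rw [add_sub_cancel_left] at h5
  refine h5.trans ?_
  gcongr
  exact h.norm_coe_le_norm s

theorem contDiff_postcomp_nat (n : ℕ) : ∀ {F : Type u} [NormedAddCommGroup F] [NormedSpace ℝ F]
    (f : C(E, F)), ContDiff ℝ n f → ContDiff ℝ n (fun u : C(K, E) => f.comp u) := by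
  induction n with
  | zero =>
    intro F _ _ f _
    simpa [contDiff_zero] using ContinuousMap.continuous_postcomp f
  | succ n ih =>
    intro F _ _ f hf
    have h1 : ContDiff ℝ n (fderiv ℝ f) := hf.fderiv_right (by norm_cast)
    have h2 : Differentiable ℝ f := hf.differentiable (by simp)
    refine contDiff_succ_iff_hasFDerivAt.2 ⟨fun u => applyCLM K E F
      ((⟨fderiv ℝ f, h1.continuous⟩ : C(E, E →L[ℝ] F)).comp u), ?_, ?_⟩
    · exact (applyCLM K E F).contDiff.comp (ih (⟨fderiv ℝ f, h1.continuous⟩ : C(E, E →L[ℝ] F)) h1)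
    · intro u
      exact hasFDerivAt_postcomp f ⟨fderiv ℝ f, h1.continuous⟩ (fun x => (h2 x).hasFDerivAt) u

theorem contDiff_postcomp {F : Type u} [NormedAddCommGroup F] [NormedSpace ℝ F]
    (f : C(E, F)) (hf : ContDiff ℝ ∞ f) : ContDiff ℝ ∞ (fun u : C(K, E) => f.comp u) :=
  contDiff_infty.2 fun n => contDiff_postcomp_nat n f (hf.of_le (by exact_mod_cast le_top))

end Nemytskii

section LocalFlow

universe u
variable {E : Type u} [NormedAddCommGroup E] [NormedSpace ℝ E] [CompleteSpace E]

/-- Primitives vanishing at `0` of continuous maps on `[-1, 1]`. -/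
def primitiveCLM (E : Type*) [NormedAddCommGroup E] [NormedSpace ℝ E] [CompleteSpace E] :
    C(Icc (-1 : ℝ) 1, E) →L[ℝ] C(Icc (-1 : ℝ) 1, E) :=
  LinearMap.mkContinuous
    { toFun := fun u => ⟨fun s => ∫ r in (0 : ℝ)..s, IccExtend (by norm_num : (-1 : ℝ) ≤ 1) u r,
        (intervalIntegral.continuous_primitive (fun a b =>
          (u.continuous.Icc_extend' (h := by norm_num)).intervalIntegrable a b) 0).comp
          continuous_subtype_val⟩
      map_add' := fun u v => by
        ext s
        exact intervalIntegral.integral_add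
          ((u.continuous.Icc_extend' (h := by norm_num)).intervalIntegrable _ _)
          ((v.continuous.Icc_extend' (h := by norm_num)).intervalIntegrable _ _)
      map_smul' := fun c u => by
        ext s
        exact intervalIntegral.integral_smul c _ }
    1 (fun u => by
      refine (ContinuousMap.norm_le _ (by positivity)).2 fun s => ?_
      have h := intervalIntegral.norm_integral_le_of_norm_le_const (a := (0 : ℝ)) (b := s)
        (f := IccExtend (by norm_num : (-1 : ℝ) ≤ 1) u) (C := ‖u‖)
        (fun r _ => u.norm_coe_le_norm _)
      refine h.trans ?_
      rw [one_mul, sub_zero]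
      exact mul_le_of_le_one_right (norm_nonneg _) (abs_le.2 s.2))

theorem primitiveCLM_apply (u : C(Icc (-1 : ℝ) 1, E)) (s : Icc (-1 : ℝ) 1) :
    primitiveCLM E u s = ∫ r in (0 : ℝ)..s, IccExtend (by norm_num : (-1 : ℝ) ≤ 1) u r := rfl

/-- The shear `(τ, h) ↦ (τ, h - τ k)`. -/
def shearCLE {C : Type*} [NormedAddCommGroup C] [NormedSpace ℝ C] (k : C) :
    (ℝ × C) ≃L[ℝ] (ℝ × C) :=
  ContinuousLinearEquiv.equivOfInverse
    ((ContinuousLinearMap.fst ℝ ℝ C).prod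
      (ContinuousLinearMap.snd ℝ ℝ C - (ContinuousLinearMap.fst ℝ ℝ C).smulRight k))
    ((ContinuousLinearMap.fst ℝ ℝ C).prod
      (ContinuousLinearMap.snd ℝ ℝ C + (ContinuousLinearMap.fst ℝ ℝ C).smulRight k))
    (fun p => by ext <;> simp) (fun p => by ext <;> simp)

/-- Solutions on `[-1, 1]` of the integral equations `u(s) = x + τ ∫₀ˢ f(u)`, depending smoothly
on `(τ, x)`. -/
theorem exists_smooth_integralSolution {f : E → E} (hf : ContDiff ℝ ∞ f) (x₀ : E) :
    ∃ g : ℝ × E → C(Icc (-1 : ℝ) 1, E), ContDiffAt ℝ ∞ g (0, x₀) ∧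
      ∃ ε > 0, ∀ᶠ x in 𝓝 x₀, ∀ τ ∈ Ioo (-ε) ε,
        (∀ s, g (τ, x) s = x + τ • ∫ r in (0 : ℝ)..s,
          f (IccExtend (by norm_num : (-1 : ℝ) ≤ 1) (g (τ, x)) r)) ∧
        ∀ σ (hσ : σ ∈ Icc (-1 : ℝ) 1), g (σ * τ, x) ⟨1, by norm_num⟩ = g (τ, x) ⟨σ, hσ⟩ := by
  let C := C(Icc (-1 : ℝ) 1, E)
  let fc : C(E, E) := ⟨f, hf.continuous⟩
  let G : ℝ × C → ℝ × C := fun p => (p.1, p.2 - p.1 • primitiveCLM E (fc.comp p.2))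
  have hN : ContDiff ℝ ∞ (fun u : C => primitiveCLM E (fc.comp u)) :=
    (primitiveCLM E).contDiff.comp (contDiff_postcomp fc hf)
  have hG : ContDiff ℝ ∞ G :=
    contDiff_fst.prodMk (contDiff_snd.sub (contDiff_fst.smul (hN.comp contDiff_snd)))
  let c₀ : C := ContinuousMap.const _ x₀
  let p₀ : ℝ × C := (0, c₀)
  have hGd : HasFDerivAt G
      (shearCLE (primitiveCLM E (fc.comp c₀)) : (ℝ × C) →L[ℝ] (ℝ × C)) p₀ := by
    have h1 : HasFDerivAt (fun u : C => primitiveCLM E (fc.comp u))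
        (fderiv ℝ (fun u : C => primitiveCLM E (fc.comp u)) c₀) c₀ :=
      ((hN.differentiable (by simp)) c₀).hasFDerivAt
    have h2 : HasFDerivAt (fun p : ℝ × C => primitiveCLM E (fc.comp p.2)) _ p₀ :=
      HasFDerivAt.comp (g := fun u : C => primitiveCLM E (fc.comp u)) p₀ h1 hasFDerivAt_snd
    have h3 := (hasFDerivAt_fst (𝕜 := ℝ) (p := p₀)).prodMk
      ((hasFDerivAt_snd (𝕜 := ℝ) (p := p₀)).sub
        ((hasFDerivAt_fst (𝕜 := ℝ) (p := p₀)).smul h2))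
    refine h3.congr_fderiv ?_
    ext p <;> (simp [shearCLE, p₀]; try rfl)
  let e := hG.contDiffAt.toOpenPartialHomeomorph G hGd (by simp)
  have he : ∀ p, e p = G p := fun p => rfl
  have hG0 : G p₀ = p₀ := by simp [G, p₀]
  have hsm : ContDiffAt ℝ ∞ e.symm p₀ := by
    have h := hG.contDiffAt.to_localInverse hGd (by simp)
    rw [hG0] at h
    exact h
  have hsrc : p₀ ∈ e.source := hG.contDiffAt.mem_toOpenPartialHomeomorph_source hGd (by simp)
  have htgt : p₀ ∈ e.target := by
    have h := e.map_source hsrc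
    rwa [he, hG0] at h
  have hs0 : e.symm p₀ = p₀ := by
    have h := e.left_inv hsrc
    rwa [he, hG0] at h
  have hκ : ContDiff ℝ ∞ (fun q : ℝ × E => ((q.1, ContinuousMap.const _ q.2) : ℝ × C)) := by
    have h : ContDiff ℝ ∞ (fun x : E => (ContinuousMap.const _ x : C)) :=
      (ContinuousLinearMap.const ℝ (Icc (-1 : ℝ) 1) (M := E)).contDiff
    exact contDiff_fst.prodMk (h.comp contDiff_snd)
  let g : ℝ × E → C := fun q => (e.symm (q.1, ContinuousMap.const _ q.2)).2
  have hg : ContDiffAt ℝ ∞ g (0, x₀) :=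
    contDiff_snd.contDiffAt.comp _ (ContDiffAt.comp (0, x₀) (g := e.symm) hsm hκ.contDiffAt)
  have hg0 : g (0, x₀) = c₀ := by
    change (e.symm p₀).2 = c₀
    rw [hs0]
  refine ⟨g, hg, ?_⟩
  obtain ⟨δ, hδ, hδs⟩ := Metric.mem_nhds_iff.1 (e.open_source.mem_nhds hsrc)
  have h1 : ∀ᶠ q in 𝓝 ((0 : ℝ), x₀), ((q.1, ContinuousMap.const _ q.2) : ℝ × C) ∈ e.target :=
    hκ.continuous.continuousAt.eventually (e.open_target.mem_nhds htgt)
  have h2 : ∀ᶠ q in 𝓝 ((0 : ℝ), x₀), dist (g q) c₀ < δ := by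
    have h := hg.continuousAt.eventually (Metric.ball_mem_nhds (g (0, x₀)) hδ)
    rw [hg0] at h
    exact h
  obtain ⟨ε, hε, V, hV, hVε⟩ : ∃ ε > 0, ∃ V ∈ 𝓝 x₀, ∀ τ ∈ Ioo (-ε) ε, ∀ x ∈ V,
      ((τ, ContinuousMap.const _ x) : ℝ × C) ∈ e.target ∧ dist (g (τ, x)) c₀ < δ := by
    obtain ⟨A, hA, V, hV, hAV⟩ := mem_nhds_prod_iff.1 (h1.and h2)
    obtain ⟨ε, hε, hεA⟩ := Metric.mem_nhds_iff.1 hA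
    refine ⟨ε, hε, V, hV, fun τ hτ x hx => hAV (mk_mem_prod (hεA ?_) hx)⟩
    rw [Real.ball_eq_Ioo]
    simpa using hτ
  refine ⟨min ε δ, lt_min hε hδ, ?_⟩
  filter_upwards [hV] with x hx τ hτ
  have hτε : τ ∈ Ioo (-ε) ε := ⟨by linarith [hτ.1, min_le_left ε δ], by
    linarith [hτ.2, min_le_left ε δ]⟩
  have hτδ : |τ| < δ := abs_lt.2 ⟨by linarith [hτ.1, min_le_right ε δ], by
    linarith [hτ.2, min_le_right ε δ]⟩
  obtain ⟨ht, hd⟩ := hVε τ hτε x hx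
  have hfst : (e.symm (τ, ContinuousMap.const _ x)).1 = τ := by
    have h := congrArg Prod.fst (e.right_inv ht)
    exact h
  have hsnd : ∀ s : Icc (-1 : ℝ) 1, g (τ, x) s = x + τ • ∫ r in (0 : ℝ)..s,
      f (IccExtend (by norm_num : (-1 : ℝ) ≤ 1) (g (τ, x)) r) := by
    intro s
    have h := congrArg Prod.snd (e.right_inv ht)
    have h' : (e.symm (τ, ContinuousMap.const _ x)).2 - (e.symm (τ, ContinuousMap.const _ x)).1 •
        primitiveCLM E (fc.comp (e.symm (τ, ContinuousMap.const _ x)).2)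
        = ContinuousMap.const _ x := h
    rw [hfst] at h'
    have h3 := DFunLike.congr_fun h' s
    have h4 : g (τ, x) s - τ • primitiveCLM E (fc.comp (g (τ, x))) s = x := h3
    rw [sub_eq_iff_eq_add] at h4
    exact h4
  refine ⟨hsnd, fun σ hσ => ?_⟩
  let u := g (τ, x)
  have hmem : ∀ s : Icc (-1 : ℝ) 1, σ * (s : ℝ) ∈ Icc (-1 : ℝ) 1 := fun s => abs_le.1 (by
    rw [abs_mul]
    exact mul_le_one₀ (abs_le.2 hσ) (abs_nonneg _) (abs_le.2 s.2))
  let v : C := ⟨fun s => u ⟨σ * s, hmem s⟩, by fun_prop⟩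
  have hv : ∀ s : Icc (-1 : ℝ) 1, v s = u ⟨σ * s, hmem s⟩ := fun s => rfl
  have hsv : ((σ * τ, v) : ℝ × C) ∈ e.source := by
    refine hδs ?_
    rw [Metric.mem_ball, Prod.dist_eq, max_lt_iff]
    constructor
    · rw [Real.dist_eq]
      change |σ * τ - 0| < δ
      rw [sub_zero, abs_mul]
      exact (mul_le_of_le_one_left (abs_nonneg _) (abs_le.2 hσ)).trans_lt hτδ
    · refine lt_of_le_of_lt ?_ hd
      exact (ContinuousMap.dist_le dist_nonneg).2 fun s =>
        ContinuousMap.dist_apply_le_dist (f := u) (g := c₀) _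
  have hGv : G (σ * τ, v) = (σ * τ, ContinuousMap.const _ x) := by
    refine Prod.ext rfl ?_
    ext s
    have h3 : v s = x + τ • ∫ r in (0 : ℝ)..(σ * s), f (IccExtend (by norm_num : (-1 : ℝ) ≤ 1) u r) :=
      hsnd ⟨σ * s, hmem s⟩
    have h4 : primitiveCLM E (fc.comp v) s
        = ∫ r in (0 : ℝ)..s, f (IccExtend (by norm_num : (-1 : ℝ) ≤ 1) u (σ * r)) := by
      rw [primitiveCLM_apply]
      refine intervalIntegral.integral_congr fun r hr => ?_
      have hr' : r ∈ Icc (-1 : ℝ) 1 :=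
        (uIcc_subset_Icc (by norm_num : (0 : ℝ) ∈ Icc (-1 : ℝ) 1) s.2) hr
      have h5 := hmem ⟨r, hr'⟩
      simp only [IccExtend_of_mem _ _ hr', IccExtend_of_mem _ _ h5]
      rfl
    have h6 : σ • primitiveCLM E (fc.comp v) s
        = ∫ r in (0 : ℝ)..(σ * s), f (IccExtend (by norm_num : (-1 : ℝ) ≤ 1) u r) := by
      rw [h4, intervalIntegral.smul_integral_comp_mul_left
        (fun r => f (IccExtend (by norm_num : (-1 : ℝ) ≤ 1) u r)) σ, mul_zero]
    change v s - (σ * τ) • primitiveCLM E (fc.comp v) s = x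
    rw [mul_comm, mul_smul, h6, h3, add_sub_cancel_right]
  have h7 : e.symm (σ * τ, ContinuousMap.const _ x) = (σ * τ, v) := by
    rw [← hGv]
    exact e.left_inv hsv
  change (e.symm (σ * τ, ContinuousMap.const _ x)).2 _ = _
  rw [h7]
  change u _ = u _
  congr 2
  simp

/-- Smooth local flows of smooth vector fields. -/
theorem exists_localFlow {f : E → E} (hf : ContDiff ℝ ∞ f) (x₀ : E) :
    ∃ Φ : ℝ × E → E, ContDiffAt ℝ ∞ Φ (0, x₀) ∧ ∃ ε > 0, ∀ᶠ x in 𝓝 x₀, Φ (0, x) = x ∧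
      ∀ t ∈ Ioo (-ε) ε, HasDerivAt (fun s => Φ (s, x)) (f (Φ (t, x))) t := by
  obtain ⟨g, hg, ε, hε, H⟩ := exists_smooth_integralSolution hf x₀
  have hev : ContDiff ℝ ∞ (fun u : C(Icc (-1 : ℝ) 1, E) => u ⟨1, by norm_num⟩) :=
    (ContinuousMap.evalCLM ℝ (M := E) (⟨1, by norm_num⟩ : Icc (-1 : ℝ) 1)).contDiff
  refine ⟨fun q => g q ⟨1, by norm_num⟩,
    ContDiffAt.comp (g := fun u : C(Icc (-1 : ℝ) 1, E) => u ⟨1, by norm_num⟩) _ hev.contDiffAt hg,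
    ε, hε, ?_⟩
  filter_upwards [H] with x hx
  constructor
  · have h := (hx 0 ⟨by linarith, hε⟩).1 ⟨1, by norm_num⟩
    simpa using h
  intro t ht
  have ht' : |t| < ε := abs_lt.2 ht
  set τ := (|t| + ε) / 2 with hτ
  have hτ0 : 0 < τ := by positivity
  have hτε : τ < ε := by linarith
  have htτ : |t| < τ := by linarith
  obtain ⟨h1, h2⟩ := hx τ ⟨by linarith, hτε⟩
  set u := IccExtend (by norm_num : (-1 : ℝ) ≤ 1) (g (τ, x)) with hu
  have hcu : Continuous u := (g (τ, x)).continuous.Icc_extend'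
  have key : ∀ t' : ℝ, |t'| < τ → g (t', x) ⟨1, by norm_num⟩ = u (t' / τ) ∧
      g (t', x) ⟨1, by norm_num⟩ = x + τ • ∫ r in (0 : ℝ)..(t' / τ), f (u r) := by
    intro t' h
    have h3 : t' / τ ∈ Icc (-1 : ℝ) 1 := abs_le.1 (by
      rw [abs_div, abs_of_pos hτ0, div_le_one hτ0]
      exact h.le)
    have h4 := h2 _ h3
    rw [div_mul_cancel₀ _ hτ0.ne'] at h4
    refine ⟨by rw [h4, hu, IccExtend_of_mem _ _ h3], by rw [h4, h1]⟩
  have hd : HasDerivAt (fun t' : ℝ => x + τ • ∫ r in (0 : ℝ)..(t' / τ), f (u r))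
      (τ • (τ⁻¹ • f (u (t / τ)))) t := by
    have h3 : HasDerivAt (fun y : ℝ => ∫ r in (0 : ℝ)..y, f (u r)) (f (u (t / τ))) (t / τ) :=
      intervalIntegral.integral_hasDerivAt_right
        ((hf.continuous.comp hcu).intervalIntegrable _ _)
        ((hf.continuous.comp hcu).stronglyMeasurableAtFilter _ _)
        (hf.continuous.comp hcu).continuousAt
    have h4 : HasDerivAt (fun t' : ℝ => t' / τ) τ⁻¹ t := by
      simpa using (hasDerivAt_id t).div_const τ
    exact ((h3.scomp t h4).const_smul τ).const_add x
  rw [smul_inv_smul₀ hτ0.ne', ← (key t htτ).1] at hd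
  refine hd.congr_of_eventuallyEq ?_
  have h5 : ∀ᶠ t' in 𝓝 t, |t'| < τ := continuous_abs.continuousAt.eventually (gt_mem_nhds htτ)
  filter_upwards [h5] with t' ht'
  exact (key t' ht').2

end LocalFlow

section ManifoldFlow

variable {E : Type*} [NormedAddCommGroup E] [NormedSpace ℝ E] [FiniteDimensional ℝ E]
  {H : Type*} [TopologicalSpace H] {I : ModelWithCorners ℝ E H}
  {M : Type*} [TopologicalSpace M] [ChartedSpace H M] [IsManifold I ∞ M]

theorem contMDiffOn_mfderiv_section {F : Type*} [NormedAddCommGroup F] [NormedSpace ℝ F]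
    {f : M → F} {U : Set M} (hU : IsOpen U) (hf : ContMDiffOn I 𝓘(ℝ, F) ∞ f U)
    {Z : VecField I M} (hZ : SmoothVec I Z) :
    ContMDiffOn I 𝓘(ℝ, F) ∞ (fun p => (mfderiv I 𝓘(ℝ, F) f p (Z p) : F)) U := by
  have h1 := hf.contMDiffOn_tangentMapWithin (m := ∞) (by simp) hU.uniqueMDiffOn
  have h2 : ContMDiffOn I 𝓘(ℝ, F) ∞ (fun p => (tangentMapWithin I 𝓘(ℝ, F) f U ⟨p, Z p⟩).2) U :=
    ((contMDiff_snd_tangentBundle_modelSpace F 𝓘(ℝ, F) (n := ∞)).comp_contMDiffOn h1).comp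
      hZ.contMDiffOn (fun p hp => hp)
  refine h2.congr fun p hp => ?_
  change _ = mfderivWithin I 𝓘(ℝ, F) f U p (Z p)
  rw [mfderivWithin_of_isOpen hU hp]

variable [I.Boundaryless]

theorem isMIntegralCurveAt_extChartAt_symm {Z : VecField I M} {p₀ : M} {u : ℝ → E} {t : ℝ}
    (ht : u t ∈ (extChartAt I p₀).target)
    (hu : HasDerivAt u (mfderiv I 𝓘(ℝ, E) (extChartAt I p₀) ((extChartAt I p₀).symm (u t))
      (Z ((extChartAt I p₀).symm (u t)))) t) :
    HasMFDerivAt 𝓘(ℝ, ℝ) I (fun s => (extChartAt I p₀).symm (u s)) t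
      ((1 : ℝ →L[ℝ] ℝ).smulRight (Z ((extChartAt I p₀).symm (u t)))) := by
  have h1 := (mdifferentiableWithinAt_extChartAt_symm (I := I) ht).hasMFDerivWithinAt
  rw [I.range_eq_univ, hasMFDerivWithinAt_univ] at h1
  have h2 := h1.comp t hu.hasFDerivAt.hasMFDerivAt
  refine h2.congr_mfderiv ?_
  have h3 := mfderivWithin_extChartAt_symm_comp_mfderiv_extChartAt (I := I) ht
  rw [I.range_eq_univ] at h3
  refine ContinuousLinearMap.ext_ring ?_
  have h4 := DFunLike.congr_fun h3 (Z ((extChartAt I p₀).symm (u t)))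
  change mfderivWithin 𝓘(ℝ, E) I (extChartAt I p₀).symm univ (u t)
    ((1 : ℝ) • (mfderiv I 𝓘(ℝ, E) (extChartAt I p₀) ((extChartAt I p₀).symm (u t))
      (Z ((extChartAt I p₀).symm (u t))))) = (1 : ℝ) • Z ((extChartAt I p₀).symm (u t))
  rw [one_smul, one_smul]
  exact h4

theorem exists_localFlow_manifold [T2Space M] {Z : VecField I M} (hZ : SmoothVec I Z) (p₀ : M) :
    ∃ Ψ : ℝ × M → M, ContMDiffAt (𝓘(ℝ, ℝ).prod I) I ∞ Ψ (0, p₀) ∧ ∃ ε > 0, ∀ᶠ p in 𝓝 p₀,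
      Ψ (0, p) = p ∧ IsMIntegralCurveOn (fun t => Ψ (t, p)) Z (Ioo (-ε) ε) := by
  set φ := extChartAt I p₀ with hφ
  let f₀ : E → E := fun y => mfderiv I 𝓘(ℝ, E) φ (φ.symm y) (Z (φ.symm y))
  have ht : IsOpen φ.target := isOpen_extChartAt_target p₀
  have hf₀ : ContMDiffOn 𝓘(ℝ, E) 𝓘(ℝ, E) ∞ f₀ φ.target := by
    have h := contMDiffOn_mfderiv_section (isOpen_extChartAt_source (I := I) p₀)
      (fun x hx => (contMDiffAt_extChartAt' (n := ∞)
        (by rwa [extChartAt_source] at hx)).contMDiffWithinAt) hZ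
    exact h.comp (contMDiffOn_extChartAt_symm p₀) φ.symm.mapsTo
  obtain ⟨f, hf, hff⟩ := exists_contMDiff_eventuallyEq ht (mem_extChartAt_target p₀) hf₀
  obtain ⟨Φ, hΦ, ε, hε, hΦε⟩ := exists_localFlow hf.contDiff (φ p₀)
  have hΦ0 : Φ (0, φ p₀) = φ p₀ := hΦε.self_of_nhds.1
  refine ⟨fun q => φ.symm (Φ (q.1, φ q.2)), ?_, ?_⟩
  · have h1 : ContMDiffAt (𝓘(ℝ, ℝ).prod I) 𝓘(ℝ, ℝ × E) ∞ (fun q : ℝ × M => (q.1, φ q.2)) (0, p₀) :=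
      contMDiffAt_fst.prodMk_space ((contMDiffAt_extChartAt (n := ∞)).comp (0, p₀) contMDiffAt_snd)
    have h2 : ContMDiffAt (𝓘(ℝ, ℝ).prod I) 𝓘(ℝ, E) ∞ (fun q : ℝ × M => Φ (q.1, φ q.2)) (0, p₀) :=
      ContMDiffAt.comp (g := Φ) (0, p₀) hΦ.contMDiffAt h1
    have h3 : ContMDiffAt 𝓘(ℝ, E) I ∞ φ.symm (Φ (0, φ p₀)) := by
      rw [hΦ0]
      exact (contMDiffOn_extChartAt_symm p₀).contMDiffAt (ht.mem_nhds (mem_extChartAt_target p₀))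
    exact ContMDiffAt.comp (g := φ.symm) (0, p₀) h3 h2
  · have h1 : ∀ᶠ y in 𝓝 (φ p₀), f y = f₀ y ∧ y ∈ φ.target :=
      hff.and (ht.mem_nhds (mem_extChartAt_target p₀))
    have h2 : ∀ᶠ q in 𝓝 ((0 : ℝ), φ p₀), f (Φ q) = f₀ (Φ q) ∧ Φ q ∈ φ.target := by
      have h := hΦ.continuousAt
      rw [ContinuousAt, hΦ0] at h
      exact h.eventually h1
    obtain ⟨A, hA, V, hV, hAV⟩ := mem_nhds_prod_iff.1 h2
    obtain ⟨δ, hδ, hδA⟩ := Metric.mem_nhds_iff.1 hA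
    refine ⟨min ε δ, lt_min hε hδ, ?_⟩
    filter_upwards [(continuousAt_extChartAt (I := I) p₀).eventually hV,
      (continuousAt_extChartAt (I := I) p₀).eventually hΦε,
      extChartAt_source_mem_nhds (I := I) p₀] with p hpV hp hps
    refine ⟨by rw [hp.1]; exact φ.left_inv hps, fun t ht => ?_⟩
    have htε : t ∈ Ioo (-ε) ε := ⟨by linarith [ht.1, min_le_left ε δ], by
      linarith [ht.2, min_le_left ε δ]⟩
    have htδ : t ∈ A := hδA (by
      rw [Real.ball_eq_Ioo]
      constructor <;> linarith [ht.1, ht.2, min_le_right ε δ])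
    have h3 : f (Φ (t, φ p)) = f₀ (Φ (t, φ p)) ∧ Φ (t, φ p) ∈ φ.target :=
      hAV (mk_mem_prod htδ hpV)
    have h4 := hp.2 t htε
    rw [h3.1] at h4
    exact (isMIntegralCurveAt_extChartAt_symm (u := fun s => Φ (s, φ p)) h3.2 h4).hasMFDerivWithinAt

theorem flow_add [T2Space M] {Z : VecField I M} (hZ : SmoothVec I Z) {Φ : ℝ × M → M}
    (h0 : ∀ p, Φ (0, p) = p) (hΦ : ∀ p, IsMIntegralCurve (fun t => Φ (t, p)) Z) (s t : ℝ) (p : M) :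
    Φ (s + t, p) = Φ (s, Φ (t, p)) := by
  have h1 : IsMIntegralCurve (fun s => Φ (s + t, p)) Z := (hΦ p).comp_add t
  have h2 := isMIntegralCurve_Ioo_eq_of_contMDiff_boundaryless (t₀ := 0)
    (hZ.of_le (by exact_mod_cast le_top)) h1 (hΦ (Φ (t, p))) (by simp [h0])
  exact congrFun h2 s

theorem contMDiff_flow [T2Space M] {Z : VecField I M} (hZ : SmoothVec I Z) {Φ : ℝ × M → M}
    (h0 : ∀ p, Φ (0, p) = p) (hΦ : ∀ p, IsMIntegralCurve (fun t => Φ (t, p)) Z) :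
    ContMDiff (𝓘(ℝ, ℝ).prod I) I ∞ Φ := by
  refine contMDiff_infty.2 fun n => ?_
  have hloc : ∀ p₀ : M, ∀ᶠ q in 𝓝 ((0 : ℝ), p₀), ContMDiffAt (𝓘(ℝ, ℝ).prod I) I n Φ q := by
    intro p₀
    obtain ⟨Ψ, hΨ, ε, hε, hΨε⟩ := exists_localFlow_manifold hZ p₀
    have h1 : Φ =ᶠ[𝓝 ((0 : ℝ), p₀)] Ψ := by
      rw [nhds_prod_eq]
      have h2 : ∀ᶠ t in 𝓝 (0 : ℝ), t ∈ Ioo (-ε) ε := Ioo_mem_nhds (by linarith) hε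
      filter_upwards [h2.prod_mk hΨε] with q hq
      have h3 := isMIntegralCurveOn_Ioo_eqOn_of_contMDiff_boundaryless (t₀ := 0)
        ⟨by linarith, hε⟩ (hZ.of_le (by exact_mod_cast le_top))
        ((hΦ q.2).isMIntegralCurveOn _) hq.2.2 (by rw [h0, hq.2.1])
      exact h3 hq.1
    have h2 : ContMDiffAt (𝓘(ℝ, ℝ).prod I) I n Φ (0, p₀) :=
      (hΨ.of_le (by exact_mod_cast le_top)).congr_of_eventuallyEq h1
    exact (contMDiffAt_iff_contMDiffAt_nhds (by simp)).1 h2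
  rintro ⟨t₁, p⟩
  let A : Set ℝ := {t | ContMDiffAt (𝓘(ℝ, ℝ).prod I) I n Φ (t, p)}
  have key : ∀ t, ∃ δ > 0, ∀ s ∈ Metric.ball t δ, ∀ s' ∈ Metric.ball t δ, s ∈ A → s' ∈ A := by
    intro t
    obtain ⟨B, hB, V, hV, hBV⟩ := mem_nhds_prod_iff.1 (hloc (Φ (t, p)))
    obtain ⟨ε, hε, hεB⟩ := Metric.mem_nhds_iff.1 hB
    obtain ⟨δ, hδ, hδV⟩ := Metric.mem_nhds_iff.1
      ((hΦ p).continuous.continuousAt.preimage_mem_nhds hV)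
    refine ⟨min δ (ε / 2), by positivity, fun s hs s' hs' hsA => ?_⟩
    have hs1 : Φ (s, p) ∈ V := hδV (Metric.ball_subset_ball (min_le_left _ _) hs)
    have hs2 : s' - s ∈ B := hεB (by
      rw [mem_ball_zero_iff, ← dist_eq_norm]
      rw [Metric.mem_ball] at hs hs'
      have := dist_triangle_right s' s t
      linarith [min_le_right δ (ε / 2)])
    have h1 : ContMDiffAt (𝓘(ℝ, ℝ).prod I) I n Φ (s' - s, Φ (s, p)) := hBV (mk_mem_prod hs2 hs1)
    have h2 : ContMDiffAt (𝓘(ℝ, ℝ).prod I) I n (fun q : ℝ × M => Φ (s, q.2)) (s', p) :=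
      ContMDiffAt.comp (g := Φ) (f := fun q : ℝ × M => (s, q.2)) (s', p) hsA
        (contMDiffAt_const.prodMk contMDiffAt_snd)
    have h3 : ContMDiffAt (𝓘(ℝ, ℝ).prod I) 𝓘(ℝ, ℝ) n (fun q : ℝ × M => q.1 - s) (s', p) :=
      contMDiffAt_fst.sub contMDiffAt_const
    have h4 := ContMDiffAt.comp (g := Φ) (f := fun q : ℝ × M => (q.1 - s, Φ (s, q.2))) (s', p) h1
      (h3.prodMk h2)
    refine h4.congr_of_eventuallyEq (Eventually.of_forall fun q => ?_)
    have h5 := flow_add hZ h0 hΦ (q.1 - s) s q.2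
    rwa [sub_add_cancel] at h5
  have hclopen : IsClopen A := by
    constructor
    · rw [← isOpen_compl_iff, Metric.isOpen_iff]
      intro t ht
      obtain ⟨δ, hδ, h⟩ := key t
      exact ⟨δ, hδ, fun s hs hsA => ht (h s hs t (Metric.mem_ball_self hδ) hsA)⟩
    · rw [Metric.isOpen_iff]
      intro t ht
      obtain ⟨δ, hδ, h⟩ := key t
      exact ⟨δ, hδ, fun s hs => h t (Metric.mem_ball_self hδ) s hs ht⟩
  have hA : A = univ := hclopen.eq_univ ⟨0, (hloc p).self_of_nhds⟩
  exact (hA ▸ mem_univ t₁ : t₁ ∈ A)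

end ManifoldFlow

section TimeDependentFlow

variable {E : Type*} [NormedAddCommGroup E] [NormedSpace ℝ E] [FiniteDimensional ℝ E]
  {H : Type*} [TopologicalSpace H] {I : ModelWithCorners ℝ E H}
  {M : Type*} [TopologicalSpace M] [ChartedSpace H M] [IsManifold I ∞ M]

/-- The vector field `∂_t + Y_t` on `ℝ × M`. -/
def suspension (Y : ℝ → VecField I M) : VecField (𝓘(ℝ, ℝ).prod I) (ℝ × M) :=
  fun p => ((1 : ℝ), Y p.1 p.2)

theorem smooth_suspension [T2Space M] {Y : ℝ → VecField I M} (hY : FamVec I Y) :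
    SmoothVec (𝓘(ℝ, ℝ).prod I) (suspension Y) := by
  have h1 : ContMDiff 𝓘(ℝ, ℝ) 𝓘(ℝ, ℝ).tangent ∞
      (fun t => (⟨t, (1 : ℝ)⟩ : TangentBundle 𝓘(ℝ, ℝ) ℝ)) :=
    contMDiff_vectorSpace_iff_contDiff.2 contDiff_const
  have h2 := (h1.comp (contMDiff_fst (I := 𝓘(ℝ, ℝ)) (J := I) (M := ℝ) (N := M))).prodMk hY.contMDiff
  exact contMDiff_equivTangentBundleProd_symm.comp h2

variable [I.Boundaryless] [CompactSpace M] [T2Space M]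

theorem exists_isMIntegralCurve_suspension {Y : ℝ → VecField I M} (hY : FamVec I Y)
    (hY0 : ∀ t ∉ Icc (0 : ℝ) 1, Y t = 0) (p : ℝ × M) :
    ∃ γ : ℝ → ℝ × M, γ 0 = p ∧ IsMIntegralCurve (I := 𝓘(ℝ, ℝ).prod I) γ (suspension Y) := by
  have hZ := smooth_suspension hY
  obtain ⟨ε, hε, h⟩ : ∃ ε > 0, ∀ p ∈ Icc (-1 : ℝ) 2 ×ˢ (univ : Set M), ∃ γ : ℝ → ℝ × M, γ 0 = p ∧
      IsMIntegralCurveOn (I := 𝓘(ℝ, ℝ).prod I) γ (suspension Y) (Ioo (-ε) ε) := by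
    have hK : IsCompact (Icc (-1 : ℝ) 2 ×ˢ (univ : Set M)) := isCompact_Icc.prod isCompact_univ
    refine hK.induction_on (p := fun s => ∃ ε > 0, ∀ p ∈ s, ∃ γ : ℝ → ℝ × M, γ 0 = p ∧
      IsMIntegralCurveOn (I := 𝓘(ℝ, ℝ).prod I) γ (suspension Y) (Ioo (-ε) ε))
      ⟨1, one_pos, by simp⟩ ?_ ?_ ?_
    · rintro s t hst ⟨ε, hε, h⟩
      exact ⟨ε, hε, fun p hp => h p (hst hp)⟩
    · rintro s t ⟨ε, hε, h⟩ ⟨δ, hδ, h'⟩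
      refine ⟨min ε δ, lt_min hε hδ, ?_⟩
      rintro p (hp | hp)
      · obtain ⟨γ, h0, hγ⟩ := h p hp
        exact ⟨γ, h0, hγ.mono (Ioo_subset_Ioo (neg_le_neg (min_le_left _ _)) (min_le_left _ _))⟩
      · obtain ⟨γ, h0, hγ⟩ := h' p hp
        exact ⟨γ, h0, hγ.mono (Ioo_subset_Ioo (neg_le_neg (min_le_right _ _)) (min_le_right _ _))⟩
    · intro p _
      obtain ⟨Ψ, -, ε, hε, hΨ⟩ := exists_localFlow_manifold hZ p
      refine ⟨_, mem_nhdsWithin_of_mem_nhds hΨ, ε, hε, fun q hq => ⟨_, hq.1, hq.2⟩⟩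
  refine exists_isMIntegralCurve_of_isMIntegralCurveOn (hZ.of_le (by exact_mod_cast le_top))
    (lt_min hε one_pos) ?_ p
  rintro ⟨t, x⟩
  by_cases ht : t ∈ Icc (-1 : ℝ) 2
  · obtain ⟨γ, h0, hγ⟩ := h (t, x) ⟨ht, mem_univ _⟩
    exact ⟨γ, h0, hγ.mono (Ioo_subset_Ioo (neg_le_neg (min_le_left _ _)) (min_le_left _ _))⟩
  · refine ⟨fun s => (t + s, x), by simp, fun s hs => ?_⟩
    have hs' : s ∈ Ioo (-1 : ℝ) 1 := by
      constructor <;> linarith [hs.1, hs.2, min_le_right ε (1 : ℝ)]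
    have h1 : Y (t + s) = 0 := hY0 _ fun h => ht ⟨by linarith [h.1, hs'.2], by linarith [h.2, hs'.1]⟩
    have h2 : HasMFDerivAt 𝓘(ℝ, ℝ) 𝓘(ℝ, ℝ) (fun s : ℝ => t + s) s
        ((1 : ℝ →L[ℝ] ℝ).smulRight (1 : ℝ)) :=
      ((hasDerivAt_id s).const_add t).hasFDerivAt.hasMFDerivAt
    have h3 := h2.prodMk (hasMFDerivAt_const (I := 𝓘(ℝ, ℝ)) (I' := I) x s)
    refine (h3.congr_mfderiv ?_).hasMFDerivWithinAt
    refine ContinuousLinearMap.ext_ring ?_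
    change ((1 : ℝ) • (1 : ℝ), (0 : TangentSpace I x)) = (1 : ℝ) • ((1 : ℝ), Y (t + s) x)
    rw [h1, one_smul, one_smul]
    rfl

theorem hasMFDerivAt_fst_comp {Y : ℝ → VecField I M} {γ : ℝ → ℝ × M} {t : ℝ}
    (h : HasMFDerivAt 𝓘(ℝ, ℝ) (𝓘(ℝ, ℝ).prod I) γ t
      ((1 : ℝ →L[ℝ] ℝ).smulRight (suspension Y (γ t)))) :
    HasDerivAt (fun s => (γ s).1) 1 t ∧ HasMFDerivAt 𝓘(ℝ, ℝ) I (fun s => (γ s).2) t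
      ((1 : ℝ →L[ℝ] ℝ).smulRight (Y (γ t).1 (γ t).2)) := by
  constructor
  · have h1 := (hasMFDerivAt_fst (I := 𝓘(ℝ, ℝ)) (I' := I) (γ t)).comp t h
    have h2 : HasFDerivAt (fun s => (γ s).1) ((1 : ℝ →L[ℝ] ℝ).smulRight (1 : ℝ)) t :=
      hasMFDerivAt_iff_hasFDerivAt.1 (h1.congr_mfderiv (ContinuousLinearMap.ext_ring rfl))
    simpa using h2.hasDerivAt
  · have h1 := (hasMFDerivAt_snd (I := 𝓘(ℝ, ℝ)) (I' := I) (γ t)).comp t h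
    refine h1.congr_mfderiv ?_
    refine ContinuousLinearMap.ext_ring ?_
    rfl

/-- The flow of a time-dependent vector field on a compact manifold. -/
theorem exists_flow {Y : ℝ → VecField I M} (hY : FamVec I Y)
    (hY0 : ∀ t ∉ Icc (0 : ℝ) 1, Y t = 0) :
    ∃ φ : ℝ → M ≃ₘ^∞⟮I, I⟯ M,
      ContMDiff (𝓘(ℝ, ℝ).prod I) I ∞ (fun p : ℝ × M => φ p.1 p.2) ∧
      ContMDiff (𝓘(ℝ, ℝ).prod I) I ∞ (fun p : ℝ × M => (φ p.1).symm p.2) ∧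
      φ 0 = Diffeomorph.refl I M ∞ ∧
      ∀ t x, HasMFDerivAt 𝓘(ℝ, ℝ) I (fun s => φ s x) t
        ((1 : ℝ →L[ℝ] ℝ).smulRight (Y t (φ t x))) := by
  choose γ hγ0 hγ using exists_isMIntegralCurve_suspension hY hY0
  have hZ := smooth_suspension hY
  let Φ : ℝ × (ℝ × M) → ℝ × M := fun q => γ q.2 q.1
  have hΦ0 : ∀ p, Φ (0, p) = p := hγ0
  have hΦ : ContMDiff (𝓘(ℝ, ℝ).prod (𝓘(ℝ, ℝ).prod I)) (𝓘(ℝ, ℝ).prod I) ∞ Φ :=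
    contMDiff_flow hZ hΦ0 hγ
  have hadd : ∀ s t p, Φ (s + t, p) = Φ (s, Φ (t, p)) := flow_add hZ hΦ0 hγ
  have hfst : ∀ t p, (Φ (t, p)).1 = p.1 + t := by
    intro t p
    have h1 : ∀ s, HasDerivAt (fun s => (Φ (s, p)).1 - s) 0 s := by
      intro s
      have h := (hasMFDerivAt_fst_comp (hγ p s)).1.sub (hasDerivAt_id s)
      rwa [sub_self] at h
    have h2 := is_const_of_deriv_eq_zero (fun s => (h1 s).differentiableAt) (fun s => (h1 s).deriv) t 0
    simp only [hΦ0] at h2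
    linarith
  let f : ℝ → M → M := fun t x => (Φ (t, (0, x))).2
  let g : ℝ → M → M := fun t x => (Φ (-t, (t, x))).2
  have hf1 : ∀ t x, Φ (t, (0, x)) = (t, f t x) := fun t x => Prod.ext (by simp [hfst]) rfl
  have hg1 : ∀ t x, Φ (-t, (t, x)) = (0, g t x) := fun t x => Prod.ext (by simp [hfst]) rfl
  have hf : ContMDiff (𝓘(ℝ, ℝ).prod I) I ∞ (fun p : ℝ × M => f p.1 p.2) :=
    contMDiff_snd.comp (hΦ.comp (contMDiff_fst.prodMk (contMDiff_const.prodMk contMDiff_snd)))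
  have hneg : ContMDiff (𝓘(ℝ, ℝ).prod I) 𝓘(ℝ, ℝ) ∞ (fun p : ℝ × M => -p.1) :=
    contDiff_neg.contMDiff.comp contMDiff_fst
  have hg : ContMDiff (𝓘(ℝ, ℝ).prod I) I ∞ (fun p : ℝ × M => g p.1 p.2) :=
    contMDiff_snd.comp (hΦ.comp (hneg.prodMk (contMDiff_fst.prodMk contMDiff_snd)))
  have hgf : ∀ t x, g t (f t x) = x := by
    intro t x
    have h := hadd (-t) t (0, x)
    rw [neg_add_cancel, hΦ0, hf1, hg1] at h
    exact (congrArg Prod.snd h).symm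
  have hfg : ∀ t x, f t (g t x) = x := by
    intro t x
    have h := hadd t (-t) (t, x)
    rw [add_neg_cancel, hΦ0, hg1, hf1] at h
    exact (congrArg Prod.snd h).symm
  refine ⟨fun t => ⟨⟨f t, g t, hgf t, hfg t⟩, hf.comp (contMDiff_const.prodMk contMDiff_id),
    hg.comp (contMDiff_const.prodMk contMDiff_id)⟩, hf, hg, ?_, fun t x => ?_⟩
  · ext x
    change (Φ (0, (0, x))).2 = x
    rw [hΦ0]
  · have h := (hasMFDerivAt_fst_comp (hγ (0, x) t)).2
    change HasMFDerivAt 𝓘(ℝ, ℝ) I (fun s => f s x) t ((1 : ℝ →L[ℝ] ℝ).smulRight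
      (Y (Φ (t, (0, x))).1 (Φ (t, (0, x))).2)) at h
    rw [hf1] at h
    exact h

end TimeDependentFlow

section LieBracket

variable {E : Type*} [NormedAddCommGroup E] [NormedSpace ℝ E] [FiniteDimensional ℝ E]
  {H : Type*} [TopologicalSpace H] {I : ModelWithCorners ℝ E H}
  {M : Type*} [TopologicalSpace M] [ChartedSpace H M] [IsManifold I ∞ M]

theorem mlieBracket_fun_smul {V W : VecField I M} {f : M → ℝ} {x : M}
    (hf : MDifferentiableAt I 𝓘(ℝ, ℝ) f x) (hW : SmoothVec I W) :
    VectorField.mlieBracket I V (fun y => f y • W y) x =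
      dform I f x (V x) • W x + f x • VectorField.mlieBracket I V W x :=
  VectorField.mlieBracket_smul_right hf (hW.mdifferentiableAt x)

theorem SmoothVec.mlieBracket {X V : VecField I M} (hX : SmoothVec I X) (hV : SmoothVec I V) :
    SmoothVec I (VectorField.mlieBracket I X V) := by
  have := FiniteDimensional.complete ℝ E
  intro x
  have : IsManifold I ((⊤ : ℕ∞) + 1) M := ‹IsManifold I ∞ M›
  have : IsManifold I (minSmoothness ℝ 2) M := by
    rw [minSmoothness_of_isRCLikeNormedField]
    exact IsManifold.of_le (n := ∞) ENat.LEInfty.out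
  exact ContMDiffAt.mlieBracket_vectorField (m := ⊤) (n := ⊤) (hX x) (hV x) (by simp)

theorem SmoothVec.fun_smul {X : VecField I M} (hX : SmoothVec I X) {f : M → ℝ}
    (hf : ContMDiff I 𝓘(ℝ, ℝ) ∞ f) : SmoothVec I (fun y => f y • X y) :=
  ContMDiff.smul_section (V := TangentSpace I) hf hX

variable [T2Space M]

theorem dform_mlieBracket {X V : VecField I M} (hX : SmoothVec I X) (hV : SmoothVec I V)
    {f : M → ℝ} (hf : ContMDiff I 𝓘(ℝ, ℝ) ∞ f) (x : M) :
    dform I f x (VectorField.mlieBracket I X V x) =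
      vderiv I X (fun y => dform I f y (V y)) x - vderiv I V (fun y => dform I f y (X y)) x := by
  have := FiniteDimensional.complete ℝ E
  obtain ⟨e, q, he, hq, h⟩ := exists_frame (I := I) x
  obtain ⟨hdual, hspan⟩ := h.self_of_nhds
  rcases isEmpty_or_nonempty (Fin (Module.finrank ℝ E)) with h0 | ⟨⟨i⟩⟩
  · have hz : ∀ v : TangentSpace I x, v = 0 := fun v => by rw [hspan v]; simp
    rw [vderiv_eq_dform, vderiv_eq_dform, hz (VectorField.mlieBracket I X V x), hz (X x), hz (V x)]
    simp
  · have hW := he i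
    set W := e i
    have hW0 : dform I (q i) x (W x) = 1 := by simpa using hdual i i
    have hmd : ∀ {g : M → ℝ}, ContMDiff I 𝓘(ℝ, ℝ) ∞ g → ∀ y, MDifferentiableAt I 𝓘(ℝ, ℝ) g y :=
      fun hg y => (hg y).mdifferentiableAt (by simp)
    have hbr : ∀ {A : VecField I M}, (fun y => VectorField.mlieBracket I A (fun y => f y • W y) y) =
        (fun y => dform I f y (A y) • W y) + (fun y => f y • VectorField.mlieBracket I A W y) := by
      intro A
      funext y
      exact mlieBracket_fun_smul (hmd hf y) hW
    have hXf : ContMDiff I 𝓘(ℝ, ℝ) ∞ (fun y => dform I f y (X y)) := smoothForm_dform hf X hX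
    have hVf : ContMDiff I 𝓘(ℝ, ℝ) ∞ (fun y => dform I f y (V y)) := smoothForm_dform hf V hV
    have hsm : ∀ {A : VecField I M}, SmoothVec I A → ContMDiffAt I I.tangent (minSmoothness ℝ 2)
        (fun y => (⟨y, A y⟩ : TangentBundle I M)) x := by
      intro A hA
      rw [minSmoothness_of_isRCLikeNormedField]
      exact (hA x).of_le ENat.LEInfty.out
    have hfW := hW.fun_smul hf
    have : IsManifold I (minSmoothness ℝ 3) M := by
      rw [minSmoothness_of_isRCLikeNormedField]
      exact IsManifold.of_le (n := ∞) ENat.LEInfty.out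
    have J := VectorField.leibniz_identity_mlieBracket_apply (hsm hX) (hsm hV) (hsm hfW)
    have J' := VectorField.leibniz_identity_mlieBracket_apply (hsm hX) (hsm hV) (hsm hW)
    have hexp : ∀ {A B : VecField I M}, SmoothVec I B →
        ContMDiff I 𝓘(ℝ, ℝ) ∞ (fun y => dform I f y (B y)) →
        VectorField.mlieBracket I A (VectorField.mlieBracket I B (fun y => f y • W y)) x =
          dform I (fun y => dform I f y (B y)) x (A x) • W x
          + dform I f x (B x) • VectorField.mlieBracket I A W x
          + (dform I f x (A x) • VectorField.mlieBracket I B W x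
          + f x • VectorField.mlieBracket I A (VectorField.mlieBracket I B W) x) := by
      intro A B hB hBf
      have h1 := hbr (A := B)
      change VectorField.mlieBracket I B (fun y => f y • W y) = _ at h1
      rw [h1, VectorField.mlieBracket_add_right ((hW.fun_smul hBf).mdifferentiableAt x)
        (((hB.mlieBracket hW).fun_smul hf).mdifferentiableAt x), mlieBracket_fun_smul (hmd hBf x) hW,
        mlieBracket_fun_smul (hmd hf x) (hB.mlieBracket hW)]
    rw [hexp hV hVf, hexp hX hXf, mlieBracket_fun_smul (hmd hf x) hW, J'] at J
    have K := congrArg (dform I (q i) x) J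
    simp only [map_add, map_smul, hW0, smul_eq_mul] at K
    rw [vderiv_eq_dform, vderiv_eq_dform]
    linarith

end LieBracket

section Tensoriality

variable {E : Type*} [NormedAddCommGroup E] [NormedSpace ℝ E] [FiniteDimensional ℝ E]
  {H : Type*} [TopologicalSpace H] {I : ModelWithCorners ℝ E H}
  {M : Type*} [TopologicalSpace M] [ChartedSpace H M] [IsManifold I ∞ M] [T2Space M]

/-- The Lie derivative of a bivector field on exact forms. -/
theorem bracketVB_dform {Y : VecField I M} {P : BiField I M} (hY : SmoothVec I Y)
    (hP : IsBivectorField I P) {f g : M → ℝ} (hf : ContMDiff I 𝓘(ℝ, ℝ) ∞ f)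
    (hg : ContMDiff I 𝓘(ℝ, ℝ) ∞ g) (x : M) :
    (tangentLie I M).bracketVB Y P (dform I f) (dform I g) x =
      vderiv I Y (fun y => P y (dform I f y) (dform I g y)) x
        - P x (dform I (fun y => dform I f y (Y y)) x) (dform I g x)
        - P x (dform I f x) (dform I (fun y => dform I g y (Y y)) x) := by
  simp only [AlmostLieData.bracketVB, AlmostLieData.lie, tangentLie]
  rw [dform_mlieBracket hY (hP.smooth_sharp (smoothForm_dform hg)) hf,
    dform_mlieBracket hY (hP.smooth_sharp (smoothForm_dform hf)) hg]
  simp only [vderiv_eq_dform, sharpField, apply_sharp]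
  rw [BiField.skew hP.1 x (dform I g x)]
  ring

theorem dform_pairing_eq_zero {η : OneForm I M} {V : VecField I M} (hη : SmoothForm I η)
    (hV : SmoothVec I V) {x : M} (h1 : η x = 0) (h2 : V x = 0) :
    dform I (fun y => η y (V y)) x = 0 := by
  obtain ⟨e, q, he, hq, h⟩ := exists_frame (I := I) x
  have hev : (fun y => η y (V y)) =ᶠ[𝓝 x] fun y => ∑ i, dform I (q i) y (V y) * η y (e i y) := by
    filter_upwards [h] with y hy
    conv_lhs => rw [hy.2 (V y)]
    simp
  have hA : ∀ i, MDifferentiableAt I 𝓘(ℝ, ℝ) (fun y => dform I (q i) y (V y)) x := fun i =>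
    (smoothForm_dform (hq i) V hV x).mdifferentiableAt (by simp)
  have hB : ∀ i, MDifferentiableAt I 𝓘(ℝ, ℝ) (fun y => η y (e i y)) x := fun i =>
    (hη _ (he i) x).mdifferentiableAt (by simp)
  have hAB : ∀ i, MDifferentiableAt I 𝓘(ℝ, ℝ)
      (fun y => dform I (q i) y (V y) * η y (e i y)) x := fun i => (hA i).mul (hB i)
  rw [dform_congr hev, (dform_finsetSum _ hAB).2]
  refine Finset.sum_eq_zero fun i _ => ?_
  rw [dform_mul (hA i) (hB i), h1, h2]
  simp

theorem SmoothForm.sub {α β : OneForm I M} (hα : SmoothForm I α) (hβ : SmoothForm I β) :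
    SmoothForm I (α - β) := fun X hX => (hα X hX).sub (hβ X hX)

theorem apply_mlieBracket_of_eq_zero {β : OneForm I M} {X V : VecField I M} (hβ : SmoothForm I β)
    (hX : SmoothVec I X) (hV : SmoothVec I V) {x : M} (h : V x = 0) :
    β x (VectorField.mlieBracket I X V x) = vderiv I X (fun y => β y (V y)) x := by
  obtain ⟨f, hf, hfx⟩ := exists_dform_eq x (β x)
  have h1 := dform_pairing_eq_zero (hβ.sub (smoothForm_dform hf)) hV
    (by simp [hfx] : (β - dform I f) x = 0) h
  have h2 : dform I (fun y => β y (V y)) x = dform I (fun y => dform I f y (V y)) x := by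
    have h3 := dform_sub ((hβ V hV x).mdifferentiableAt (by simp))
      ((smoothForm_dform hf V hV x).mdifferentiableAt (by simp))
    have h4 : (fun y => (β - dform I f) y (V y)) = fun y => β y (V y) - dform I f y (V y) := rfl
    rw [h4, h3] at h1
    exact sub_eq_zero.1 h1
  rw [← hfx, dform_mlieBracket hX hV hf, vderiv_eq_dform, vderiv_eq_dform, vderiv_eq_dform, h2, h,
    map_zero, sub_zero]

theorem bracketVB_eq_zero {Y : VecField I M} {P : BiField I M} (hY : SmoothVec I Y)
    (hP : IsBivectorField I P) {α β : OneForm I M} (hα : SmoothForm I α) (hβ : SmoothForm I β)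
    {x : M} (h : α x = 0) : (tangentLie I M).bracketVB Y P α β x = 0 := by
  simp only [AlmostLieData.bracketVB, AlmostLieData.lie, tangentLie]
  rw [apply_mlieBracket_of_eq_zero hβ hY (hP.smooth_sharp hα) (by simp [sharpField, h]), h]
  have h1 : (fun y => P y (α y) (β y)) = fun y => - α y (sharpField I P β y) := by
    funext y
    rw [sharpField, apply_sharp, BiField.skew hP.1]
  rw [h1, vderiv_eq_dform, vderiv_eq_dform, dform_neg]
  simp

theorem bracketVB_congr {Y : VecField I M} {P : BiField I M} (hY : SmoothVec I Y)
    (hP : IsBivectorField I P) {α α' β β' : OneForm I M} (hα : SmoothForm I α)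
    (hα' : SmoothForm I α') (hβ : SmoothForm I β) (hβ' : SmoothForm I β') {x : M}
    (h : α x = α' x) (h' : β x = β' x) :
    (tangentLie I M).bracketVB Y P α β x = (tangentLie I M).bracketVB Y P α' β' x := by
  have swap : ∀ α β : OneForm I M, (tangentLie I M).bracketVB Y P α β x
      = - (tangentLie I M).bracketVB Y P β α x := by
    intro α β
    have h1 : (fun y => P y (α y) (β y)) = fun y => - P y (β y) (α y) :=
      funext fun y => BiField.skew hP.1 y _ _
    simp only [AlmostLieData.bracketVB, h1, vderiv_eq_dform, dform_neg, LinearMap.neg_apply]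
    ring
  have key : ∀ {α α' β : OneForm I M}, SmoothForm I α → SmoothForm I α' → SmoothForm I β →
      α x = α' x → (tangentLie I M).bracketVB Y P α β x = (tangentLie I M).bracketVB Y P α' β x := by
    intro α α' β hα hα' hβ h
    have h1 : graphSec I P α = graphSec I P α' + graphSec I P (α - α') := by
      refine Prod.ext ?_ (by simp [graphSec])
      funext y
      simp [graphSec, sharpField]
    have h2 := bracketVB_eq_zero hY hP (hα.sub hα') hβ (by simp [h] : (α - α') x = 0)
    rw [bracketVB_eq_courant] at h2 ⊢
    rw [h1, courant_add_mid hY.smoothGen (hP.smoothGen hα') (hP.smoothGen (hα.sub hα'))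
      (hP.smoothGen hβ), h2, add_zero, bracketVB_eq_courant]
  rw [key hα hα' hβ h, swap, key hβ hβ' hα' h', swap, neg_neg]

theorem bracketVB_const_smul {Y : VecField I M} (hY : SmoothVec I Y) (c : ℝ) (P : BiField I M)
    (α β : OneForm I M) (x : M) :
    (tangentLie I M).bracketVB (c • Y) P α β x = c * (tangentLie I M).bracketVB Y P α β x := by
  simp only [AlmostLieData.bracketVB, AlmostLieData.lie, tangentLie, vderiv_eq_dform,
    VectorField.mlieBracket_const_smul_left (hY.mdifferentiableAt x), Pi.smul_apply, map_smul,
    smul_eq_mul]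
  ring

end Tensoriality

section PointwiseDerivative

variable {V : Type*} [AddCommGroup V] [Module ℝ V] [FiniteDimensional ℝ V]

theorem hasDerivAt_dual_apply {L : ℝ → Module.Dual ℝ V →ₗ[ℝ] ℝ} {L' : Module.Dual ℝ V → ℝ}
    {a : ℝ → Module.Dual ℝ V} {a' : Module.Dual ℝ V} {t : ℝ}
    (hL : ∀ b, HasDerivAt (fun s => L s b) (L' b) t)
    (ha : ∀ v, HasDerivAt (fun s => a s v) (a' v) t) :
    HasDerivAt (fun s => L s (a s)) (L' (a t) + L t a') t := by
  let e := Module.finBasis ℝ V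
  have hexp : ∀ s b, L s b = ∑ i, b (e i) * L s (e.coord i) := fun s b => by
    conv_lhs => rw [← e.sum_dual_apply_smul_coord b]
    simp only [map_sum, map_smul, smul_eq_mul]
  have h1 : L' (a t) = ∑ i, a t (e i) * L' (e.coord i) := by
    refine (hL (a t)).unique ?_
    simp only [hexp _ (a t)]
    exact HasDerivAt.fun_sum fun i _ => (hL _).const_mul _
  rw [h1, hexp t a', ← Finset.sum_add_distrib]
  simp only [hexp _ (a _)]
  refine HasDerivAt.fun_sum fun i _ => ?_
  exact ((ha (e i)).mul (hL (e.coord i))).congr_deriv (by ring)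

theorem hasDerivAt_bilin_apply {B : ℝ → Module.Dual ℝ V →ₗ[ℝ] Module.Dual ℝ V →ₗ[ℝ] ℝ}
    {B' : Module.Dual ℝ V → Module.Dual ℝ V → ℝ} {a b : ℝ → Module.Dual ℝ V}
    {a' b' : Module.Dual ℝ V} {t : ℝ}
    (hB : ∀ c d, HasDerivAt (fun s => B s c d) (B' c d) t)
    (ha : ∀ v, HasDerivAt (fun s => a s v) (a' v) t)
    (hb : ∀ v, HasDerivAt (fun s => b s v) (b' v) t) :
    HasDerivAt (fun s => B s (a s) (b s)) (B' (a t) (b t) + B t a' (b t) + B t (a t) b') t := by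
  have h1 : ∀ c, HasDerivAt (fun s => (B s).flip (b s) c) (B' c (b t) + B t c b') t := fun c =>
    hasDerivAt_dual_apply (L := fun s => B s c) (hB c) hb
  exact (hasDerivAt_dual_apply (L := fun s => (B s).flip (b s)) h1 ha).congr_deriv (by
    simp only [LinearMap.flip_apply]; ring)

end PointwiseDerivative

theorem hasDerivAt_deriv_comm {u : ℝ × ℝ → ℝ} {t₀ s₀ : ℝ} (hu : ContDiffAt ℝ 2 u (t₀, s₀)) :
    HasDerivAt (fun t => deriv (fun s => u (t, s)) s₀)
      (deriv (fun s => deriv (fun t => u (t, s)) t₀) s₀) t₀ := by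
  have hd : ∀ᶠ p in 𝓝 (t₀, s₀), DifferentiableAt ℝ u p := by
    filter_upwards [hu.eventually (by simp)] with p hp
    exact hp.differentiableAt (by simp)
  have hl : ∀ t s : ℝ, HasDerivAt (fun t => (t, s)) ((1 : ℝ), (0 : ℝ)) t := fun t s =>
    (hasDerivAt_id t).prodMk (hasDerivAt_const t s)
  have hr : ∀ t s : ℝ, HasDerivAt (fun s => (t, s)) ((0 : ℝ), (1 : ℝ)) s := fun t s =>
    (hasDerivAt_const s t).prodMk (hasDerivAt_id s)
  have h2 : HasFDerivAt (fderiv ℝ u) (fderiv ℝ (fderiv ℝ u) (t₀, s₀)) (t₀, s₀) :=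
    ((hu.fderiv_right (m := 1) (by norm_num)).differentiableAt (by simp)).hasFDerivAt
  have hsymm : fderiv ℝ (fderiv ℝ u) (t₀, s₀) (1, 0) (0, 1)
      = fderiv ℝ (fderiv ℝ u) (t₀, s₀) (0, 1) (1, 0) :=
    (hu.isSymmSndFDerivAt (by simp)) (1, 0) (0, 1)
  have h3 : HasDerivAt (fun s => deriv (fun t => u (t, s)) t₀)
      (fderiv ℝ (fderiv ℝ u) (t₀, s₀) (0, 1) (1, 0)) s₀ := by
    have h0 : HasDerivAt (fun s => fderiv ℝ u (t₀, s)) (fderiv ℝ (fderiv ℝ u) (t₀, s₀) (0, 1)) s₀ :=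
      HasFDerivAt.comp_hasDerivAt (f := fun s => (t₀, s)) s₀ h2 (hr t₀ s₀)
    have h := h0.clm_apply (hasDerivAt_const s₀ ((1 : ℝ), (0 : ℝ)))
    simp only [map_zero, add_zero] at h
    refine h.congr_of_eventuallyEq ?_
    filter_upwards [(hr t₀ s₀).continuousAt.eventually hd] with s hs
    have h5 : HasDerivAt (fun t => u (t, s)) (fderiv ℝ u (t₀, s) (1, 0)) t₀ :=
      HasFDerivAt.comp_hasDerivAt (f := fun t => (t, s)) t₀ hs.hasFDerivAt (hl t₀ s)
    exact h5.deriv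
  have h4 : HasDerivAt (fun t => deriv (fun s => u (t, s)) s₀)
      (fderiv ℝ (fderiv ℝ u) (t₀, s₀) (1, 0) (0, 1)) t₀ := by
    have h0 : HasDerivAt (fun t => fderiv ℝ u (t, s₀)) (fderiv ℝ (fderiv ℝ u) (t₀, s₀) (1, 0)) t₀ :=
      HasFDerivAt.comp_hasDerivAt (f := fun t => (t, s₀)) t₀ h2 (hl t₀ s₀)
    have h := h0.clm_apply (hasDerivAt_const t₀ ((0 : ℝ), (1 : ℝ)))
    simp only [map_zero, add_zero] at h
    refine h.congr_of_eventuallyEq ?_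
    filter_upwards [(hl t₀ s₀).continuousAt.eventually hd] with t ht
    have h5 : HasDerivAt (fun s => u (t, s)) (fderiv ℝ u (t, s₀) (0, 1)) s₀ :=
      HasFDerivAt.comp_hasDerivAt (f := fun s => (t, s)) s₀ ht.hasFDerivAt (hr t s₀)
    exact h5.deriv
  rw [h3.deriv, ← hsymm]
  exact h4

section FamilyCalculus

variable {E : Type*} [NormedAddCommGroup E] [NormedSpace ℝ E] [FiniteDimensional ℝ E]
  {H : Type*} [TopologicalSpace H] {I : ModelWithCorners ℝ E H}
  {M : Type*} [TopologicalSpace M] [ChartedSpace H M] [IsManifold I ∞ M]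

theorem FamFun.mfderiv_apply {F : ℝ → M → ℝ} (hF : FamFun I F) (t : ℝ) (y : M) (a : ℝ)
    (v : TangentSpace I y) :
    mfderiv (𝓘(ℝ, ℝ).prod I) 𝓘(ℝ, ℝ) (fun p : ℝ × M => F p.1 p.2) (t, y) (a, v) =
      a * deriv (fun s => F s y) t + dform I (F t) y v := by
  have h := mfderiv_prod_eq_add_apply (I := 𝓘(ℝ, ℝ)) (I' := I) (I'' := 𝓘(ℝ, ℝ)) (v := (a, v))
    ((hF (t, y)).mdifferentiableAt (by simp))
  have h2 : fderiv ℝ (fun s => F s y) t a = a * deriv (fun s => F s y) t := by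
    rw [fderiv_eq_smul_deriv, smul_eq_mul]
  have h3 : (mfderiv 𝓘(ℝ, ℝ) 𝓘(ℝ, ℝ) (fun s => F s y) t a : ℝ) = a * deriv (fun s => F s y) t := by
    rw [mfderiv_eq_fderiv]
    exact h2
  exact h.trans (congrArg (fun z : ℝ => z + dform I (F t) y v) h3)

theorem FamFun.hasDerivAt {F : ℝ → M → ℝ} (hF : FamFun I F) (t : ℝ) (y : M) :
    HasDerivAt (fun s => F s y) (deriv (fun s => F s y) t) t := by
  have h : ContMDiff 𝓘(ℝ, ℝ) 𝓘(ℝ, ℝ) ∞ (fun s => F s y) :=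
    hF.comp (contMDiff_id.prodMk contMDiff_const)
  exact ((h.contDiff.differentiable (by simp)) t).hasDerivAt

theorem FamFun.hasDerivAt_comp {F : ℝ → M → ℝ} (hF : FamFun I F) {c : ℝ → M} {t : ℝ}
    {v : TangentSpace I (c t)}
    (hc : HasMFDerivAt 𝓘(ℝ, ℝ) I c t ((1 : ℝ →L[ℝ] ℝ).smulRight v)) :
    HasDerivAt (fun s => F s (c s)) (deriv (fun s => F s (c t)) t + dform I (F t) (c t) v) t := by
  have h1 := ((hasMFDerivAt_id (I := 𝓘(ℝ, ℝ)) t).prodMk hc)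
  have h2 := ((hF (t, c t)).mdifferentiableAt (by simp)).hasMFDerivAt.comp t h1
  have h3 : HasFDerivAt (fun s => F s (c s)) ((1 : ℝ →L[ℝ] ℝ).smulRight
      (deriv (fun s => F s (c t)) t + dform I (F t) (c t) v)) t := by
    refine hasMFDerivAt_iff_hasFDerivAt.1 (h2.congr_mfderiv (ContinuousLinearMap.ext_ring ?_))
    change mfderiv (𝓘(ℝ, ℝ).prod I) 𝓘(ℝ, ℝ) (fun p : ℝ × M => F p.1 p.2) (t, c t)
      ((1 : ℝ), (1 : ℝ) • v) = (1 : ℝ) • _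
    rw [hF.mfderiv_apply, one_smul, one_mul]
    exact (one_smul ℝ (_ : ℝ)).symm
  simpa using h3.hasDerivAt

variable [T2Space M]

theorem FamFun.deriv {F : ℝ → M → ℝ} (hF : FamFun I F) :
    FamFun I (fun t y => deriv (fun s => F s y) t) := by
  have h0 : FamVec I (fun _ => (0 : VecField I M)) := fun α _ => by
    simpa using! (contMDiff_const (c := (0 : ℝ)))
  have h := contMDiffOn_univ.1 (contMDiffOn_mfderiv_section isOpen_univ hF.contMDiffOn
    (smooth_suspension h0))
  refine h.congr fun p => ?_
  change _ = mfderiv (𝓘(ℝ, ℝ).prod I) 𝓘(ℝ, ℝ) (fun p : ℝ × M => F p.1 p.2) (p.1, p.2)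
    ((1 : ℝ), (0 : TangentSpace I p.2))
  rw [hF.mfderiv_apply, map_zero, one_mul, add_zero]

theorem FamFun.famForm_dform {F : ℝ → M → ℝ} (hF : FamFun I F) :
    FamForm I (fun t => dform I (F t)) := by
  intro V hV
  have h := contMDiffOn_univ.1 (contMDiffOn_mfderiv_section isOpen_univ hF.contMDiffOn
    (smooth_suspension (FamVec.of_smooth hV)))
  have h2 : FamFun I (fun t y => (mfderiv (𝓘(ℝ, ℝ).prod I) 𝓘(ℝ, ℝ)
      (fun p : ℝ × M => F p.1 p.2) (t, y) (suspension (fun _ => V) (t, y)) : ℝ)) := h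
  refine (h2.sub hF.deriv).congr fun p => ?_
  change _ = mfderiv (𝓘(ℝ, ℝ).prod I) 𝓘(ℝ, ℝ) (fun p : ℝ × M => F p.1 p.2) (p.1, p.2)
    ((1 : ℝ), V p.2) - _
  rw [hF.mfderiv_apply, one_mul]
  exact (add_sub_cancel_left (_root_.deriv (fun s => F s p.2) p.1) _).symm

variable [I.Boundaryless]

theorem exists_curve (y : M) (v : TangentSpace I y) :
    ∃ c : ℝ → M, c 0 = y ∧ ContMDiffAt 𝓘(ℝ, ℝ) I ∞ c 0 ∧
      HasMFDerivAt 𝓘(ℝ, ℝ) I c 0 ((1 : ℝ →L[ℝ] ℝ).smulRight v) := by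
  set φ := extChartAt I y
  let w : E := mfderiv I 𝓘(ℝ, E) φ y v
  let u : ℝ → E := fun s => φ y + s • w
  have hu0 : u 0 = φ y := by simp [u]
  have hc0 : φ.symm (u 0) = y := by rw [hu0]; exact extChartAt_to_inv y
  have hmem : u 0 ∈ φ.target := by rw [hu0]; exact mem_extChartAt_target y
  have hu : ContDiff ℝ ∞ u := by fun_prop
  refine ⟨fun s => φ.symm (u s), hc0, ?_, ?_⟩
  · refine ContMDiffAt.comp (g := φ.symm) 0 ?_ hu.contMDiff.contMDiffAt
    exact (contMDiffOn_extChartAt_symm y).contMDiffAt ((isOpen_extChartAt_target y).mem_nhds hmem)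
  · obtain ⟨Z, -, hZ⟩ : ∃ Z : VecField I M, True ∧ Z y = v := by
      classical
      exact ⟨Function.update 0 y v, trivial, by simp⟩
    have hud : HasDerivAt u w 0 := by
      simpa [u] using ((hasDerivAt_id (0 : ℝ)).smul_const w).const_add (φ y)
    have h := isMIntegralCurveAt_extChartAt_symm (Z := Z) (p₀ := y) (u := u) (t := 0) hmem (by
      have h1 : ∀ z, z = y → (mfderiv I 𝓘(ℝ, E) φ z (Z z) : E) = w := by
        rintro z rfl
        rw [hZ]
      rw [h1 _ hc0]
      exact hud)
    refine h.congr_mfderiv ?_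
    have h1 : ∀ z, z = y → (Z z : E) = v := by
      rintro z rfl
      exact hZ
    exact congrArg (fun z : E => (1 : ℝ →L[ℝ] ℝ).smulRight z) (h1 _ hc0)

theorem FamFun.hasDerivAt_dform {F : ℝ → M → ℝ} (hF : FamFun I F) (t : ℝ) (y : M)
    (v : TangentSpace I y) :
    HasDerivAt (fun s => dform I (F s) y v)
      (dform I (fun z => _root_.deriv (fun s => F s z) t) y v) t := by
  obtain ⟨c, hc0, hc, hcd⟩ := exists_curve y v
  subst hc0
  let u : ℝ × ℝ → ℝ := fun p => F p.1 (c p.2)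
  have hu : ContMDiffAt 𝓘(ℝ, ℝ × ℝ) 𝓘(ℝ, ℝ) ∞ u (t, 0) := by
    refine ContMDiffAt.comp (g := fun p : ℝ × M => F p.1 p.2) (f := fun p : ℝ × ℝ => (p.1, c p.2))
      (t, 0) (hF _) ?_
    have h1 : ContMDiffAt 𝓘(ℝ, ℝ × ℝ) 𝓘(ℝ, ℝ) ∞ (Prod.fst : ℝ × ℝ → ℝ) (t, 0) :=
      contDiff_fst.contMDiff.contMDiffAt
    have h2 : ContMDiffAt 𝓘(ℝ, ℝ × ℝ) 𝓘(ℝ, ℝ) ∞ (Prod.snd : ℝ × ℝ → ℝ) (t, 0) :=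
      contDiff_snd.contMDiff.contMDiffAt
    exact h1.prodMk (ContMDiffAt.comp (g := c) (t, 0) hc h2)
  have key := hasDerivAt_deriv_comm (hu.contDiffAt.of_le ENat.LEInfty.out)
  have hcomp : ∀ {f : M → ℝ}, ContMDiff I 𝓘(ℝ, ℝ) ∞ f →
      HasDerivAt (fun s => f (c s)) (dform I f (c 0) v) 0 := by
    intro f hf
    have h := (FamFun.const hf).hasDerivAt_comp hcd
    simpa using h
  have h1 : ∀ s, _root_.deriv (fun r => u (s, r)) 0 = dform I (F s) (c 0) v := fun s =>
    (hcomp (hF.slice s)).deriv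
  have h2 : _root_.deriv (fun r => _root_.deriv (fun s => u (s, r)) t) 0
      = dform I (fun z => _root_.deriv (fun s => F s z) t) (c 0) v := (hcomp (hF.deriv.slice t)).deriv
  simp only [h1, h2] at key
  exact key

end FamilyCalculus

section Transport

variable {E : Type*} [NormedAddCommGroup E] [NormedSpace ℝ E] [FiniteDimensional ℝ E]
  {H : Type*} [TopologicalSpace H] {I : ModelWithCorners ℝ E H} [I.Boundaryless]
  {M : Type*} [TopologicalSpace M] [ChartedSpace H M] [IsManifold I ∞ M] [T2Space M]

/-- The derivative of `φ_t^* P_t` for a family of diffeomorphisms with velocity `Y_t`. -/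
theorem hasDerivAt_transport {P : ℝ → BiField I M} (hP : FamBi I P)
    (hPb : ∀ t, IsBivectorField I (P t)) {Y : ℝ → VecField I M} (hY : FamVec I Y)
    {φ : ℝ → M ≃ₘ^∞⟮I, I⟯ M}
    (hθ : ContMDiff (𝓘(ℝ, ℝ).prod I) I ∞ (fun p : ℝ × M => (φ p.1).symm p.2))
    (hφ : ∀ t x, HasMFDerivAt 𝓘(ℝ, ℝ) I (fun s => φ s x) t
      ((1 : ℝ →L[ℝ] ℝ).smulRight (Y t (φ t x))))
    {f g : M → ℝ} (hf : ContMDiff I 𝓘(ℝ, ℝ) ∞ f) (hg : ContMDiff I 𝓘(ℝ, ℝ) ∞ g) (t : ℝ) (x : M) :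
    HasDerivAt (fun s => P s (φ s x) (dform I (fun y => f ((φ s).symm y)) (φ s x))
        (dform I (fun y => g ((φ s).symm y)) (φ s x)))
      (deriv (fun s => P s (φ t x) (dform I (fun y => f ((φ t).symm y)) (φ t x))
          (dform I (fun y => g ((φ t).symm y)) (φ t x))) t
        + (tangentLie I M).bracketVB (Y t) (P t) (dform I (fun y => f ((φ t).symm y)))
          (dform I (fun y => g ((φ t).symm y))) (φ t x)) t := by
  have hF : ∀ {f : M → ℝ}, ContMDiff I 𝓘(ℝ, ℝ) ∞ f → FamFun I (fun s y => f ((φ s).symm y)) :=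
    fun hf => hf.comp hθ
  have hD : ∀ {f : M → ℝ}, ContMDiff I 𝓘(ℝ, ℝ) ∞ f → ∀ z, deriv (fun s => f ((φ s).symm z)) t
      = - dform I (fun y => f ((φ t).symm y)) z (Y t z) := by
    intro f hf z
    have h1 := (hF hf).hasDerivAt_comp (hφ t ((φ t).symm z))
    simp only [Diffeomorph.symm_apply_apply, Diffeomorph.apply_symm_apply] at h1
    have h2 := h1.unique (hasDerivAt_const t (f ((φ t).symm z)))
    have h3 : ∀ w, w = z → dform I (fun y => f ((φ t).symm y)) w (Y t w)
        = dform I (fun y => f ((φ t).symm y)) z (Y t z) := by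
      rintro w rfl
      rfl
    rw [h3 _ ((φ t).apply_symm_apply z)] at h2
    linarith
  have hd : ∀ {f : M → ℝ}, ContMDiff I 𝓘(ℝ, ℝ) ∞ f → ∀ z v,
      HasDerivAt (fun s => dform I (fun y => f ((φ s).symm y)) z v)
        ((- dform I (fun y => dform I (fun y => f ((φ t).symm y)) y (Y t y)) z) v) t := by
    intro f hf z v
    have h1 := (hF hf).hasDerivAt_dform t z v
    have h2 : (fun z => deriv (fun s => f ((φ s).symm z)) t)
        = fun z => - dform I (fun y => f ((φ t).symm y)) z (Y t z) := funext (hD hf)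
    simp only [h2, dform_neg] at h1
    exact h1
  have hH : FamFun I (fun s y => P s y (dform I (fun y => f ((φ s).symm y)) y)
      (dform I (fun y => g ((φ s).symm y)) y)) :=
    hP.pairing (hF hf).famForm_dform (hF hg).famForm_dform
  refine (hH.hasDerivAt_comp (hφ t x)).congr_deriv ?_
  set y := φ t x
  have hB : ∀ c d : Cotangent I y, HasDerivAt (fun s => P s y c d) (deriv (fun s => P s y c d) t) t := by
    intro c d
    obtain ⟨α, hα, rfl⟩ := exists_smoothForm_eq y c
    obtain ⟨β, hβ, rfl⟩ := exists_smoothForm_eq y d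
    exact (hP.pairing (.of_smooth hα) (.of_smooth hβ)).hasDerivAt t y
  have h1 := (hasDerivAt_bilin_apply (B := fun s => P s y) hB (hd hf y) (hd hg y)).deriv
  rw [h1, bracketVB_dform (hY.slice t) (hPb t) ((hF hf).slice t) ((hF hg).slice t), vderiv_eq_dform]
  simp only [map_neg, LinearMap.neg_apply]
  ring

end Transport

theorem smoothTransition_mem_Icc (s : ℝ) : Real.smoothTransition s ∈ Icc (0 : ℝ) 1 :=
  ⟨Real.smoothTransition.nonneg s, Real.smoothTransition.le_one s⟩

theorem hasDerivAt_smoothTransition (s : ℝ) :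
    HasDerivAt Real.smoothTransition (deriv Real.smoothTransition s) s :=
  ((Real.smoothTransition.contDiff (n := 1)).differentiable (by simp) s).hasDerivAt

theorem deriv_smoothTransition_of_notMem {s : ℝ} (hs : s ∉ Icc (0 : ℝ) 1) :
    deriv Real.smoothTransition s = 0 := by
  rcases not_and_or.1 hs with h | h
  · have h1 : Real.smoothTransition =ᶠ[𝓝 s] fun _ => 0 := by
      filter_upwards [gt_mem_nhds (not_le.1 h)] with r hr
      exact Real.smoothTransition.zero_of_nonpos hr.le
    rw [h1.deriv_eq, deriv_const]
  · have h1 : Real.smoothTransition =ᶠ[𝓝 s] fun _ => 1 := by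
      filter_upwards [lt_mem_nhds (not_le.1 h)] with r hr
      exact Real.smoothTransition.one_of_one_le hr.le
    rw [h1.deriv_eq, deriv_const]

section Families

variable {E : Type*} [NormedAddCommGroup E] [NormedSpace ℝ E] [FiniteDimensional ℝ E]
  {H : Type*} [TopologicalSpace H] {I : ModelWithCorners ℝ E H}
  {M : Type*} [TopologicalSpace M] [ChartedSpace H M] [IsManifold I ∞ M]

theorem contMDiff_smoothTransition_prod (I : ModelWithCorners ℝ E H) (M : Type*)
    [TopologicalSpace M] [ChartedSpace H M] :
    ContMDiff (𝓘(ℝ, ℝ).prod I) (𝓘(ℝ, ℝ).prod I) ∞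
      (fun p : ℝ × M => (Real.smoothTransition p.1, p.2)) :=
  (Real.smoothTransition.contDiff.contMDiff.comp contMDiff_fst).prodMk contMDiff_snd

theorem FamFun.of_contDiff {c : ℝ → ℝ} (hc : ContDiff ℝ ∞ c) :
    FamFun I (fun t (_ : M) => c t) := hc.contMDiff.comp contMDiff_fst

theorem FamVec.smul {X : ℝ → VecField I M} (hX : FamVec I X) {c : ℝ → ℝ} (hc : ContDiff ℝ ∞ c) :
    FamVec I (fun t => c t • X t) := fun α hα => by
  simpa using! (FamFun.of_contDiff hc).mul (hX α hα)

variable [T2Space M]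

theorem FamBi.hasDerivAt {P : ℝ → BiField I M} (hP : FamBi I P) (t : ℝ) (y : M)
    (a b : Cotangent I y) :
    HasDerivAt (fun s => P s y a b) (deriv (fun s => P s y a b) t) t := by
  obtain ⟨α, hα, rfl⟩ := exists_smoothForm_eq y a
  obtain ⟨β, hβ, rfl⟩ := exists_smoothForm_eq y b
  exact (hP.pairing (.of_smooth hα) (.of_smooth hβ)).hasDerivAt t y

theorem FamForm.exists_hasDerivAt {α : ℝ → OneForm I M} (hα : FamForm I α) (t : ℝ) (y : M) :
    ∃ a' : Cotangent I y, ∀ v, HasDerivAt (fun s => α s y v) (a' v) t := by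
  obtain ⟨e, q, he, -, h⟩ := exists_frame (I := I) y
  have h1 : ∀ s v, α s y v = ∑ i, dform I (q i) y v * α s y (e i y) := fun s v => by
    conv_lhs => rw [h.self_of_nhds.2 v]
    simp only [map_sum, map_smul, smul_eq_mul]
  refine ⟨∑ i, deriv (fun s => α s y (e i y)) t • dform I (q i) y, fun v => ?_⟩
  simp only [h1 _ v]
  refine (HasDerivAt.fun_sum fun i _ =>
    (FamFun.hasDerivAt (hα _ (he i)) t y).const_mul (dform I (q i) y v)).congr_deriv ?_
  simp only [LinearMap.sum_apply, LinearMap.smul_apply, smul_eq_mul]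
  exact Finset.sum_congr rfl fun i _ => mul_comm _ _

end Families

section Pushforward

variable {E : Type*} [NormedAddCommGroup E] [NormedSpace ℝ E] [FiniteDimensional ℝ E]
  {H : Type*} [TopologicalSpace H] {I : ModelWithCorners ℝ E H}
  {M : Type*} [TopologicalSpace M] [ChartedSpace H M] [IsManifold I ∞ M]

theorem mfderiv_symm_apply (φ : M ≃ₘ^∞⟮I, I⟯ M) (x : M) (v : TangentSpace I x) :
    mfderiv I I φ.symm (φ x) (mfderiv I I φ x v) = v := by
  have h1 := (φ.symm.contMDiff.mdifferentiable (by simp) (φ x)).hasMFDerivAt.comp x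
    (φ.contMDiff.mdifferentiable (by simp) x).hasMFDerivAt
  have h2 : (φ.symm ∘ φ : M → M) = id := funext φ.symm_apply_apply
  rw [h2] at h1
  exact congrArg (fun L : E →L[ℝ] E => L v) (hasMFDerivAt_unique h1 (hasMFDerivAt_id x))

theorem mfderiv_apply_symm (φ : M ≃ₘ^∞⟮I, I⟯ M) (x : M) (v : TangentSpace I (φ x)) :
    mfderiv I I φ x (mfderiv I I φ.symm (φ x) v) = v := by
  have h1 := (φ.contMDiff.mdifferentiable (by simp) (φ.symm (φ x))).hasMFDerivAt.comp (φ x)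
    (φ.symm.contMDiff.mdifferentiable (by simp) (φ x)).hasMFDerivAt
  have h2 : (φ ∘ φ.symm : M → M) = id := funext φ.apply_symm_apply
  rw [h2] at h1
  have h3 := congrArg (fun L : E →L[ℝ] E => L v) (hasMFDerivAt_unique h1 (hasMFDerivAt_id (φ x)))
  have h4 : ∀ z, z = x → (mfderiv I I φ z : E →L[ℝ] E) = mfderiv I I φ x := by
    rintro z rfl
    rfl
  have h5 : ((mfderiv I I φ (φ.symm (φ x)) : E →L[ℝ] E)) (mfderiv I I φ.symm (φ x) v : E) = v := h3
  rw [h4 _ (φ.symm_apply_apply x)] at h5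
  exact h5

theorem dform_comp_mfderiv (φ : M ≃ₘ^∞⟮I, I⟯ M) {f : M → ℝ} (hf : ContMDiff I 𝓘(ℝ, ℝ) ∞ f) (x : M) :
    dform I f (φ x) ∘ₗ (mfderiv I I φ x).toLinearMap = dform I (fun y => f (φ y)) x := by
  ext v
  have h1 := ((hf (φ x)).mdifferentiableAt (by simp)).hasMFDerivAt.comp x
    (φ.contMDiff.mdifferentiable (by simp) x).hasMFDerivAt
  exact congrArg (fun L : E →L[ℝ] ℝ => L v) h1.mfderiv.symm

theorem dform_comp_symm (φ : M ≃ₘ^∞⟮I, I⟯ M) {f : M → ℝ} (hf : ContMDiff I 𝓘(ℝ, ℝ) ∞ f) {x : M}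
    {a : Cotangent I (φ x)} (ha : dform I f x = a ∘ₗ (mfderiv I I φ x).toLinearMap) :
    dform I (fun y => f (φ.symm y)) (φ x) = a := by
  have h1 := dform_comp_mfderiv φ (hf.comp φ.symm.contMDiff) x
  have h2 : (fun y => (f ∘ φ.symm) (φ y)) = f := funext fun y => by simp
  rw [h2, ha] at h1
  ext v
  have h3 : dform I (f ∘ φ.symm) (φ x) (mfderiv I I φ x (mfderiv I I φ.symm (φ x) v))
      = a (mfderiv I I φ x (mfderiv I I φ.symm (φ x) v)) :=
    LinearMap.congr_fun h1 (mfderiv I I φ.symm (φ x) v)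
  rwa [mfderiv_apply_symm] at h3

theorem Pushforward.sharp {φ : M ≃ₘ^∞⟮I, I⟯ M} {P Q : BiField I M} (h : Pushforward φ P Q) (x : M)
    (a : Cotangent I (φ x)) : sharp I Q (φ x) a =
      mfderiv I I φ x (sharp I P x (a ∘ₗ (mfderiv I I φ x).toLinearMap)) := by
  refine Cotangent.eq_of_forall_apply fun b => ?_
  rw [apply_sharp, h]
  exact (apply_sharp I P x _ (b ∘ₗ (mfderiv I I φ x).toLinearMap)).symm

end Pushforward

section GaugeToIsotopy

variable {E : Type*} [NormedAddCommGroup E] [NormedSpace ℝ E] [FiniteDimensional ℝ E]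
  {H : Type*} [TopologicalSpace H] {I : ModelWithCorners ℝ E H}
  {M : Type*} [TopologicalSpace M] [ChartedSpace H M] [IsManifold I ∞ M] [T2Space M]
  (S : SplitRegularPoisson I M)

namespace SplitRegularPoisson

theorem hasDerivAt_apply {W : ℝ → BiField I M} (hW : FamBi I W)
    (hW0 : ∀ t x a, W t x a a = 0) (hI : ∀ t, S.MemI (W t)) (t : ℝ) (x : M) {α β : OneForm I M}
    (hβ : SmoothForm I β) :
    HasDerivAt (fun s => W s x (α x) (β x))
      (deriv (fun s => S.expG (W s) x (S.idAddGammaSharp (W t) x (α x))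
        (S.idAddGammaSharp (W t) x (β x))) t) t := by
  have hP := S.famBi_expG hW hI
  obtain ⟨b', hb'⟩ := FamForm.exists_hasDerivAt
    ((S.famEnd_idAddGammaSharp hW).apply (.of_smooth hβ)) t x
  set A := S.idAddGammaSharp (W t) x (α x)
  have h1 := hasDerivAt_dual_apply (L := fun s => S.expG (W s) x A) (hP.hasDerivAt t x A) hb'
  have h2 := hasDerivAt_dual_apply (L := fun _ => S.expG (W t) x A) (L' := fun _ => 0)
    (fun b => hasDerivAt_const t _) hb'
  have h3 := (h1.sub h2).const_add (W t x (α x) (β x))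
  refine (h3.congr_deriv (by ring)).congr_of_eventuallyEq (Eventually.of_forall fun s => ?_)
  have h4 := S.expG_sub_expG (hI t) (hI s) (hW0 s) x (α x) (β x)
  simp only [Pi.sub_apply]
  rw [h4]
  ring

theorem range_sharp_expG_sup {W : BiField I M} (hI : S.MemI W) (x : M) :
    LinearMap.range (sharp I (S.expG W) x) ⊔ S.G x = ⊤ := by
  refine eq_top_iff.2 fun v _ => ?_
  obtain ⟨a, ha⟩ := S.prF_mem x v
  have h1 := S.sharp_expG_idAddGammaSharp hI x a
  have h2 : v = sharp I (S.expG W) x (S.idAddGammaSharp W x a)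
      + (S.prG x v - S.prG x (sharp I W x a)) := by
    rw [h1, ha]
    conv_lhs => rw [← S.prF_add_prG x v]
    abel
  rw [h2]
  exact Submodule.add_mem_sup ⟨_, rfl⟩ (Submodule.sub_mem _ (S.prG_mem x _) (S.prG_mem x _))

theorem _root_.RegPoisson.Pushforward.transverse {φ : M ≃ₘ^∞⟮I, I⟯ M} {P Q : BiField I M}
    (h : Pushforward φ P Q) {G : ∀ x : M, Submodule ℝ (TangentSpace I x)}
    (hQ : ∀ x, LinearMap.range (RegPoisson.sharp I Q x) ⊔ G x = ⊤) :
    PushforwardTransverse φ (fun x => LinearMap.range (RegPoisson.sharp I P x)) G := by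
  intro x
  refine eq_top_iff.2 ((hQ (φ x)).ge.trans (sup_le_sup_right ?_ _))
  rintro _ ⟨a, rfl⟩
  rw [h.sharp x a]
  exact ⟨_, ⟨_, rfl⟩, rfl⟩

variable [I.Boundaryless] [CompactSpace M]

theorem exists_isotopy_of_gaugeEquivalent {W₀ W₁ : BiField I M} (h : S.GaugeEquivalent W₀ W₁) :
    ∃ φ : ℝ → M ≃ₘ^∞⟮I, I⟯ M, IsIsotopy φ ∧ Pushforward (φ 1) (S.expG W₀) (S.expG W₁) ∧
      ∀ t, PushforwardTransverse (φ t)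
        (fun x => LinearMap.range (sharp I (S.expG W₀) x)) S.G := by
  obtain ⟨W, X, hW, hX, rfl, rfl, hMC, hd⟩ := h
  set τ := Real.smoothTransition
  have hτ := smoothTransition_mem_Icc
  have hτmaps : ∀ p : ℝ × M, ((τ p.1, p.2) : ℝ × M) ∈ Icc (0 : ℝ) 1 ×ˢ univ :=
    fun p => ⟨hτ p.1, mem_univ _⟩
  have hWf : FamBi I (fun s => W (τ s)) := fun α β hα hβ => contMDiffOn_univ.1
    ((hW α β hα hβ).comp (contMDiff_smoothTransition_prod I M).contMDiffOn fun p _ => hτmaps p)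
  have hXf : FamVec I (fun s => X (τ s)) := FamVec.of_contMDiff (contMDiffOn_univ.1
    (ContMDiffOn.comp hX (contMDiff_smoothTransition_prod I M).contMDiffOn fun p _ => hτmaps p))
  have hI : ∀ s, S.MemI (W (τ s)) := fun s => (hMC _ (hτ s)).2
  have hWb : ∀ s, IsBivectorField I (W (τ s)) := fun s => (hMC _ (hτ s)).1.1.1
  set P : ℝ → BiField I M := fun s => S.expG (W (τ s)) with hPdef
  have hP : FamBi I P := S.famBi_expG hWf hI
  have hPb : ∀ s, IsBivectorField I (P s) := fun s => S.isBivectorField_expG (hWb s) (hI s)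
  set Z : ℝ → VecField I M := fun s =>
    S.prGField (X (τ s)) - sharpField I (P s) (S.gammaField (X (τ s))) with hZdef
  have hZ : FamVec I Z := (S.famVec_prGField hXf).sub (hP.sharp (S.famForm_gammaField hXf))
  have hτs : ContDiff ℝ ∞ (deriv τ) :=
    (contDiff_infty_iff_deriv.1 Real.smoothTransition.contDiff).2
  have hY : FamVec I (fun s => deriv τ s • Z s) := hZ.smul hτs
  obtain ⟨φ, hφs, hθ, hφ0, hφ⟩ := exists_flow hY (fun t ht => by
    rw [deriv_smoothTransition_of_notMem ht, zero_smul])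
  have hPd : ∀ s x α β, SmoothForm I α → SmoothForm I β →
      deriv (fun r => P r x (α x) (β x)) s =
        - (tangentLie I M).bracketVB (deriv τ s • Z s) (P s) α β x := by
    intro s x α β hα hβ
    have hK : ∀ α, SmoothForm I α → SmoothForm I
        (fun x => Ring.inverse (S.idAddGammaSharp (W (τ s)) x) (α x)) := fun α hα =>
      (((S.famEnd_idAddGammaSharp hWf).inverse hI).apply (.of_smooth hα)).slice s
    have h1 := S.hasDerivAt_apply hWf (fun t => (hWb t).1) hI s x (hK β hβ)
      (α := fun x => Ring.inverse (S.idAddGammaSharp (W (τ s)) x) (α x))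
    have h2 := (hd (τ s) (hτ s) _ _ (hK α hα) (hK β hβ) x).scomp_hasDerivAt s
      (hasDerivAt_smoothTransition s) hτ
    have h3 := h1.unique h2
    rw [← S.bracketVB_expG (hWb s) (hI s) (S.isPoisson_expG (hMC _ (hτ s)).1 (hI s))
      (hXf.slice s) (hK α hα) (hK β hβ) x] at h3
    simp only [S.exists_idAddGammaSharp_eq (hI s)] at h3
    rw [h3, bracketVB_const_smul (hZ.slice s), smul_eq_mul, mul_neg]
  have hpush : ∀ s, Pushforward (φ s) (P 0) (P s) := by
    intro s x a b
    obtain ⟨f, hf, hfx⟩ := exists_dform_eq x (a ∘ₗ (mfderiv I I (φ s) x).toLinearMap)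
    obtain ⟨g, hg, hgx⟩ := exists_dform_eq x (b ∘ₗ (mfderiv I I (φ s) x).toLinearMap)
    have hF : ∀ {f : M → ℝ}, ContMDiff I 𝓘(ℝ, ℝ) ∞ f → ∀ s,
        SmoothForm I (dform I (fun y => f ((φ s).symm y))) :=
      fun hf s => smoothForm_dform (hf.comp (φ s).symm.contMDiff)
    have h1 : ∀ r, HasDerivAt (fun s => P s (φ s x) (dform I (fun y => f ((φ s).symm y)) (φ s x))
        (dform I (fun y => g ((φ s).symm y)) (φ s x))) 0 r := fun r =>
      (hasDerivAt_transport hP hPb hY hθ hφ hf hg r x).congr_deriv (by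
        rw [hPd r (φ r x) _ _ (hF hf r) (hF hg r), neg_add_cancel])
    have h2 := is_const_of_deriv_eq_zero (fun r => (h1 r).differentiableAt)
      (fun r => (h1 r).deriv) s 0
    have h3 : ∀ ψ : M ≃ₘ^∞⟮I, I⟯ M, ψ = Diffeomorph.refl I M ∞ →
        P 0 (ψ x) (dform I (fun y => f (ψ.symm y)) (ψ x)) (dform I (fun y => g (ψ.symm y)) (ψ x))
          = P 0 x (dform I f x) (dform I g x) := by
      rintro ψ rfl
      rfl
    simp only [h3 _ hφ0, dform_comp_symm (φ s) hf hfx, dform_comp_symm (φ s) hg hgx] at h2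
    rw [h2, hfx, hgx]
  have hP0 : P 0 = S.expG (W 0) := by
    simp only [hPdef, τ, Real.smoothTransition.zero]
  have hP1 : P 1 = S.expG (W 1) := by
    simp only [hPdef, τ, Real.smoothTransition.one]
  refine ⟨φ, ⟨hφs.contMDiffOn, hφ0⟩, hP0 ▸ hP1 ▸ hpush 1, fun t => ?_⟩
  rw [← hP0]
  exact (hpush t).transverse (S.range_sharp_expG_sup (hI t))

end SplitRegularPoisson

end GaugeToIsotopy

section InverseFunction

variable {E : Type*} [NormedAddCommGroup E] [NormedSpace ℝ E] [FiniteDimensional ℝ E]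
  {H : Type*} [TopologicalSpace H] {I : ModelWithCorners ℝ E H} [I.Boundaryless]
  {M : Type*} [TopologicalSpace M] [ChartedSpace H M] [IsManifold I ∞ M]

/-- The inverse of a smooth bijection with injective differential is smooth. -/
theorem contMDiff_inverse {Ψ Θ : M → M} (hΨ : ContMDiff I I ∞ Ψ) (hΘΨ : ∀ p, Θ (Ψ p) = p)
    (hΨΘ : ∀ q, Ψ (Θ q) = q) (hd : ∀ p, Function.Injective (mfderiv I I Ψ p)) :
    ContMDiff I I ∞ Θ := by
  have := FiniteDimensional.complete ℝ E
  intro q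
  obtain ⟨p, rfl⟩ : ∃ p, Ψ p = q := ⟨_, hΨΘ q⟩
  set u := extChartAt I p
  set w := extChartAt I (Ψ p)
  let g : E → E := w ∘ Ψ ∘ u.symm
  have hg : ContDiffAt ℝ ∞ g (u p) := by
    have h := (contMDiffAt_iff.1 (hΨ p)).2
    rwa [I.range_eq_univ, contDiffWithinAt_univ] at h
  let D : E →L[ℝ] E := mfderiv I I Ψ p
  let L : E ≃L[ℝ] E := (LinearEquiv.ofInjectiveEndo (D : E →ₗ[ℝ] E) (hd p)).toContinuousLinearEquiv
  have hgd : HasFDerivAt g (L : E →L[ℝ] E) (u p) := by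
    have h : HasFDerivWithinAt g D (range I) (u p) :=
      ((hΨ p).mdifferentiableAt (by simp)).hasMFDerivAt.2
    rw [I.range_eq_univ, hasFDerivWithinAt_univ] at h
    exact h
  let e := hg.toOpenPartialHomeomorph g hgd (by simp)
  have hgu : g (u p) = w (Ψ p) := by
    change w (Ψ (u.symm (u p))) = _
    rw [extChartAt_to_inv]
  have hes : ContDiffAt ℝ ∞ e.symm (w (Ψ p)) := hgu ▸ hg.to_localInverse hgd (by simp)
  have htgt : w (Ψ p) ∈ e.target :=
    hgu ▸ e.map_source (hg.mem_toOpenPartialHomeomorph_source hgd (by simp))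
  have hsym : e.symm (w (Ψ p)) = u p := by
    rw [← hgu]
    exact e.left_inv (hg.mem_toOpenPartialHomeomorph_source hgd (by simp))
  have hw : ContMDiffAt I 𝓘(ℝ, E) ∞ w (Ψ p) := contMDiffAt_extChartAt
  have h1 : ContMDiffAt I 𝓘(ℝ, E) ∞ (fun q => e.symm (w q)) (Ψ p) :=
    ContMDiffAt.comp (g := e.symm) (Ψ p) hes.contMDiffAt hw
  have h2 : ContMDiffAt I I ∞ (fun q => u.symm (e.symm (w q))) (Ψ p) := by
    refine ContMDiffAt.comp (g := u.symm) (Ψ p) ?_ h1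
    rw [hsym]
    exact (contMDiffOn_extChartAt_symm p).contMDiffAt
      ((isOpen_extChartAt_target p).mem_nhds (mem_extChartAt_target p))
  refine h2.congr_of_eventuallyEq ?_
  have h3 : ContinuousAt (fun q => Ψ (u.symm (e.symm (w q)))) (Ψ p) :=
    ContinuousAt.comp (g := Ψ) hΨ.continuous.continuousAt h2.continuousAt
  have h4 : Ψ (u.symm (e.symm (w (Ψ p)))) = Ψ p := by rw [hsym, extChartAt_to_inv]
  have h5 : w.source ∈ 𝓝 (Ψ (u.symm (e.symm (w (Ψ p))))) := by
    rw [h4]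
    exact extChartAt_source_mem_nhds (Ψ p)
  filter_upwards [h3.eventually h5, extChartAt_source_mem_nhds (I := I) (Ψ p),
    hw.continuousAt.eventually (e.open_target.mem_nhds htgt)] with q hq1 hq2 hq3
  have h6 : w (Ψ (u.symm (e.symm (w q)))) = w q := e.right_inv hq3
  have h7 : Ψ (u.symm (e.symm (w q))) = q := w.injOn hq1 hq2 h6
  conv_lhs => rw [← h7]
  exact hΘΨ _

theorem mfderiv_family_apply {φ : ℝ → M ≃ₘ^∞⟮I, I⟯ M}
    (hφ : ContMDiff (𝓘(ℝ, ℝ).prod I) I ∞ (fun p : ℝ × M => φ p.1 p.2)) (t : ℝ) (x : M) (a : ℝ)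
    (v : TangentSpace I x) :
    mfderiv (𝓘(ℝ, ℝ).prod I) I (fun p : ℝ × M => φ p.1 p.2) (t, x) (a, v) =
      mfderiv 𝓘(ℝ, ℝ) I (fun s => φ s x) t a + mfderiv I I (φ t) x v :=
  mfderiv_prod_eq_add_apply (I := 𝓘(ℝ, ℝ)) (I' := I) (I'' := I) (v := (a, v))
    ((hφ (t, x)).mdifferentiableAt (by simp))

theorem contMDiff_family_symm {φ : ℝ → M ≃ₘ^∞⟮I, I⟯ M}
    (hφ : ContMDiff (𝓘(ℝ, ℝ).prod I) I ∞ (fun p : ℝ × M => φ p.1 p.2)) :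
    ContMDiff (𝓘(ℝ, ℝ).prod I) I ∞ (fun p : ℝ × M => (φ p.1).symm p.2) := by
  have hΨ : ContMDiff (𝓘(ℝ, ℝ).prod I) (𝓘(ℝ, ℝ).prod I) ∞ (fun p : ℝ × M => (p.1, φ p.1 p.2)) :=
    contMDiff_fst.prodMk hφ
  refine contMDiff_snd.comp (contMDiff_inverse (Θ := fun p => (p.1, (φ p.1).symm p.2)) hΨ
    (fun p => by simp) (fun p => by simp) ?_)
  rintro ⟨t, x⟩
  have h1 := (mdifferentiableAt_fst (I := 𝓘(ℝ, ℝ)) (I' := I) (x := (t, x))).mfderiv_prod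
    ((hφ (t, x)).mdifferentiableAt (by simp))
  refine (injective_iff_map_eq_zero (mfderiv (𝓘(ℝ, ℝ).prod I) (𝓘(ℝ, ℝ).prod I)
    (fun p : ℝ × M => (p.1, φ p.1 p.2)) (t, x))).2 ?_
  rintro ⟨a, v⟩ h0
  have h := (DFunLike.congr_fun h1 (a, v)).symm.trans h0
  have ha : a = 0 := by
    have h2 := congrArg Prod.fst h
    rw [mfderiv_fst] at h2
    exact h2
  have hv : mfderiv (𝓘(ℝ, ℝ).prod I) I (fun p : ℝ × M => φ p.1 p.2) (t, x) (a, v) = 0 :=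
    congrArg Prod.snd h
  have hv2 := (mfderiv_family_apply hφ t x a v).symm.trans hv
  have ha' : mfderiv 𝓘(ℝ, ℝ) I (fun s => φ s x) t a = 0 := ha ▸ map_zero _
  have hv3 : mfderiv I I (φ t) x v = 0 :=
    (zero_add _).symm.trans ((congrArg (· + mfderiv I I (φ t) x v) ha').symm.trans hv2)
  have hv' : v = 0 :=
    (mfderiv_symm_apply (φ t) x v).symm.trans ((congrArg _ hv3).trans (map_zero _))
  rw [ha, hv']
  rfl

end InverseFunction

section Pullback

variable {E : Type*} [NormedAddCommGroup E] [NormedSpace ℝ E] [FiniteDimensional ℝ E]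
  {H : Type*} [TopologicalSpace H] {I : ModelWithCorners ℝ E H}
  {M : Type*} [TopologicalSpace M] [ChartedSpace H M] [IsManifold I ∞ M]

/-- The pullback `φ^* α` of a one-form. -/
def pullForm (φ : M ≃ₘ^∞⟮I, I⟯ M) (α : OneForm I M) : OneForm I M :=
  fun x => α (φ x) ∘ₗ (mfderiv I I φ x).toLinearMap

/-- The push-forward `φ_* P` of a bivector field. -/
def pushBi (φ : M ≃ₘ^∞⟮I, I⟯ M) (P : BiField I M) : BiField I M := fun y =>
  let T : Cotangent I (φ (φ.symm y)) →ₗ[ℝ] Cotangent I (φ.symm y) :=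
    (mfderiv I I φ (φ.symm y)).toLinearMap.dualMap
  (P (φ.symm y)).compl₁₂ T T

theorem pushforward_pushBi (φ : M ≃ₘ^∞⟮I, I⟯ M) (P : BiField I M) :
    Pushforward φ P (pushBi φ P) := by
  intro x a b
  let D : M → E →L[ℝ] E := fun z => mfderiv I I φ z
  have h : ∀ z, z = x → (P z) ((D z).toLinearMap.dualMap a) ((D z).toLinearMap.dualMap b)
      = P x (a ∘ₗ (mfderiv I I φ x).toLinearMap) (b ∘ₗ (mfderiv I I φ x).toLinearMap) := by
    rintro z rfl
    rfl
  exact h _ (φ.symm_apply_apply x)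

theorem Pushforward.self {φ : M ≃ₘ^∞⟮I, I⟯ M} {P Q : BiField I M} (h : Pushforward φ P Q)
    (hP : ∀ x a, P x a a = 0) (y : M) (a : Cotangent I y) : Q y a a = 0 := by
  obtain ⟨x, rfl⟩ : ∃ x, φ x = y := ⟨φ.symm y, φ.apply_symm_apply y⟩
  rw [h, hP]

theorem Pushforward.apply_symm {φ : M ≃ₘ^∞⟮I, I⟯ M} {P Q : BiField I M} (h : Pushforward φ P Q)
    (α β : OneForm I M) (y : M) :
    Q y (α y) (β y) = P (φ.symm y) (pullForm φ α (φ.symm y)) (pullForm φ β (φ.symm y)) := by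
  obtain ⟨x, rfl⟩ : ∃ x, φ x = y := ⟨φ.symm y, φ.apply_symm_apply y⟩
  rw [h]
  have h1 : ∀ z, z = x → P x (pullForm φ α x) (pullForm φ β x)
      = P z (pullForm φ α z) (pullForm φ β z) := by
    rintro z rfl
    rfl
  exact h1 _ (φ.symm_apply_apply x)

theorem mpullback_diffeo (φ : M ≃ₘ^∞⟮I, I⟯ M) (X : VecField I M) (x : M) :
    mfderiv I I φ x (VectorField.mpullback I I φ X x) = X (φ x) := by
  have h : (mfderiv I I φ x).IsInvertible :=
    ContinuousLinearMap.IsInvertible.of_inverse (g := mfderiv I I φ.symm (φ x))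
      (ContinuousLinearMap.ext (mfderiv_apply_symm φ x))
      (ContinuousLinearMap.ext (mfderiv_symm_apply φ x))
  rw [VectorField.mpullback_apply]
  exact DFunLike.congr_fun h.self_comp_inverse (X (φ x))

theorem pullForm_mpullback (φ : M ≃ₘ^∞⟮I, I⟯ M) (α : OneForm I M) (X : VecField I M) (x : M) :
    pullForm φ α x (VectorField.mpullback I I φ X x) = α (φ x) (X (φ x)) :=
  congrArg (α (φ x)) (mpullback_diffeo φ X x)

theorem vderiv_mpullback (φ : M ≃ₘ^∞⟮I, I⟯ M) (X : VecField I M) {f : M → ℝ}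
    (hf : ContMDiff I 𝓘(ℝ, ℝ) ∞ f) (x : M) :
    vderiv I (VectorField.mpullback I I φ X) (fun y => f (φ y)) x = vderiv I X f (φ x) := by
  rw [vderiv_eq_dform, ← dform_comp_mfderiv φ hf, vderiv_eq_dform]
  exact congrArg (dform I f (φ x)) (mpullback_diffeo φ X x)

theorem courant_pull (φ : M ≃ₘ^∞⟮I, I⟯ M) {e₁ e₂ e₃ : VecField I M × OneForm I M}
    (h₁ : SmoothGen e₁) (h₂ : SmoothGen e₂) (h₃ : SmoothGen e₃) (x : M) :
    courant (VectorField.mpullback I I φ e₁.1, pullForm φ e₁.2)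
      (VectorField.mpullback I I φ e₂.1, pullForm φ e₂.2)
      (VectorField.mpullback I I φ e₃.1, pullForm φ e₃.2) x = courant e₁ e₂ e₃ (φ x) := by
  have := FiniteDimensional.complete ℝ E
  have : IsManifold I (minSmoothness ℝ 2) M := by
    rw [minSmoothness_of_isRCLikeNormedField]
    exact IsManifold.of_le (n := ∞) ENat.LEInfty.out
  have hbr : ∀ {X Y : VecField I M}, SmoothVec I X → SmoothVec I Y →
      VectorField.mlieBracket I (VectorField.mpullback I I φ X) (VectorField.mpullback I I φ Y) x
        = VectorField.mpullback I I φ (VectorField.mlieBracket I X Y) x := fun hX hY =>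
    (VectorField.mpullback_mlieBracket (hX.mdifferentiableAt _) (hY.mdifferentiableAt _)
      (φ.contMDiff x) (by rw [minSmoothness_of_isRCLikeNormedField]; exact ENat.LEInfty.out)).symm
  have hp : ∀ {e f : VecField I M × OneForm I M}, SmoothGen e → SmoothGen f →
      ContMDiff I 𝓘(ℝ, ℝ) ∞ (fun y => e.2 y (f.1 y)) := fun he hf => he.2 _ hf.1
  simp only [courant]
  rw [hbr h₁.1 h₂.1, hbr h₁.1 h₃.1, hbr h₂.1 h₃.1]
  simp only [pullForm_mpullback]
  rw [vderiv_mpullback φ _ (hp h₂ h₃), vderiv_mpullback φ _ (hp h₁ h₃),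
    vderiv_mpullback φ _ (hp h₁ h₂)]

theorem Pushforward.graphSec {φ : M ≃ₘ^∞⟮I, I⟯ M} {P Q : BiField I M} (h : Pushforward φ P Q)
    (α : OneForm I M) : (VectorField.mpullback I I φ (graphSec I Q α).1, pullForm φ α)
      = RegPoisson.graphSec I P (pullForm φ α) := by
  refine Prod.ext (funext fun x => ?_) rfl
  have h1 := mpullback_diffeo φ (sharpField I Q α) x
  rw [sharpField, h.sharp] at h1
  have h2 := congrArg (mfderiv I I φ.symm (φ x)) h1
  rwa [mfderiv_symm_apply, mfderiv_symm_apply] at h2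

end Pullback

section Families

variable {E : Type*} [NormedAddCommGroup E] [NormedSpace ℝ E] [FiniteDimensional ℝ E]
  {H : Type*} [TopologicalSpace H] {I : ModelWithCorners ℝ E H} [I.Boundaryless]
  {M : Type*} [TopologicalSpace M] [ChartedSpace H M] [IsManifold I ∞ M] [T2Space M]

theorem SmoothForm.contMDiff_section {E' : Type*} [NormedAddCommGroup E'] [NormedSpace ℝ E']
    {H' : Type*} [TopologicalSpace H'] {J : ModelWithCorners ℝ E' H'}
    {N : Type*} [TopologicalSpace N] [ChartedSpace H' N] {α : OneForm I M} (hα : SmoothForm I α)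
    {b : N → M} {X : ∀ p, TangentSpace I (b p)}
    (hX : ContMDiff J I.tangent ∞ (fun p => (⟨b p, X p⟩ : TangentBundle I M))) :
    ContMDiff J 𝓘(ℝ, ℝ) ∞ (fun p => α (b p) (X p)) := by
  intro p₀
  have hb : ContMDiff J I ∞ b := (Bundle.contMDiff_proj (TangentSpace I)).comp hX
  obtain ⟨e, q, he, hq, hf⟩ := exists_frame (I := I) (b p₀)
  have h : ContMDiffAt J 𝓘(ℝ, ℝ) ∞
      (fun p => ∑ i, α (b p) (e i (b p)) * dform I (q i) (b p) (X p)) p₀ :=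
    contMDiffAt_finsetSum fun i _ => (((hα (e i) (he i)).comp hb) p₀).mul
      (contMDiffAt_mfderiv_section (hq i) (hX p₀).contMDiffWithinAt)
  refine h.congr_of_eventuallyEq ?_
  filter_upwards [hb.continuous.continuousAt.eventually hf] with p hp
  conv_lhs => rw [Cotangent.eq_sum_of_frame hp.2 (α (b p))]
  simp [LinearMap.sum_apply]

theorem contMDiff_mfderiv_suspension {φ : ℝ → M ≃ₘ^∞⟮I, I⟯ M}
    (hφ : ContMDiff (𝓘(ℝ, ℝ).prod I) I ∞ (fun p : ℝ × M => φ p.1 p.2))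
    {Y : ℝ → VecField I M} (hY : FamVec I Y) :
    ContMDiff (𝓘(ℝ, ℝ).prod I) I.tangent ∞ (fun p : ℝ × M => (⟨φ p.1 p.2,
      mfderiv 𝓘(ℝ, ℝ) I (fun s => φ s p.2) p.1 (1 : ℝ) + mfderiv I I (φ p.1) p.2 (Y p.1 p.2)⟩ :
      TangentBundle I M)) := by
  have h := (hφ.contMDiff_tangentMap (m := ∞) (by simp)).comp (smooth_suspension hY)
  refine h.congr fun p => ?_
  exact congrArg (Bundle.TotalSpace.mk (E := TangentSpace I) (φ p.1 p.2))
    (mfderiv_family_apply hφ p.1 p.2 1 (Y p.1 p.2)).symm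

theorem famVec_zero : FamVec I (fun _ => (0 : VecField I M)) := fun α hα => by
  simpa [FamFun] using contMDiff_const

theorem SmoothForm.famForm_pullForm {α : OneForm I M} (hα : SmoothForm I α)
    {φ : ℝ → M ≃ₘ^∞⟮I, I⟯ M}
    (hφ : ContMDiff (𝓘(ℝ, ℝ).prod I) I ∞ (fun p : ℝ × M => φ p.1 p.2)) :
    FamForm I (fun t => pullForm (φ t) α) := fun X hX => by
  have h1 := hα.contMDiff_section (contMDiff_mfderiv_suspension hφ (FamVec.of_smooth hX))
  have h2 := hα.contMDiff_section (contMDiff_mfderiv_suspension hφ famVec_zero)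
  refine (h1.sub h2).congr fun p => ?_
  have h3 : mfderiv I I (φ p.1) p.2 ((0 : VecField I M) p.2) = 0 := map_zero _
  rw [h3, map_add, add_zero, add_sub_cancel_left]
  rfl

theorem IsBivectorField.famBi_pushforward {P : BiField I M} (hP : IsBivectorField I P)
    {φ : ℝ → M ≃ₘ^∞⟮I, I⟯ M}
    (hφ : ContMDiff (𝓘(ℝ, ℝ).prod I) I ∞ (fun p : ℝ × M => φ p.1 p.2))
    {Q : ℝ → BiField I M} (hQ : ∀ t, Pushforward (φ t) P (Q t)) :
    FamBi I Q := fun α β hα hβ => by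
  have h := (FamBi.of_smooth hP).pairing (hα.famForm_pullForm hφ) (hβ.famForm_pullForm hφ)
  exact (ContMDiff.comp h (contMDiff_fst.prodMk (contMDiff_family_symm hφ))).congr fun p =>
    (hQ p.1).apply_symm α β p.2

theorem IsPoisson.pushforward {P Q : BiField I M} (hP : IsPoisson P) {φ : M ≃ₘ^∞⟮I, I⟯ M}
    (h : Pushforward φ P Q) : IsPoisson Q := by
  have hφ : ContMDiff (𝓘(ℝ, ℝ).prod I) I ∞ (fun p : ℝ × M => φ p.2) :=
    φ.contMDiff.comp contMDiff_snd
  have hb : IsBivectorField I Q := ⟨h.self hP.1.1, fun α β hα hβ =>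
    ((hP.1.famBi_pushforward (φ := fun _ => φ) hφ (fun _ => h)) α β hα hβ).slice 0⟩
  have hs : ∀ {α : OneForm I M}, SmoothForm I α → SmoothForm I (pullForm φ α) :=
    fun hα => (hα.famForm_pullForm (φ := fun _ => φ) hφ).slice 0
  refine ⟨hb, fun α β δ hα hβ hδ y => ?_⟩
  obtain ⟨x, rfl⟩ : ∃ x, φ x = y := ⟨φ.symm y, φ.apply_symm_apply y⟩
  have h1 := hP.2 _ _ _ (hs hα) (hs hβ) (hs hδ) x
  rw [schoutenBB_self_eq_courant] at h1 ⊢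
  rw [← courant_pull φ (hb.smoothGen hα) (hb.smoothGen hβ) (hb.smoothGen hδ), ← h1,
    ← h.graphSec, ← h.graphSec, ← h.graphSec]
  rfl

/-- The velocity of a family of diffeomorphisms, as a time-dependent vector field. -/
def velocity (φ : ℝ → M ≃ₘ^∞⟮I, I⟯ M) (t : ℝ) : VecField I M := fun y =>
  (show E from mfderiv 𝓘(ℝ, ℝ) I (fun s => φ s ((φ t).symm y)) t (1 : ℝ))

theorem famVec_velocity {φ : ℝ → M ≃ₘ^∞⟮I, I⟯ M}
    (hφ : ContMDiff (𝓘(ℝ, ℝ).prod I) I ∞ (fun p : ℝ × M => φ p.1 p.2)) :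
    FamVec I (velocity φ) := by
  refine FamVec.of_contMDiff ((ContMDiff.comp (contMDiff_mfderiv_suspension hφ famVec_zero)
    (contMDiff_fst.prodMk (contMDiff_family_symm hφ))).congr fun p => ?_)
  have h : ∀ (y z : M) (v w : E), y = z → v = w →
      (⟨y, v⟩ : TangentBundle I M) = ⟨z, w⟩ := by
    rintro y z v w rfl rfl
    rfl
  refine h _ _ _ _ ((φ p.1).apply_symm_apply p.2).symm ?_
  have h3 : mfderiv I I (φ p.1) ((φ p.1).symm p.2) ((0 : VecField I M) ((φ p.1).symm p.2)) = 0 :=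
    map_zero _
  exact ((congrArg _ h3).trans (add_zero _)).symm

theorem hasMFDerivAt_velocity {φ : ℝ → M ≃ₘ^∞⟮I, I⟯ M}
    (hφ : ContMDiff (𝓘(ℝ, ℝ).prod I) I ∞ (fun p : ℝ × M => φ p.1 p.2)) (t : ℝ) (x : M) :
    HasMFDerivAt 𝓘(ℝ, ℝ) I (fun s => φ s x) t
      ((1 : ℝ →L[ℝ] ℝ).smulRight (velocity φ t (φ t x))) := by
  have h : MDifferentiableAt 𝓘(ℝ, ℝ) I (fun s => φ s x) t :=
    ((hφ.comp (contMDiff_id.prodMk contMDiff_const)) t).mdifferentiableAt (by simp)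
  have h1 : ∀ z, z = x → (show E from mfderiv 𝓘(ℝ, ℝ) I (fun s => φ s z) t (1 : ℝ))
      = (show E from mfderiv 𝓘(ℝ, ℝ) I (fun s => φ s x) t (1 : ℝ)) := by
    rintro z rfl
    rfl
  let L : ℝ →L[ℝ] E := (1 : ℝ →L[ℝ] ℝ).smulRight (velocity φ t (φ t x) : E)
  let L' : ℝ →L[ℝ] E := mfderiv 𝓘(ℝ, ℝ) I (fun s => φ s x) t
  have h2 : L = L' := ContinuousLinearMap.ext_ring
    ((one_smul ℝ _).trans (h1 _ ((φ t).symm_apply_apply x)))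
  change HasMFDerivAt 𝓘(ℝ, ℝ) I (fun s => φ s x) t L
  rw [h2]
  exact h.hasMFDerivAt

end Families

section PushforwardRange

variable {E : Type*} [NormedAddCommGroup E] [NormedSpace ℝ E] [FiniteDimensional ℝ E]
  {H : Type*} [TopologicalSpace H] {I : ModelWithCorners ℝ E H}
  {M : Type*} [TopologicalSpace M] [ChartedSpace H M] [IsManifold I ∞ M]

theorem Pushforward.range_sharp {φ : M ≃ₘ^∞⟮I, I⟯ M} {P Q : BiField I M} (h : Pushforward φ P Q)
    (x : M) : LinearMap.range (RegPoisson.sharp I Q (φ x)) =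
      (LinearMap.range (RegPoisson.sharp I P x)).map (mfderiv I I φ x).toLinearMap := by
  refine le_antisymm ?_ ?_
  · rintro _ ⟨a, rfl⟩
    rw [h.sharp x a]
    exact ⟨_, ⟨_, rfl⟩, rfl⟩
  · rintro _ ⟨_, ⟨a, rfl⟩, rfl⟩
    let D : TangentSpace I x →ₗ[ℝ] TangentSpace I (φ x) := (mfderiv I I φ x).toLinearMap
    let D' : TangentSpace I (φ x) →ₗ[ℝ] TangentSpace I x :=
      (show E →L[ℝ] E from mfderiv I I φ.symm (φ x)).toLinearMap
    have h1 : (a ∘ₗ D') ∘ₗ D = a :=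
      LinearMap.ext fun v => congrArg a (mfderiv_symm_apply φ x v)
    refine ⟨a ∘ₗ D', ?_⟩
    rw [h.sharp x]
    exact congrArg (fun b => mfderiv I I φ x (RegPoisson.sharp I P x b)) h1

end PushforwardRange

section IsotopyToGauge

variable {E : Type*} [NormedAddCommGroup E] [NormedSpace ℝ E] [FiniteDimensional ℝ E]
  {H : Type*} [TopologicalSpace H] {I : ModelWithCorners ℝ E H}
  {M : Type*} [TopologicalSpace M] [ChartedSpace H M] [IsManifold I ∞ M]
  (S : SplitRegularPoisson I M)

namespace SplitRegularPoisson

theorem finrank_G_add (x : M) :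
    2 * S.k + Module.finrank ℝ (S.G x) = Module.finrank ℝ (TangentSpace I x) := by
  rw [← S.rank_eq x]
  exact Submodule.finrank_add_eq_of_isCompl (S.isCompl x)

theorem isUnit_idSubGammaSharp {P : BiField I M} (hP : ∀ x a, P x a a = 0) {x : M}
    (hr : Module.finrank ℝ (LinearMap.range (sharp I P x)) ≤ 2 * S.k)
    (ht : LinearMap.range (sharp I P x) ⊔ S.G x = ⊤) : IsUnit (S.idSubGammaSharp P x) := by
  have hdisj : LinearMap.range (sharp I P x) ⊓ S.G x = ⊥ := by
    have h1 := Submodule.finrank_sup_add_finrank_inf_eq (LinearMap.range (sharp I P x)) (S.G x)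
    rw [ht, finrank_top] at h1
    have h2 := S.finrank_G_add x
    exact Submodule.finrank_eq_zero.1 (by omega)
  have hinj : Function.Injective (S.idSubGammaSharp P x) := by
    refine (injective_iff_map_eq_zero _).2 fun a ha => ?_
    have h0 : ∀ v, a (S.prG x v) = S.gammaFlat x (sharp I P x a) v := fun v => by
      have h1 := S.idSubGammaSharp_apply' P x a v
      rw [ha, LinearMap.zero_apply] at h1
      linarith
    have hG : ∀ v ∈ S.G x, a v = 0 := fun v hv => by
      rw [← S.prG_of_mem_G hv, h0, S.gammaFlat_apply_of_mem_G x _ hv]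
    have hγ : S.gammaFlat x (sharp I P x a) = 0 :=
      LinearMap.ext fun v => (h0 v).symm.trans (hG _ (S.prG_mem x v))
    have hF : S.prF x (sharp I P x a) = 0 := by
      have h1 := S.sharp_gammaFlat x (sharp I P x a)
      rw [hγ, map_zero] at h1
      exact neg_eq_zero.1 h1.symm
    have hz : sharp I P x a = 0 := by
      have h1 : sharp I P x a ∈ LinearMap.range (sharp I P x) ⊓ S.G x := by
        refine ⟨⟨a, rfl⟩, ?_⟩
        rw [← S.prF_add_prG x (sharp I P x a), hF, zero_add]
        exact S.prG_mem x _
      rw [hdisj] at h1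
      exact h1
    refine LinearMap.ext fun v => ?_
    obtain ⟨_, ⟨b, rfl⟩, w, hw, rfl⟩ := Submodule.mem_sup.1 (ht ▸ Submodule.mem_top : v ∈ _)
    rw [map_add, hG w hw, BiField.apply_sharp_swap hP, hz]
    simp
  exact (Module.End.isUnit_iff _).2 ⟨hinj, LinearMap.injective_iff_surjective.1 hinj⟩

theorem range_sharp_expG {W : BiField I M} (hI : S.MemI W) (x : M) :
    LinearMap.range (sharp I (S.expG W) x) =
      LinearMap.range (sharp I S.Pi x + S.prG x ∘ₗ sharp I W x) := by
  refine le_antisymm ?_ ?_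
  · rintro _ ⟨a, rfl⟩
    refine ⟨Ring.inverse (S.idAddGammaSharp W x) a, ?_⟩
    conv_rhs => rw [← S.exists_idAddGammaSharp_eq hI x a]
    exact (S.sharp_expG_idAddGammaSharp hI x _).symm
  · rintro _ ⟨a, rfl⟩
    exact ⟨_, S.sharp_expG_idAddGammaSharp hI x a⟩

theorem ker_le_ker_sharp_Pi (W : BiField I M) (x : M) :
    LinearMap.ker (sharp I S.Pi x + S.prG x ∘ₗ sharp I W x) ≤ LinearMap.ker (sharp I S.Pi x) := by
  intro a ha
  have h1 : sharp I S.Pi x a + S.prG x (sharp I W x a) = 0 := ha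
  have h2 := congrArg (S.prF x) h1
  rwa [map_add, S.prF_of_mem_G (S.prG_mem x _), add_zero, map_zero, S.prF_of_mem ⟨a, rfl⟩] at h2

theorem mem_dualAnnihilator_iff (x : M) (a : Cotangent I x) :
    a ∈ (S.TF x).dualAnnihilator ↔ sharp I S.Pi x a = 0 := by
  rw [Submodule.mem_dualAnnihilator]
  constructor
  · intro h
    refine Cotangent.eq_of_forall_apply fun b => ?_
    rw [BiField.apply_sharp_swap S.Pi_self, h _ ⟨b, rfl⟩, neg_zero, map_zero]
  · rintro h _ ⟨b, rfl⟩
    rw [BiField.apply_sharp_swap S.Pi_self, h, map_zero, neg_zero]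

theorem ker_sharp_Pi_le_ker {W : BiField I M} (hW : S.IsGood W) (x : M) :
    LinearMap.ker (sharp I S.Pi x) ≤ LinearMap.ker (sharp I S.Pi x + S.prG x ∘ₗ sharp I W x) := by
  intro a ha
  have ha' : sharp I S.Pi x a = 0 := ha
  change sharp I S.Pi x a + S.prG x (sharp I W x a) = 0
  rw [ha', zero_add]
  refine Cotangent.eq_of_forall_apply fun b => ?_
  have h1 : b ∘ₗ S.prG x ∈ (S.TF x).dualAnnihilator :=
    (Submodule.mem_dualAnnihilator _).2 fun v hv => by
      rw [LinearMap.comp_apply, S.prG_of_mem hv, map_zero]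
  have h2 := hW.2 x a ((S.mem_dualAnnihilator_iff x a).2 ha') _ h1
  rw [← apply_sharp] at h2
  rw [map_zero]
  exact h2

theorem finrank_range_sharp_expG {W : BiField I M} (hW : S.IsGood W) (hI : S.MemI W) (x : M) :
    Module.finrank ℝ (LinearMap.range (sharp I (S.expG W) x)) ≤ 2 * S.k := by
  rw [S.range_sharp_expG hI, ← S.rank_eq x]
  have h1 := (sharp I S.Pi x).finrank_range_add_finrank_ker
  have h2 := (sharp I S.Pi x + S.prG x ∘ₗ sharp I W x).finrank_range_add_finrank_ker
  have h3 := Submodule.finrank_mono (S.ker_sharp_Pi_le_ker hW x)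
  omega

theorem apply_eq_zero_of_finrank_le {W : BiField I M} (hI : S.MemI W) {x : M}
    (hr : Module.finrank ℝ (LinearMap.range (sharp I (S.expG W) x)) ≤ 2 * S.k)
    {a b : Cotangent I x} (ha : a ∈ (S.TF x).dualAnnihilator)
    (hb : b ∈ (S.TF x).dualAnnihilator) : W x a b = 0 := by
  rw [S.range_sharp_expG hI, ← S.rank_eq x] at hr
  have h1 := (sharp I S.Pi x).finrank_range_add_finrank_ker
  have h2 := (sharp I S.Pi x + S.prG x ∘ₗ sharp I W x).finrank_range_add_finrank_ker
  have h3 := Submodule.eq_of_le_of_finrank_le (S.ker_le_ker_sharp_Pi W x) (by omega)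
  have ha0 := (S.mem_dualAnnihilator_iff x a).1 ha
  have h4 : a ∈ LinearMap.ker (sharp I S.Pi x) := ha0
  rw [← h3] at h4
  have h5 : sharp I S.Pi x a + S.prG x (sharp I W x a) = 0 := h4
  rw [ha0, zero_add] at h5
  rw [← apply_sharp, ← S.prF_add_prG x (sharp I W x a), h5, add_zero]
  exact (Submodule.mem_dualAnnihilator _).1 hb _ (S.prF_mem x _)

variable [I.Boundaryless] [T2Space M]

theorem deriv_pushforward {P₀ : BiField I M} {P : ℝ → BiField I M} {φ : ℝ → M ≃ₘ^∞⟮I, I⟯ M}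
    (hφ : ContMDiff (𝓘(ℝ, ℝ).prod I) I ∞ (fun p : ℝ × M => φ p.1 p.2))
    (hP : FamBi I P) (hPb : ∀ t, IsBivectorField I (P t)) (hpush : ∀ t, Pushforward (φ t) P₀ (P t))
    {α β : OneForm I M} (hα : SmoothForm I α) (hβ : SmoothForm I β) (t : ℝ) (y : M) :
    deriv (fun s => P s y (α y) (β y)) t =
      - (tangentLie I M).bracketVB (velocity φ t) (P t) α β y := by
  obtain ⟨x, rfl⟩ : ∃ x, φ t x = y := ⟨(φ t).symm y, (φ t).apply_symm_apply y⟩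
  have hY := famVec_velocity hφ
  obtain ⟨f, hf, hfx⟩ := exists_dform_eq x (α (φ t x) ∘ₗ (mfderiv I I (φ t) x).toLinearMap)
  obtain ⟨g, hg, hgx⟩ := exists_dform_eq x (β (φ t x) ∘ₗ (mfderiv I I (φ t) x).toLinearMap)
  have h1 := hasDerivAt_transport hP hPb hY (contMDiff_family_symm hφ)
    (hasMFDerivAt_velocity hφ) hf hg t x
  have hd : ∀ {f : M → ℝ}, ContMDiff I 𝓘(ℝ, ℝ) ∞ f → ∀ s,
      dform I (fun y => f ((φ s).symm y)) (φ s x) ∘ₗ (mfderiv I I (φ s) x).toLinearMap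
        = dform I f x := fun {f} hf s => by
    refine (dform_comp_mfderiv (φ s) (hf.comp (φ s).symm.contMDiff) x).trans ?_
    simp only [Function.comp_apply, Diffeomorph.symm_apply_apply]
  have h2 : (fun s => P s (φ s x) (dform I (fun y => f ((φ s).symm y)) (φ s x))
      (dform I (fun y => g ((φ s).symm y)) (φ s x))) = fun _ => P₀ x (dform I f x) (dform I g x) :=
    funext fun s => by rw [hpush s x, hd hf, hd hg]
  rw [h2] at h1
  have h3 := h1.unique (hasDerivAt_const t _)
  have hfα := dform_comp_symm (φ t) hf hfx
  have hgβ := dform_comp_symm (φ t) hg hgx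
  have h4 : (tangentLie I M).bracketVB (velocity φ t) (P t)
      (dform I (fun y => f ((φ t).symm y))) (dform I (fun y => g ((φ t).symm y))) (φ t x) =
      (tangentLie I M).bracketVB (velocity φ t) (P t) α β (φ t x) :=
    bracketVB_congr (hY.slice t) (hPb t)
      (smoothForm_dform (hf.comp (φ t).symm.contMDiff)) hα
      (smoothForm_dform (hg.comp (φ t).symm.contMDiff)) hβ hfα hgβ
  rw [hfα, hgβ, h4] at h3
  linarith

theorem prGField_sub_sharpField {W : BiField I M} (hI : S.MemI W) (Y : VecField I M) :
    S.prGField (Y + sharpField I W (S.gammaField Y)) - sharpField I (S.expG W)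
      (S.gammaField (Y + sharpField I W (S.gammaField Y))) = Y := by
  funext x
  have h1 : S.gammaField (Y + sharpField I W (S.gammaField Y)) x
      = S.idAddGammaSharp W x (S.gammaFlat x (Y x)) := by
    rw [idAddGammaSharp_apply]
    exact map_add _ _ _
  change S.prG x (Y x + sharp I W x (S.gammaFlat x (Y x))) - sharp I (S.expG W) x
    (S.gammaField (Y + sharpField I W (S.gammaField Y)) x) = Y x
  rw [h1, S.sharp_expG_idAddGammaSharp hI, S.sharp_gammaFlat, map_add]
  conv_rhs => rw [← S.prF_add_prG x (Y x)]
  abel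

theorem gaugeEquivalent_of_isotopy {W₀ W₁ : BiField I M} (h₀ : S.IsMaurerCartan W₀)
    (h₀' : S.MemI W₀) (h₁ : S.IsMaurerCartan W₁) (h₁' : S.MemI W₁) {φ : ℝ → M ≃ₘ^∞⟮I, I⟯ M}
    (hφ : IsIsotopy φ) (hψ : Pushforward (φ 1) (S.expG W₀) (S.expG W₁))
    (ht : ∀ t ∈ Icc (0 : ℝ) 1, PushforwardTransverse (φ t)
      (fun x => LinearMap.range (sharp I (S.expG W₀) x)) S.G) : S.GaugeEquivalent W₀ W₁ := by
  set χ : ℝ → M ≃ₘ^∞⟮I, I⟯ M := fun s => φ (Real.smoothTransition s) with hχdef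
  have hχ : ContMDiff (𝓘(ℝ, ℝ).prod I) I ∞ (fun p : ℝ × M => χ p.1 p.2) :=
    contMDiffOn_univ.1 (ContMDiffOn.comp hφ.1 (contMDiff_smoothTransition_prod I M).contMDiffOn
      fun p _ => ⟨smoothTransition_mem_Icc p.1, mem_univ _⟩)
  have hPoi := S.isPoisson_expG h₀ h₀'
  set P : ℝ → BiField I M := fun s => pushBi (χ s) (S.expG W₀)
  have hpush : ∀ s, Pushforward (χ s) (S.expG W₀) (P s) := fun s => pushforward_pushBi _ _
  have hP : FamBi I P := hPoi.1.famBi_pushforward hχ hpush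
  have hPp : ∀ s, IsPoisson (P s) := fun s => hPoi.pushforward (hpush s)
  have hr : ∀ s y, Module.finrank ℝ (LinearMap.range (sharp I (P s) y)) ≤ 2 * S.k := fun s y => by
    obtain ⟨x, rfl⟩ : ∃ x, χ s x = y := ⟨(χ s).symm y, (χ s).apply_symm_apply y⟩
    rw [(hpush s).range_sharp]
    exact (Submodule.finrank_map_le _ _).trans (S.finrank_range_sharp_expG h₀.1 h₀' x)
  have hu : ∀ s y, IsUnit (S.idSubGammaSharp (P s) y) := fun s y => by
    refine S.isUnit_idSubGammaSharp (hPp s).1.1 (hr s y) ?_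
    obtain ⟨x, rfl⟩ : ∃ x, χ s x = y := ⟨(χ s).symm y, (χ s).apply_symm_apply y⟩
    rw [(hpush s).range_sharp]
    exact ht _ (smoothTransition_mem_Icc s) x
  set W : ℝ → BiField I M := fun s => S.logG (P s)
  have hW : FamBi I W := S.famBi_logG hP hu
  have hWI : ∀ s, S.MemI (W s) := fun s => S.memI_logG (hu s)
  have hWP : ∀ s, S.expG (W s) = P s := fun s => S.expG_logG (hu s)
  have hW0 : ∀ s x a, W s x a a = 0 := fun s => S.logG_self (hu s) (hPp s).1.1
  have hWb : ∀ s, IsBivectorField I (W s) := fun s =>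
    ⟨hW0 s, fun α β hα hβ => (hW α β hα hβ).slice s⟩
  have hMC : ∀ s, S.IsMaurerCartan (W s) := fun s =>
    S.isMaurerCartan_of_isPoisson ⟨hWb s, fun x a ha b hb =>
      S.apply_eq_zero_of_finrank_le (hWI s) ((hWP s).symm ▸ hr s x) ha hb⟩ (hWI s)
      ((hWP s).symm ▸ hPp s)
  have hY := famVec_velocity hχ
  have hX : FamVec I (fun s => velocity χ s + sharpField I (W s) (S.gammaField (velocity χ s))) :=
    hY.add (hW.sharp (S.famForm_gammaField hY))
  have huniq : ∀ {Q : BiField I M} {s : ℝ}, Pushforward (χ s) (S.expG W₀) Q → P s = Q := by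
    intro Q s hQ
    funext y
    obtain ⟨x, rfl⟩ : ∃ x, χ s x = y := ⟨(χ s).symm y, (χ s).apply_symm_apply y⟩
    ext a b
    rw [hpush s, hQ]
  refine ⟨W, fun s => velocity χ s + sharpField I (W s) (S.gammaField (velocity χ s)),
    fun α β hα hβ => (hW α β hα hβ).contMDiffOn, hX.contMDiff.contMDiffOn, ?_, ?_,
    fun t _ => ⟨hMC t, hWI t⟩, fun t _ α β hα hβ x => ?_⟩
  · refine S.expG_injective (hWI 0) h₀' h₀.1.1.1 ((hWP 0).trans (huniq ?_))
    have h1 : χ 0 = Diffeomorph.refl I M ∞ := by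
      rw [hχdef, ← hφ.2]
      simp
    rw [h1]
    intro x a b
    have h2 : (mfderiv I I (Diffeomorph.refl I M ∞) x).toLinearMap = LinearMap.id :=
      congrArg ContinuousLinearMap.toLinearMap (mfderiv_id (I := I) (x := x))
    rw [h2]
    rfl
  · refine S.expG_injective (hWI 1) h₁' h₁.1.1.1 ((hWP 1).trans (huniq ?_))
    have h1 : χ 1 = φ 1 := by simp [hχdef]
    rwa [h1]
  · rw [← S.bracketVB_expG (hWb t) (hWI t) (S.isPoisson_expG (hMC t) (hWI t)) (hX.slice t) hα hβ,
      S.prGField_sub_sharpField (hWI t), hWP t]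
    rw [← deriv_pushforward hχ hP (fun s => (hPp s).1) hpush
      (S.smooth_idAddGammaSharp (hWb t) hα) (S.smooth_idAddGammaSharp (hWb t) hβ)]
    have h1 := S.hasDerivAt_apply hW hW0 hWI t x hβ (α := α)
    simp only [hWP] at h1
    exact h1.hasDerivWithinAt

end SplitRegularPoisson

end IsotopyToGauge
end RegPoisson

end

theorem mainTheorem1 {E : Type*} [NormedAddCommGroup E] [NormedSpace ℝ E] [FiniteDimensional ℝ E]
    {H : Type*} [TopologicalSpace H] (I : ModelWithCorners ℝ E H) [I.Boundaryless]
    {M : Type*} [TopologicalSpace M] [ChartedSpace H M] [IsManifold I ∞ M]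
    [CompactSpace M] [T2Space M]
    (S : RegPoisson.SplitRegularPoisson I M)
    (W₀ W₁ : RegPoisson.BiField I M)
    (h₀ : S.IsMaurerCartan W₀) (h₀' : S.MemI W₀)
    (h₁ : S.IsMaurerCartan W₁) (h₁' : S.MemI W₁) :
    S.GaugeEquivalent W₀ W₁ ↔
      ∃ ψ : M ≃ₘ^∞⟮I, I⟯ M,
        RegPoisson.Pushforward ψ (S.expG W₀) (S.expG W₁) ∧
        ∃ φ : ℝ → M ≃ₘ^∞⟮I, I⟯ M,
          RegPoisson.IsIsotopy φ ∧ φ 1 = ψ ∧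
          ∀ t ∈ Icc (0 : ℝ) 1,
            RegPoisson.PushforwardTransverse (φ t)
              (fun x => LinearMap.range (RegPoisson.sharp I (S.expG W₀) x)) S.G := by
  refine ⟨fun h => ?_, ?_⟩
  · obtain ⟨φ, hφ, hψ, ht⟩ := S.exists_isotopy_of_gaugeEquivalent h
    exact ⟨φ 1, hψ, φ, hφ, rfl, fun t _ => ht t⟩
  · rintro ⟨_, hψ, φ, hφ, rfl, ht⟩
    exact S.gaugeEquivalent_of_isotopy h₀ h₀' h₁ h₁' hφ hψ ht
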